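/- Let $\alpha\in(0,1)$ and let $f:\mathbb{R}\to\mathbb{R}$ be real analytic on $\mathbb{R}\setminus\{0\}$ with $f(0)=0$ and $f(\alpha x)=\alpha f(x)$ for all $x\in\mathbb{R}$. Let $\Gamma=\{(x,f(x)):x\in\mathbb{R}\}\subset\mathbb{R}^2$, with arc length $ds$ and upward-pointing unit normal $n$, and let $D_\Gamma$ be the double-layer operator on $L^2(\Gamma)$, $$D_\Gamma\phi(x)=\frac1{2\pi}\int_\Gamma\frac{(x-y)\cdot n(y)}{|x-y|^2}\,\phi(y)\,ds(y)\qquad\text{for a.e. }x\in\Gamma,$$ the integral being a Cauchy principal value (this defines a unique bounded linear operator on $L^2(\Gamma)$). For a bounded operator $T$, $\sigma(T)$ is its spectrum and $\sigma_{\mathrm{ess}}(T)$ is the set of $\lambda\in\mathbb{C}$ such that $T-\lambda I$ is not Fredholm. For $x>0$ put $f_\pm(x)=f(\pm x)$. For $j\in\mathbb{Z}$ and $x,y\in\mathbb{R}$ let $$p_j^\pm(x,y)=\frac{(\alpha^y-\alpha^{x+j})f_\pm'(\alpha^y)+f_\pm(\alpha^{x+j})-f_\pm(\alpha^y)}{(\alpha^{x+j}-\alpha^y)^2},\qquad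 q_j^\pm(x,y)=\frac{f_\pm(\alpha^{x+j})-f_\pm(\alpha^y)}{\alpha^{x+j}-\alpha^y}$$ if $x+j\neq y$, and $p_j^\pm(x,y)=\frac12f_\pm''(\alpha^y)$, $q_j^\pm(x,y)=f_\pm'(\alpha^y)$ if $x+j=y$; and let $$\tilde p_j^\pm(x,y)=\frac{(\alpha^y+\alpha^{x+j})f_\mp'(\alpha^y)+f_\pm(\alpha^{x+j})-f_\mp(\alpha^y)}{(\alpha^{x+j}+\alpha^y)^2},\qquad \tilde q_j^\pm(x,y)=\frac{f_\pm(\alpha^{x+j})-f_\mp(\alpha^y)}{\alpha^{x+j}+\alpha^y}.$$ For $t\in\mathbb{R}$ and $M\in\mathbb{N}$ define the kernels $$K_t^{\pm,M}(x,y)=\frac1{2\pi}\sum_{j=-M}^{M}e^{ijt}\frac{p_j^\pm(x,y)}{1+q_j^\pm(x,y)^2}\left(\frac{1+f_\pm'(\alpha^x)^2}{1+f_\pm'(\alpha^y)^2}\right)^{1/4}\alpha^{\frac{x+y+j}2}|\log\alpha|,$$ $$L_t^{\pm,M}(x,y)=\frac1{2\pi}\sum_{j=-M}^{M}e^{ijt}\frac{\tilde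 p_j^\pm(x,y)}{1+\tilde q_j^\pm(x,y)^2}\left(\frac{1+f_\pm'(\alpha^x)^2}{1+f_\mp'(\alpha^y)^2}\right)^{1/4}\alpha^{\frac{x+y+j}2}|\log\alpha|.$$ For $N\in\mathbb{N}=\{1,2,\dots\}$ let $x_{q,N}=(q-\frac12)/N$, $q=1,\dots,N$. For a kernel $k$, its Nyström operator on $C[0,1]$ is $\phi\mapsto\frac1N\sum_{q=1}^Nk(\cdot,x_{q,N})\phi(x_{q,N})$ and its Nyström matrix is the $N\times N$ matrix $\big(\frac1Nk(x_{p,N},x_{q,N})\big)_{p,q}$. Let $\tilde K_{t,N}^M$ be the operator on $(C[0,1])^2$, and $A_{t,N}^M$ the $2N\times2N$ matrix, whose $2\times2$ blocks are the Nyström operators, respectively Nyström matrices, of the kernels $$\begin{pmatrix}K_t^{-,M}&L_t^{-,M}\\L_t^{+,M}&K_t^{+,M}\end{pmatrix}.$$ Let $(m_N)_{N\in\mathbb{N}},(M_N)_{N\in\mathbb{N}}\subset\mathbb{N}$ be sequences with $m_N,M_N\to\infty$ as $N\to\infty$, and let $T_N=\{\pm(k-\frac12)\pi/m_N:k=1,\dots,m_N\}$.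 Then, for every $N\in\mathbb{N}$, $$\sigma^N(D_\Gamma):=\bigcup_{t\in T_N}\sigma\big(\tilde K_{t,N}^{M_N}\big)=\{0\}\cup\bigcup_{t\in T_N}\sigma\big(A_{t,N}^{M_N}\big),$$ $\sigma(D_\Gamma)=\sigma_{\mathrm{ess}}(D_\Gamma)$, and $\sigma^N(D_\Gamma)\to\sigma(D_\Gamma)$ in the Hausdorff metric as $N\to\infty$. -/

import Mathlib

open Filter Topology MeasureTheory Set

noncomputable section

/-- A two-sided dilation-invariant graph in the plane that is analytic off `0`: the graph of
`f : ℝ → ℝ`, real analytic on `ℝ \ {0}`, with `f 0 = 0` and `f (α x) = α f x` for one given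
`α ∈ (0,1)`. -/
structure AnalyticDilationGraph where
  f : ℝ → ℝ
  α : ℝ
  α_pos : 0 < α
  α_lt_one : α < 1
  analytic : AnalyticOnNhd ℝ f {0}ᶜ
  map_zero : f 0 = 0
  dilation : ∀ x : ℝ, f (α * x) = α * f x

/-- The plane with its Euclidean norm. -/
abbrev Plane : Type := EuclideanSpace ℝ (Fin 2)

/-- The essential spectrum: all `z` for which `T - z I` is not Fredholm. -/
def essentialSpectrum {E : Type*} [NormedAddCommGroup E] [NormedSpace ℂ E]
    (T : E →L[ℂ] E) : Set ℂ :=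
  {z : ℂ | ¬ (T - z • ContinuousLinearMap.id ℂ E).IsFredholm}

/-- The nodes `(q - 1/2) / N`, `q = 1, …, N`, of the midpoint rule on `[0,1]`
(`q` is counted from `0` here). -/
def midpointNode (N : ℕ) (q : Fin N) : ℝ := ((q : ℝ) + 1 / 2) / N

theorem midpointNode_mem (N : ℕ) (q : Fin N) : midpointNode N q ∈ unitInterval := by
  have hq : (q : ℝ) + 1 ≤ N := by exact_mod_cast q.2
  have h0 : (0 : ℝ) ≤ (q : ℝ) := Nat.cast_nonneg _
  have hN : (0 : ℝ) < N := by linarith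
  refine ⟨?_, ?_⟩
  · unfold midpointNode; positivity
  · unfold midpointNode; rw [div_le_one hN]; linarith

/-- The midpoint-rule Nyström operator
`φ ↦ (1/N) ∑_q k(·, x_q) φ(x_q)` on `C[0,1]`. -/
def nystromOp (k : ℝ → ℝ → ℂ) (hk : ∀ y : ℝ, Continuous fun x => k x y) (N : ℕ) :
    C(unitInterval, ℂ) →L[ℂ] C(unitInterval, ℂ) :=
  (1 / (N : ℂ)) • ∑ q : Fin N,
    (ContinuousMap.evalCLM ℂ (⟨midpointNode N q, midpointNode_mem N q⟩ : unitInterval)).smulRight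
      (⟨fun x : unitInterval => k x (midpointNode N q),
        (hk _).comp continuous_subtype_val⟩ : C(unitInterval, ℂ))

theorem nystromOp_apply (k : ℝ → ℝ → ℂ) (hk : ∀ y : ℝ, Continuous fun x => k x y) (N : ℕ)
    (φ : C(unitInterval, ℂ)) (x : unitInterval) :
    nystromOp k hk N φ x = (1 / (N : ℂ)) *
      ∑ q : Fin N, k x (midpointNode N q) * φ ⟨midpointNode N q, midpointNode_mem N q⟩ := by
  simp [nystromOp, mul_comm]

/-- The `N × N` Nyström matrix with entries `(1/N) k(x_p, x_q)`. -/
def nystromMatrix (k : ℝ → ℝ → ℂ) (N : ℕ) : Matrix (Fin N) (Fin N) ℂ :=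
  Matrix.of fun p q => (1 / (N : ℂ)) * k (midpointNode N p) (midpointNode N q)

/-! ### The four truncated kernels

`u` and `v` stand for the two branches `f₊` and `f₋` of the graph, as functions on `(0,∞)`. -/

/-- `p_j(x,y)` for the diagonal kernels, with its continuous value on `x + j = y`. -/
def pDiag (α : ℝ) (u : ℝ → ℝ) (j : ℤ) (x y : ℝ) : ℝ :=
  if x + j = y then deriv (deriv u) (α ^ y) / 2
  else ((α ^ y - α ^ (x + j)) * deriv u (α ^ y) + u (α ^ (x + j)) - u (α ^ y))
    / (α ^ (x + j) - α ^ y) ^ 2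

/-- `q_j(x,y)` for the diagonal kernels, with its continuous value on `x + j = y`. -/
def qDiag (α : ℝ) (u : ℝ → ℝ) (j : ℤ) (x y : ℝ) : ℝ :=
  if x + j = y then deriv u (α ^ y)
  else (u (α ^ (x + j)) - u (α ^ y)) / (α ^ (x + j) - α ^ y)

/-- `p_j(x,y)` for the off-diagonal kernels. -/
def pOff (α : ℝ) (u v : ℝ → ℝ) (j : ℤ) (x y : ℝ) : ℝ :=
  ((α ^ y + α ^ (x + j)) * deriv v (α ^ y) + u (α ^ (x + j)) - v (α ^ y))
    / (α ^ (x + j) + α ^ y) ^ 2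

/-- `q_j(x,y)` for the off-diagonal kernels. -/
def qOff (α : ℝ) (u v : ℝ → ℝ) (j : ℤ) (x y : ℝ) : ℝ :=
  (u (α ^ (x + j)) - v (α ^ y)) / (α ^ (x + j) + α ^ y)

/-- The kernel obtained from `p_j` and `q_j` by summing over `|j| ≤ M` with Floquet parameter
`t`; `u` is the branch that carries `x` and `v` the branch that carries `y`. -/
def truncatedKernel (α : ℝ) (u v : ℝ → ℝ) (p q : ℤ → ℝ → ℝ → ℝ) (t : ℝ) (M : ℕ) (x y : ℝ) : ℂ :=
  1 / (2 * (Real.pi : ℂ)) * ∑ j ∈ Finset.Icc (-(M : ℤ)) (M : ℤ),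
    Complex.exp (Complex.I * (j : ℂ) * (t : ℂ)) *
      ((p j x y / (1 + q j x y ^ 2)
        * ((1 + deriv u (α ^ x) ^ 2) / (1 + deriv v (α ^ y) ^ 2)) ^ (1 / 4 : ℝ)
        * α ^ ((x + y + j) / 2) * |Real.log α| : ℝ) : ℂ)

/-- The truncated diagonal kernel for the branch `u`. -/
def diagKernel (α : ℝ) (u : ℝ → ℝ) (t : ℝ) (M : ℕ) : ℝ → ℝ → ℂ :=
  truncatedKernel α u u (pDiag α u) (qDiag α u) t M

/-- The truncated off-diagonal kernel, from the branch `v` to the branch `u`. -/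
def offKernel (α : ℝ) (u v : ℝ → ℝ) (t : ℝ) (M : ℕ) : ℝ → ℝ → ℂ :=
  truncatedKernel α u v (pOff α u v) (qOff α u v) t M

/-! ### Continuity of the kernels in `x` -/

theorem analyticAt_dslope {u : ℝ → ℝ} {a : ℝ} (hu : AnalyticAt ℝ u a) :
    AnalyticAt ℝ (dslope u a) a := by
  obtain ⟨p, hp⟩ := hu
  exact ⟨_, hp.has_fpower_series_dslope_fslope⟩

theorem deriv_dslope_self {u : ℝ → ℝ} {a : ℝ} (hu : AnalyticAt ℝ u a) :
    deriv (dslope u a) a = deriv (deriv u) a / 2 := by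
  have hd : AnalyticAt ℝ (dslope u a) a := analyticAt_dslope hu
  have h1 : deriv u =ᶠ[𝓝 a] fun x => dslope u a x + (x - a) * deriv (dslope u a) x := by
    filter_upwards [hd.eventually_analyticAt] with x hx
    have e : u = fun y => u a + (y - a) * dslope u a y := by
      funext y
      have := sub_smul_dslope u a y
      rw [smul_eq_mul] at this
      linarith
    have hder : HasDerivAt (fun y => u a + (y - a) * dslope u a y)
        (1 * dslope u a x + (x - a) * deriv (dslope u a) x) x :=
      ((((hasDerivAt_id x).sub_const a).mul hx.differentiableAt.hasDerivAt).const_add (u a))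
    rw [← e] at hder
    rw [hder.deriv, one_mul]
  have h2 : HasDerivAt (fun x => dslope u a x + (x - a) * deriv (dslope u a) x)
      (deriv (dslope u a) a + (1 * deriv (dslope u a) a + (a - a) * deriv (deriv (dslope u a)) a))
      a :=
    hd.differentiableAt.hasDerivAt.add
      (((hasDerivAt_id a).sub_const a).mul hd.deriv.differentiableAt.hasDerivAt)
  have h3 := h1.deriv_eq.trans h2.deriv
  rw [h3]; ring

theorem rpow_add_int_eq_iff {α : ℝ} (h0 : 0 < α) (h1 : α < 1) (j : ℤ) (x y : ℝ) :
    α ^ (x + j) = α ^ y ↔ x + j = y :=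
  (Real.strictAnti_rpow_of_base_lt_one h0 h1).injective.eq_iff

theorem qDiag_eq_dslope {α : ℝ} (h0 : 0 < α) (h1 : α < 1) (u : ℝ → ℝ) (j : ℤ) (x y : ℝ) :
    qDiag α u j x y = dslope u (α ^ y) (α ^ (x + j)) := by
  unfold qDiag
  split_ifs with h
  · rw [h, dslope_same]
  · rw [dslope_of_ne _ (fun e => h ((rpow_add_int_eq_iff h0 h1 j x y).1 e)), slope_def_field]

theorem pDiag_eq_dslope {α : ℝ} (h0 : 0 < α) (h1 : α < 1) {u : ℝ → ℝ}
    (hu : AnalyticOnNhd ℝ u (Ioi 0)) (j : ℤ) (x y : ℝ) :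
    pDiag α u j x y = dslope (dslope u (α ^ y)) (α ^ y) (α ^ (x + j)) := by
  unfold pDiag
  split_ifs with h
  · rw [h, dslope_same, deriv_dslope_self (hu _ (Real.rpow_pos_of_pos h0 y))]
  · have hne : α ^ (x + j) ≠ α ^ y := fun e => h ((rpow_add_int_eq_iff h0 h1 j x y).1 e)
    have hne' : α ^ (x + j) - α ^ y ≠ 0 := sub_ne_zero.2 hne
    rw [dslope_of_ne _ hne, slope_def_field, dslope_of_ne _ hne, slope_def_field, dslope_same]
    field_simp
    ring

theorem continuousAt_dslope_of_analyticAt {u : ℝ → ℝ} {a b : ℝ} (ha : DifferentiableAt ℝ u a)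
    (hb : ContinuousAt u b) : ContinuousAt (dslope u a) b := by
  by_cases h : b = a
  · subst h; exact continuousAt_dslope_same.2 ha
  · exact (continuousAt_dslope_of_ne h).2 hb

theorem continuous_rpow_exp {α : ℝ} (h0 : 0 < α) {g : ℝ → ℝ} (hg : Continuous g) :
    Continuous fun x => α ^ g x :=
  (Real.continuous_const_rpow h0.ne').comp hg

theorem continuous_comp_rpow {α : ℝ} (h0 : 0 < α) {u : ℝ → ℝ}
    (hu : ∀ b : ℝ, 0 < b → ContinuousAt u b) {g : ℝ → ℝ} (hg : Continuous g) :
    Continuous fun x => u (α ^ g x) := by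
  rw [continuous_iff_continuousAt]
  intro x
  exact ContinuousAt.comp (f := fun x => α ^ g x) (hu _ (Real.rpow_pos_of_pos h0 _))
    (continuous_rpow_exp h0 hg).continuousAt

theorem continuous_truncatedKernel {α : ℝ} (h0 : 0 < α) {u v : ℝ → ℝ}
    (hu : AnalyticOnNhd ℝ u (Ioi 0)) {p q : ℤ → ℝ → ℝ → ℝ} (y : ℝ)
    (hp : ∀ j, Continuous fun x => p j x y) (hq : ∀ j, Continuous fun x => q j x y)
    (t : ℝ) (M : ℕ) : Continuous fun x => truncatedKernel α u v p q t M x y := by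
  have hdu : Continuous fun x : ℝ => deriv u (α ^ x) :=
    continuous_comp_rpow h0 (fun b hb => (hu.deriv b hb).continuousAt) continuous_id
  unfold truncatedKernel
  refine continuous_const.mul (continuous_finsetSum _ fun j _ => continuous_const.mul
    (Complex.continuous_ofReal.comp ?_))
  refine (((Continuous.div (hp j) (by fun_prop) fun x => by positivity).mul ?_).mul ?_).mul
    continuous_const
  · exact Continuous.rpow_const (by fun_prop) fun x => Or.inr (by norm_num)
  · exact continuous_rpow_exp h0 (by fun_prop)

theorem continuous_diagKernel {α : ℝ} (h0 : 0 < α) (h1 : α < 1) {u : ℝ → ℝ}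
    (hu : AnalyticOnNhd ℝ u (Ioi 0)) (t : ℝ) (M : ℕ) (y : ℝ) :
    Continuous fun x => diagKernel α u t M x y := by
  have hy : AnalyticAt ℝ u (α ^ y) := hu _ (Real.rpow_pos_of_pos h0 y)
  have hc : ∀ b : ℝ, 0 < b → ContinuousAt (dslope u (α ^ y)) b := fun b hb =>
    continuousAt_dslope_of_analyticAt hy.differentiableAt (hu b hb).continuousAt
  refine continuous_truncatedKernel h0 hu y (fun j => ?_) (fun j => ?_) t M
  · simp only [pDiag_eq_dslope h0 h1 hu]
    exact continuous_comp_rpow h0 (fun b hb => continuousAt_dslope_of_analyticAt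
      (analyticAt_dslope hy).differentiableAt (hc b hb)) (by fun_prop)
  · simp only [qDiag_eq_dslope h0 h1]
    exact continuous_comp_rpow h0 hc (by fun_prop)

theorem continuous_offKernel {α : ℝ} (h0 : 0 < α) {u v : ℝ → ℝ}
    (hu : AnalyticOnNhd ℝ u (Ioi 0)) (t : ℝ) (M : ℕ) (y : ℝ) :
    Continuous fun x => offKernel α u v t M x y := by
  have hX : ∀ j : ℤ, Continuous fun x : ℝ => α ^ (x + j) :=
    fun j => continuous_rpow_exp h0 (by fun_prop)
  have hU : ∀ j : ℤ, Continuous fun x : ℝ => u (α ^ (x + j)) := fun j =>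
    continuous_comp_rpow h0 (fun b hb => (hu b hb).continuousAt) (by fun_prop)
  have hne : ∀ (j : ℤ) (x : ℝ), α ^ (x + j) + α ^ y ≠ 0 := fun j x =>
    (add_pos (Real.rpow_pos_of_pos h0 _) (Real.rpow_pos_of_pos h0 _)).ne'
  refine continuous_truncatedKernel h0 hu y (fun j => ?_) (fun j => ?_) t M
  · unfold pOff
    exact Continuous.div
      ((((continuous_const.add (hX j)).mul continuous_const).add (hU j)).sub continuous_const)
      (((hX j).add continuous_const).pow 2) fun x => pow_ne_zero 2 (hne j x)
  · unfold qOff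
    exact Continuous.div ((hU j).sub continuous_const) ((hX j).add continuous_const) (hne j)

namespace AnalyticDilationGraph

variable (Γ : AnalyticDilationGraph)

/-! ### The double-layer operator on `L²(Γ)` -/

/-- Arc length on `Γ`, as a measure on the plane: the image of `√(1 + f'(x)²) dx` under
`x ↦ (x, f x)`. -/
def arcLength : Measure Plane :=
  ((volume : Measure ℝ).withDensity
    fun x => ENNReal.ofReal (Real.sqrt (1 + deriv Γ.f x ^ 2))).map fun x => !₂[x, Γ.f x]

/-- `L²(Γ)`, complex valued, with respect to arc length. -/
abbrev L2 : Type := Lp ℂ 2 Γ.arcLength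

/-- The upward unit normal at a point of `Γ` (other than the origin). -/
def normal (y : Plane) : Plane :=
  (Real.sqrt (1 + deriv Γ.f (y 0) ^ 2))⁻¹ • !₂[-deriv Γ.f (y 0), 1]

/-- `D` is the double-layer operator on `L²(Γ)`: for every `φ` and almost every `x`,
`D φ (x) = (1/2π) ∫_Γ ((x - y) · n(y)) / |x - y|² φ(y) ds(y)`
as a Cauchy principal value. -/
def IsDoubleLayer (D : Γ.L2 →L[ℂ] Γ.L2) : Prop :=
  ∀ φ : Γ.L2, ∀ᵐ x ∂Γ.arcLength,
    Tendsto (fun ε : ℝ => ∫ y in {y : Plane | ε < dist x y},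
        ((1 / (2 * Real.pi) * (inner ℝ (x - y) (Γ.normal y) / ‖x - y‖ ^ 2) : ℝ) : ℂ) * φ y
          ∂Γ.arcLength)
      (𝓝[>] 0) (𝓝 (D φ x))

/-! ### The Nyström approximation -/

/-- The right branch `f₊(x) = f(x)`, used for `x > 0`. -/
def fPos (x : ℝ) : ℝ := Γ.f x

/-- The left branch `f₋(x) = f(-x)`, used for `x > 0`. -/
def fNeg (x : ℝ) : ℝ := Γ.f (-x)

theorem analytic_fPos : AnalyticOnNhd ℝ Γ.fPos (Ioi 0) :=
  fun x hx => Γ.analytic x (ne_of_gt hx)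

theorem analytic_fNeg : AnalyticOnNhd ℝ Γ.fNeg (Ioi 0) := fun x hx =>
  AnalyticAt.fun_comp (g := Γ.f) (f := fun y : ℝ => -y)
    (Γ.analytic (-x) (neg_ne_zero.2 (ne_of_gt hx))) analyticAt_id.neg

/-- The operator on `C[0,1] × C[0,1]` given by the `2 × 2` matrix of Nyström operators
`[[K⁻, L⁻], [L⁺, K⁺]]` of the truncated kernels; the first component belongs to the branch
`f₋`, the second to `f₊`. -/
def operator (t : ℝ) (M N : ℕ) :
    (C(unitInterval, ℂ) × C(unitInterval, ℂ)) →L[ℂ] (C(unitInterval, ℂ) × C(unitInterval, ℂ)) :=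
  ((nystromOp (diagKernel Γ.α Γ.fNeg t M)
        (continuous_diagKernel Γ.α_pos Γ.α_lt_one Γ.analytic_fNeg t M) N).coprod
      (nystromOp (offKernel Γ.α Γ.fNeg Γ.fPos t M)
        (continuous_offKernel Γ.α_pos Γ.analytic_fNeg t M) N)).prod
    ((nystromOp (offKernel Γ.α Γ.fPos Γ.fNeg t M)
        (continuous_offKernel Γ.α_pos Γ.analytic_fPos t M) N).coprod
      (nystromOp (diagKernel Γ.α Γ.fPos t M)
        (continuous_diagKernel Γ.α_pos Γ.α_lt_one Γ.analytic_fPos t M) N))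

/-- The `2N × 2N` truncated Nyström matrix `A_{t,N}^M`, with the same block structure. -/
def matrix (t : ℝ) (M N : ℕ) : Matrix (Fin N ⊕ Fin N) (Fin N ⊕ Fin N) ℂ :=
  Matrix.fromBlocks
    (nystromMatrix (diagKernel Γ.α Γ.fNeg t M) N)
    (nystromMatrix (offKernel Γ.α Γ.fNeg Γ.fPos t M) N)
    (nystromMatrix (offKernel Γ.α Γ.fPos Γ.fNeg t M) N)
    (nystromMatrix (diagKernel Γ.α Γ.fPos t M) N)

/-- The sample points `± (k - 1/2) π / m`, `k = 1, …, m`. -/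
def samplePoints (m : ℕ) : Set ℝ :=
  {t : ℝ | ∃ k : ℕ, 1 ≤ k ∧ k ≤ m ∧
    (t = ((k : ℝ) - 1 / 2) * Real.pi / m ∨ t = -(((k : ℝ) - 1 / 2) * Real.pi / m))}

/-- The approximation `σ^N(D_Γ)` of the spectrum of the double-layer operator: the union of the
spectra of the operators `operator t M N` over the sample points `t`. -/
def approxSpectrum (m M N : ℕ) : Set ℂ :=
  ⋃ t ∈ samplePoints m, spectrum ℂ (Γ.operator t M N)

end AnalyticDilationGraph

end

noncomputable section

/-! ### Compact operators and collectively compact convergence -/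

section CollectiveCompactness

variable {E : Type*} [NormedAddCommGroup E] [NormedSpace ℂ E]

/-! The substitution `x = ± α ^ s`, weighted by the square root of the arc-length density, maps
`L²(Γ)` unitarily onto `L²` of two copies of the line. Dilation invariance makes `f x / x`, `f'` and
`x f''` bounded off `0`, so the transformed kernel `kern` is continuous, is `O(α ^ (|s - r| / 2))`
and is invariant under simultaneous integer translations (`exists_kern_bound`, `kern_translate`). No
singular integral remains: the principal value is an absolutely convergent integral, Schur's test
gives boundedness, and the operator commutes with integer shifts.

Relative to the unit cells it is a block Laurent operator with blocks `A_j` satisfying `∑ (1 + |j|)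
‖A_j‖ < ∞` and symbol `∑ exp (i j t) A_j`. By Parseval, a uniform lower bound for symbol minus `l`
is one for the operator; with the same bound for the adjoint this gives `isUnit_of_symbol`.
Conversely, an eigenvector of the symbol yields truncated Bloch waves that are almost eigenvectors
(`mem_spectrum_of_symbol`). A shift has no nonzero finite-dimensional invariant subspace, so a
Fredholm operator commuting with it is invertible: spectrum and essential spectrum agree.

Each block maps into continuous functions on the closed cell, so the symbol is `J ∘ B(t)` with `J`
the extension by zero; off `0` its spectrum is that of the compact operator `B(t) ∘ J` on continuous
functions. Thus the nonzero spectrum is the union over `t` of the eigenvalues of `blochOp t`. The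
point `0` belongs to it because on a cell the operator is controlled by the `L¹` norm, hence is not
bounded below in `L²`.

The truncated Nyström operators converge to `blochOp` collectively compactly, even when `t`, `M`,
`N` vary together (Anselone's theory). Limits of eigenpairs are then eigenpairs, which gives upper
semicontinuity; the maximum principle for the resolvent gives lower semicontinuity. Compactness of
`[-π, π]` and of the spectrum, with the sample points becoming dense, turns this into Hausdorff
convergence. Finally, the Nyström operator is extension after evaluation at the nodes and the matrix
is evaluation after extension, so their spectra agree off `0`. -/

theorem finite_eigenvalues_of_isCompactOperator {T : E →L[ℂ] E} (hT : IsCompactOperator T)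
    {δ : ℝ} (hδ : 0 < δ) :
    {μ : ℂ | δ ≤ ‖μ‖ ∧ Module.End.HasEigenvalue (T : Module.End ℂ E) μ}.Finite := by
  by_contra hinf
  rw [← Set.Infinite] at hinf
  let μ : ℕ → ℂ := fun n => hinf.natEmbedding _ n
  have hμinj : Function.Injective μ := fun a b h => (hinf.natEmbedding _).injective (Subtype.ext h)
  have hμδ : ∀ n, δ ≤ ‖μ n‖ := fun n => (hinf.natEmbedding _ n).2.1
  choose v hv using fun n => (hinf.natEmbedding _ n).2.2.exists_hasEigenvector
  have hTv : ∀ n, T (v n) = μ n • v n := fun n => (hv n).apply_eq_smul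
  have hli : LinearIndependent ℂ v :=
    Module.End.eigenvectors_linearIndependent' _ μ hμinj v hv
  -- Riesz's argument: `T - μ n` maps `W (n + 1)` into `W n`, so unit-distance vectors `x n` chosen
  -- by Riesz's lemma, divided by `μ n`, have images at mutual distance at least `1`. They stay
  -- bounded because `‖μ n‖ ≥ δ`, contradicting compactness.
  let W : ℕ → Submodule ℂ E := fun n => Submodule.span ℂ (v '' Iio n)
  have hWfin : ∀ n, FiniteDimensional ℂ (W n) := fun n =>
    FiniteDimensional.span_of_finite ℂ ((Set.finite_Iio n).image v)
  have hWmono : ∀ {a b}, a ≤ b → W a ≤ W b := fun h =>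
    Submodule.span_mono (Set.image_mono (Set.Iio_subset_Iio h))
  have hvW : ∀ n, v n ∈ W (n + 1) := fun n =>
    Submodule.subset_span ⟨n, Nat.lt_succ_self n, rfl⟩
  have hvW' : ∀ n, v n ∉ W n := fun n =>
    hli.notMem_span_image (s := Iio n) (x := n) (by simp)
  have hTW : ∀ n x, x ∈ W n → T x ∈ W n := by
    intro n x hx
    induction hx using Submodule.span_induction with
    | mem x h =>
      obtain ⟨k, hk, rfl⟩ := h
      rw [hTv]; exact Submodule.smul_mem _ _ (Submodule.subset_span ⟨k, hk, rfl⟩)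
    | zero => simp
    | add x y _ _ hx hy => rw [map_add]; exact Submodule.add_mem _ hx hy
    | smul a x _ hx => rw [map_smul]; exact Submodule.smul_mem _ _ hx
  have hTW' : ∀ n x, x ∈ W (n + 1) → T x - μ n • x ∈ W n := by
    intro n x hx
    induction hx using Submodule.span_induction with
    | mem x h =>
      obtain ⟨k, hk, rfl⟩ := h
      rw [hTv]
      rcases (Nat.lt_succ_iff.1 hk).lt_or_eq with h | h
      · exact Submodule.sub_mem _ (Submodule.smul_mem _ _ (Submodule.subset_span ⟨k, h, rfl⟩))
          (Submodule.smul_mem _ _ (Submodule.subset_span ⟨k, h, rfl⟩))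
      · rw [h, sub_self]; exact Submodule.zero_mem _
    | zero => simp
    | add x y _ _ hx hy =>
      have : T (x + y) - μ n • (x + y) = (T x - μ n • x) + (T y - μ n • y) := by
        rw [map_add, smul_add]; abel
      rw [this]; exact Submodule.add_mem _ hx hy
    | smul a x _ hx =>
      have : T (a • x) - μ n • (a • x) = a • (T x - μ n • x) := by
        rw [map_smul, smul_sub, smul_comm]
      rw [this]; exact Submodule.smul_mem _ _ hx
  have hex : ∀ n, ∃ x ∈ W (n + 1), ‖x‖ ≤ 3 ∧ ∀ y ∈ W n, 1 ≤ ‖x - y‖ := by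
    intro n
    have hcl : IsClosed (((W n).submoduleOf (W (n + 1)) : Submodule ℂ (W (n + 1))) :
        Set (W (n + 1))) := Submodule.closed_of_finiteDimensional _
    obtain ⟨x, hx3, hx⟩ := riesz_lemma_of_norm_lt (𝕜 := ℂ) (c := 2) (R := 3) (by simp) (by norm_num)
      hcl ⟨⟨v n, hvW n⟩, fun h => hvW' n h⟩
    refine ⟨x, x.2, hx3, fun y hy => ?_⟩
    exact hx ⟨y, hWmono n.le_succ hy⟩ hy
  choose x hxW hx3 hx1 using hex
  let z : ℕ → E := fun n => (μ n)⁻¹ • x n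
  have hμ0 : ∀ n, μ n ≠ 0 := fun n h => by have := hμδ n; rw [h, norm_zero] at this; linarith
  have hz : ∀ n, ‖z n‖ ≤ δ⁻¹ * 3 := fun n => by
    simp only [z, norm_smul, norm_inv]
    exact mul_le_mul (inv_anti₀ hδ (hμδ n)) (hx3 n) (norm_nonneg _) (by positivity)
  have hfar : ∀ a b, a < b → 1 ≤ ‖T (z b) - T (z a)‖ := by
    intro a b hab
    have h1 : T (z a) ∈ W b := hTW _ _ (Submodule.smul_mem _ _ (hWmono hab (hxW a)))
    have h2 : T (z b) - x b ∈ W b := by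
      have := Submodule.smul_mem (W b) (μ b)⁻¹ (hTW' b (x b) (hxW b))
      rwa [smul_sub, inv_smul_smul₀ (hμ0 b), ← map_smul] at this
    have := hx1 b _ (Submodule.sub_mem _ h1 h2)
    rwa [show x b - (T (z a) - (T (z b) - x b)) = T (z b) - T (z a) by abel] at this
  obtain ⟨K, hK, hK'⟩ := hT.image_closedBall_subset_compact (δ⁻¹ * 3)
  obtain ⟨y, -, ψ, hψ, hψy⟩ := hK.tendsto_subseq (x := fun n => T (z n))
    (fun n => hK' ⟨z n, by simpa using hz n, rfl⟩)
  obtain ⟨N, hN⟩ := Metric.cauchySeq_iff'.1 hψy.cauchySeq 1 one_pos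
  have h := hN (N + 1) (Nat.le_succ N)
  rw [dist_eq_norm] at h
  exact absurd (hfar _ _ (hψ (Nat.lt_succ_self N))) (not_le.2 h)

/-- Only finitely many eigenvalues have modulus at least `‖l‖ / 2`, and a radius below `‖l‖ / 2`
keeps the circle in that region, away from `0`. The circle serves as contour for the maximum
principle. -/
theorem exists_circle_avoiding_eigenvalues {T : E →L[ℂ] E} (hT : IsCompactOperator T) {l : ℂ}
    (hl : l ≠ 0) {ε : ℝ} (hε : 0 < ε) :
    ∃ r, 0 < r ∧ r < ε ∧ ∀ μ : ℂ, ‖μ - l‖ = r →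
      μ ≠ 0 ∧ ¬ Module.End.HasEigenvalue (T : Module.End ℂ E) μ := by
  have hl' : 0 < ‖l‖ / 2 := by positivity
  have hfin := (finite_eigenvalues_of_isCompactOperator hT hl').image fun μ => ‖μ - l‖
  obtain ⟨r, ⟨hr0, hr⟩, hr'⟩ := ((Set.Ioo_infinite (lt_min hε hl')).sdiff hfin).nonempty
  have hn : ∀ μ : ℂ, ‖μ - l‖ = r → ‖l‖ / 2 ≤ ‖μ‖ := fun μ hμ => by
    have h1 := norm_sub_norm_le l μ
    rw [norm_sub_rev, hμ] at h1
    have := hr.trans_le (min_le_right _ _)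
    linarith
  refine ⟨r, hr0, hr.trans_le (min_le_left _ _), fun μ hμ => ⟨?_, fun h => hr' ⟨μ, ⟨hn μ hμ, h⟩, hμ⟩⟩⟩
  rintro rfl
  have := hn 0 hμ
  rw [norm_zero] at this
  linarith

/-- `T n` converges to `T₀` pointwise, and all `T n` map the unit ball into one compact set. -/
structure CollectivelyCompactTendsto (T : ℕ → E →L[ℂ] E) (T₀ : E →L[ℂ] E) : Prop where
  exists_compact : ∃ K : Set E, IsCompact K ∧ ∀ n φ, ‖φ‖ ≤ 1 → T n φ ∈ K
  tendsto : ∀ φ, Tendsto (fun n => T n φ) atTop (𝓝 (T₀ φ))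

namespace CollectivelyCompactTendsto

variable {T : ℕ → E →L[ℂ] E} {T₀ : E →L[ℂ] E}

theorem comp (h : CollectivelyCompactTendsto T T₀) {u : ℕ → ℕ} (hu : Tendsto u atTop atTop) :
    CollectivelyCompactTendsto (fun n => T (u n)) T₀ := by
  obtain ⟨K, hK, hTK⟩ := h.exists_compact
  exact ⟨⟨K, hK, fun n => hTK (u n)⟩, fun φ => (h.tendsto φ).comp hu⟩

theorem isCompactOperator (h : CollectivelyCompactTendsto T T₀) : IsCompactOperator T₀ := by
  obtain ⟨K, hK, hTK⟩ := h.exists_compact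
  refine (isCompactOperator_iff_image_closedBall_subset_compact (T₀ : E →ₗ[ℂ] E) one_pos).2
    ⟨K, hK, ?_⟩
  rintro _ ⟨φ, hφ, rfl⟩
  exact hK.isClosed.mem_of_tendsto (h.tendsto φ)
    (Eventually.of_forall fun n => hTK n φ (by simpa using hφ))

theorem exists_norm_le (h : CollectivelyCompactTendsto T T₀) : ∃ C : ℝ, 0 ≤ C ∧ ∀ n, ‖T n‖ ≤ C := by
  obtain ⟨K, hK, hTK⟩ := h.exists_compact
  obtain ⟨C, hC⟩ := hK.isBounded.exists_norm_le
  have hC0 : 0 ≤ C := (norm_nonneg _).trans (hC _ (hTK 0 0 (by simp)))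
  exact ⟨C, hC0, fun n => ContinuousLinearMap.opNorm_le_of_unit_norm hC0
    fun x hx => hC _ (hTK n x hx.le)⟩

/-- Limits of approximate eigenpairs are eigenpairs. -/
theorem hasEigenvalue_of_tendsto (h : CollectivelyCompactTendsto T T₀) {μ : ℕ → ℂ} {μ₀ : ℂ}
    (hμ : Tendsto μ atTop (𝓝 μ₀)) (hμ₀ : μ₀ ≠ 0) {φ : ℕ → E} (hφ : ∀ n, ‖φ n‖ = 1)
    (hTφ : Tendsto (fun n => T n (φ n) - μ n • φ n) atTop (𝓝 0)) :
    Module.End.HasEigenvalue (T₀ : Module.End ℂ E) μ₀ := by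
  obtain ⟨K, hK, hTK⟩ := h.exists_compact
  obtain ⟨C, hC0, hC⟩ := h.exists_norm_le
  obtain ⟨y, -, u, hu, huy⟩ := hK.tendsto_subseq (x := fun n => T n (φ n))
    (fun n => hTK n _ (hφ n).le)
  have hut := hu.tendsto_atTop
  have h1 : Tendsto (fun n => μ (u n) • φ (u n)) atTop (𝓝 y) := by
    have := huy.sub (hTφ.comp hut)
    simpa [Function.comp_def] using this
  -- Dividing by `μ`, which stays away from `0`, turns compactness of the images into convergence of
  -- the vectors themselves.
  have h2 : Tendsto (fun n => φ (u n)) atTop (𝓝 (μ₀⁻¹ • y)) := by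
    have h3 := ((hμ.comp hut).inv₀ hμ₀).smul h1
    refine h3.congr' ?_
    filter_upwards [(hμ.comp hut).eventually_ne hμ₀] with n hn
    exact inv_smul_smul₀ hn _
  set ψ := μ₀⁻¹ • y with hψ
  have hψ1 : ‖ψ‖ = 1 := tendsto_nhds_unique h2.norm (by simp [hφ])
  -- The uniform norm bound lets pointwise convergence be evaluated along a convergent sequence of
  -- arguments.
  have h4 : Tendsto (fun n => T (u n) (φ (u n))) atTop (𝓝 (T₀ ψ)) := by
    have h5 : Tendsto (fun n => T (u n) (φ (u n) - ψ)) atTop (𝓝 0) := by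
      refine squeeze_zero_norm (fun n => ((T (u n)).le_opNorm _).trans
        (mul_le_mul_of_nonneg_right (hC _) (norm_nonneg _))) ?_
      have := ((h2.sub_const ψ).norm).const_mul C
      simpa using this
    have := h5.add ((h.tendsto ψ).comp hut)
    simpa [Function.comp_def] using this
  have h6 : T₀ ψ = y := tendsto_nhds_unique h4 huy
  refine Module.End.hasEigenvalue_of_hasEigenvector (x := ψ)
    (Module.End.hasEigenvector_iff.2 ⟨Module.End.mem_eigenspace_iff.2 ?_, ?_⟩)
  · change T₀ ψ = μ₀ • ψ
    rw [h6, hψ, smul_inv_smul₀ hμ₀]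
  · rintro h0
    rw [h0, norm_zero] at hψ1
    exact zero_ne_one hψ1

/-- If the circle `‖μ - l‖ = r` contains no eigenvalue of the limit, then `T n - μ` is eventually
bounded below, uniformly in `μ` on the circle. -/
theorem eventually_bounded_below_on_circle (h : CollectivelyCompactTendsto T T₀) {l : ℂ} {r : ℝ}
    (hr : ∀ μ : ℂ, ‖μ - l‖ = r → μ ≠ 0 ∧ ¬ Module.End.HasEigenvalue (T₀ : Module.End ℂ E) μ) :
    ∃ c : ℝ, 0 < c ∧ ∀ᶠ n in atTop, ∀ μ : ℂ, ‖μ - l‖ = r → ∀ φ, c * ‖φ‖ ≤ ‖T n φ - μ • φ‖ := by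
  -- Failure for `c = 1 / (k + 1)` at some index beyond `k` gives unit approximate eigenvectors with
  -- parameters on a compact circle; a limit parameter would be an eigenvalue of `T₀` on the circle.
  by_contra! hcon
  have hk : ∀ k : ℕ, ∃ n, k ≤ n ∧ ∃ μ : ℂ, ‖μ - l‖ = r ∧ ∃ φ : E, ‖φ‖ = 1 ∧
      ‖T n φ - μ • φ‖ ≤ 1 / ((k : ℝ) + 1) := by
    intro k
    have hf := hcon (1 / ((k : ℝ) + 1)) (by positivity)
    obtain ⟨n, hn, μ, hμ, φ, hφ⟩ := (frequently_atTop.1 hf) k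
    have hφ0 : φ ≠ 0 := by
      rintro rfl
      simp at hφ
    have hφn : 0 < ‖φ‖ := norm_pos_iff.2 hφ0
    refine ⟨n, hn, μ, hμ, ((‖φ‖ : ℂ)⁻¹) • φ, ?_, ?_⟩
    · rw [norm_smul, norm_inv, Complex.norm_real, norm_norm, inv_mul_cancel₀ hφn.ne']
    · rw [map_smul, smul_comm, ← smul_sub, norm_smul, norm_inv, Complex.norm_real, norm_norm,
        inv_mul_le_iff₀ hφn, mul_comm]
      exact hφ.le
  choose n hn μ hμ φ hφ hTφ using hk
  have hsph : ∀ k, μ k ∈ Metric.sphere l r := fun k => by simpa [dist_eq_norm] using hμ k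
  obtain ⟨μ₀, hμ₀, u, hu, huμ⟩ := (isCompact_sphere l r).tendsto_subseq hsph
  have hμ₀' : ‖μ₀ - l‖ = r := by simpa [dist_eq_norm] using hμ₀
  have hn' : Tendsto n atTop atTop := tendsto_atTop_mono hn tendsto_id
  refine (hr μ₀ hμ₀').2 ((h.comp (hn'.comp hu.tendsto_atTop)).hasEigenvalue_of_tendsto huμ
    (hr μ₀ hμ₀').1 (fun k => hφ (u k)) ?_)
  exact (squeeze_zero_norm hTφ tendsto_one_div_add_atTop_nhds_zero_nat).comp hu.tendsto_atTop

/-- Lower semicontinuity of the spectrum off `0`. -/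
theorem eventually_exists_mem_spectrum [CompleteSpace E] (h : CollectivelyCompactTendsto T T₀)
    {l : ℂ} (hl : l ≠ 0) (hT₀ : Module.End.HasEigenvalue (T₀ : Module.End ℂ E) l) {ε : ℝ}
    (hε : 0 < ε) : ∀ᶠ n in atTop, ∃ μ ∈ spectrum ℂ (T n), ‖μ - l‖ < ε := by
  obtain ⟨r, hr0, hrε, hr⟩ := exists_circle_avoiding_eigenvalues h.isCompactOperator hl hε
  obtain ⟨c, hc, hev⟩ := h.eventually_bounded_below_on_circle hr
  obtain ⟨v, hv⟩ := hT₀.exists_hasEigenvector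
  have hv0 : 0 < ‖v‖ := norm_pos_iff.2 hv.2
  have hlim : Tendsto (fun n => ‖T n v - l • v‖) atTop (𝓝 0) := by
    have h1 := ((h.tendsto v).sub_const (l • v)).norm
    have h2 : T₀ v = l • v := hv.apply_eq_smul
    rwa [h2, sub_self, norm_zero] at h1
  filter_upwards [hev, hlim.eventually_lt_const (mul_pos hc hv0)] with n hn hnv
  -- Without spectrum near `l`, the resolvent is holomorphic on the closed disc and bounded by `c⁻¹`
  -- on the circle, hence also at `l`. But it sends `l v - T n v`, of norm below `c ‖v‖`, to `v`.
  -- Spectral projections are not needed.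
  by_contra! hcon
  have hres : ∀ μ : ℂ, ‖μ - l‖ ≤ r → μ ∈ resolventSet ℂ (T n) := fun μ hμ => by
    by_contra hμ'
    exact absurd (hcon μ hμ') (not_le.2 (hμ.trans_lt hrε))
  have hinv : ∀ μ : ℂ, ‖μ - l‖ ≤ r → ∀ y, resolvent (T n) μ (μ • y - T n y) = y ∧
      μ • resolvent (T n) μ y - T n (resolvent (T n) μ y) = y := fun μ hμ y => by
    have hu := spectrum.mem_resolventSet_iff.1 (hres μ hμ)
    have h1 := Ring.inverse_mul_cancel _ hu
    have h2 := Ring.mul_inverse_cancel _ hu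
    have h1' := congrArg (fun S : E →L[ℂ] E => S y) h1
    have h2' := congrArg (fun S : E →L[ℂ] E => S y) h2
    simp only [Algebra.algebraMap_eq_smul_one] at h1' h2'
    constructor
    · simpa [resolvent, Algebra.algebraMap_eq_smul_one] using h1'
    · simpa [resolvent, Algebra.algebraMap_eq_smul_one] using h2'
  have hdiff : DifferentiableOn ℂ (resolvent (T n)) (Metric.closedBall l r) := fun μ hμ =>
    (spectrum.hasDerivAt_resolvent_const_left
      (hres μ (by simpa [dist_eq_norm] using hμ))).differentiableAt.differentiableWithinAt
  have hdc : DiffContOnCl ℂ (resolvent (T n)) (Metric.ball l r) :=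
    (hdiff.mono (closure_ball l hr0.ne').le).diffContOnCl
  have hbd : ‖resolvent (T n) l‖ ≤ c⁻¹ := by
    refine Complex.norm_le_of_forall_mem_frontier_norm_le Metric.isBounded_ball hdc ?_
      (subset_closure (Metric.mem_ball_self hr0))
    intro μ hμ
    rw [frontier_ball l hr0.ne', mem_sphere_iff_norm] at hμ
    refine ContinuousLinearMap.opNorm_le_bound _ (by positivity) fun y => ?_
    have h1 := hn μ hμ (resolvent (T n) μ y)
    rw [norm_sub_rev, (hinv μ hμ.le y).2] at h1
    rwa [inv_mul_eq_div, le_div_iff₀ hc, mul_comm]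
  have h1 := (resolvent (T n) l).le_of_opNorm_le hbd (l • v - T n v)
  rw [(hinv l (by simpa using hr0.le) v).1, norm_sub_rev, inv_mul_eq_div, le_div_iff₀ hc] at h1
  linarith

end CollectivelyCompactTendsto

end CollectiveCompactness

/-- Sums of summable families, the terms of which vary in compact sets, vary in a compact set. -/
theorem isCompact_setOf_tsum {E : Type*} [NormedAddCommGroup E] [CompleteSpace E] {ι : Type*}
    {K : ι → Set E}
    (hK : ∀ i, IsCompact (K i)) {b : ι → ℝ} (hb : Summable b) (hKb : ∀ i, ∀ y ∈ K i, ‖y‖ ≤ b i) :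
    IsCompact ((fun y : ι → E => ∑' i, y i) '' Set.univ.pi K) := by
  refine (isCompact_univ_pi hK).image_of_continuousOn ?_
  exact continuousOn_tsum (fun i => (continuous_apply i).continuousOn) hb
    fun i y hy => hKb i _ (hy i (mem_univ i))

/-! ### Trigonometric sums with coefficients in a Hilbert space -/

/-- The character `t ↦ exp (i j t)`. -/
def phase (j : ℤ) (t : ℝ) : ℂ := Complex.exp (Complex.I * (j : ℂ) * (t : ℂ))

theorem norm_phase (j : ℤ) (t : ℝ) : ‖phase j t‖ = 1 := by
  rw [phase, show Complex.I * (j : ℂ) * (t : ℂ) = ((j * t : ℝ) : ℂ) * Complex.I by push_cast; ring]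
  exact Complex.norm_exp_ofReal_mul_I _

theorem phase_add (j k : ℤ) (t : ℝ) : phase (j + k) t = phase j t * phase k t := by
  rw [phase, phase, phase, ← Complex.exp_add]; push_cast; ring_nf

theorem continuous_phase (j : ℤ) : Continuous (phase j) := by unfold phase; fun_prop

theorem phase_periodic (j : ℤ) (t : ℝ) : phase j (t + 2 * Real.pi) = phase j t := by
  rw [phase, phase, Complex.exp_eq_exp_iff_exists_int]
  exact ⟨j, by push_cast; ring⟩

theorem conj_phase (j : ℤ) (t : ℝ) : (starRingEnd ℂ) (phase j t) = phase (-j) t := by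
  rw [phase, phase, ← Complex.exp_conj]
  simp [Complex.conj_ofReal]

theorem norm_phase_smul {F : Type*} [NormedAddCommGroup F] [NormedSpace ℂ F] (j : ℤ) (t : ℝ)
    (x : F) : ‖phase j t • x‖ = ‖x‖ := by rw [norm_smul, norm_phase, one_mul]

theorem integral_phase (j : ℤ) :
    ∫ t in (0 : ℝ)..(2 * Real.pi), phase j t = if j = 0 then ((2 * Real.pi : ℝ) : ℂ) else 0 := by
  split_ifs with h
  · subst h; simp [phase]
  · have hc : Complex.I * (j : ℂ) ≠ 0 := mul_ne_zero Complex.I_ne_zero (by exact_mod_cast h)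
    simp only [phase]
    rw [integral_exp_mul_complex hc]
    have := phase_periodic j 0
    simp only [phase, zero_add] at this
    rw [this, sub_self, zero_div]

section Parseval

variable {H : Type*} [NormedAddCommGroup H] [InnerProductSpace ℂ H]

theorem integral_norm_sq_sum_phase (s : Finset ℤ) (y : ℤ → H) :
    ∫ t in (0 : ℝ)..(2 * Real.pi), ‖∑ k ∈ s, phase k t • y k‖ ^ 2
      = 2 * Real.pi * ∑ k ∈ s, ‖y k‖ ^ 2 := by
  have key : ∀ t : ℝ, ((‖∑ k ∈ s, phase k t • y k‖ ^ 2 : ℝ) : ℂ)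
      = ∑ k ∈ s, ∑ l ∈ s, phase (l - k) t * inner ℂ (y k) (y l) := by
    intro t
    have h := inner_self_eq_norm_sq_to_K (𝕜 := ℂ) (∑ k ∈ s, phase k t • y k)
    push_cast
    refine Eq.trans h.symm ?_
    rw [sum_inner]
    refine Finset.sum_congr rfl fun k _ => ?_
    rw [inner_sum]
    refine Finset.sum_congr rfl fun l _ => ?_
    rw [inner_smul_left, inner_smul_right, conj_phase, ← mul_assoc, ← phase_add]
    congr 2; ring
  have h1 : ((∫ t in (0 : ℝ)..(2 * Real.pi), ‖∑ k ∈ s, phase k t • y k‖ ^ 2 : ℝ) : ℂ)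
      = ((2 * Real.pi * ∑ k ∈ s, ‖y k‖ ^ 2 : ℝ) : ℂ) := by
    rw [← intervalIntegral.integral_ofReal]
    simp only [key]
    rw [intervalIntegral.integral_finsetSum]
    · push_cast
      rw [Finset.mul_sum]
      refine Finset.sum_congr rfl fun k hk => ?_
      rw [intervalIntegral.integral_finsetSum]
      · simp only [intervalIntegral.integral_mul_const, integral_phase]
        rw [Finset.sum_eq_single k]
        · have h := inner_self_eq_norm_sq_to_K (𝕜 := ℂ) (y k)
          simp only [sub_self, if_true]
          rw [h]; push_cast; rfl
        · intro l _ hl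
          rw [if_neg (sub_ne_zero.2 hl), zero_mul]
        · exact fun h => absurd hk h
      · exact fun l _ => ((continuous_phase _).mul continuous_const).intervalIntegrable _ _
    · refine fun k _ => Continuous.intervalIntegrable (continuous_finsetSum _ fun l _ => ?_) _ _
      exact (continuous_phase _).mul continuous_const
  exact_mod_cast h1

theorem summable_phase_smul [CompleteSpace H] {y : ℤ → H} (hy : Summable fun k => ‖y k‖) (t : ℝ) :
    Summable fun k => phase k t • y k :=
  Summable.of_norm (by simpa only [norm_phase_smul] using hy)

/-- Parseval's identity for absolutely summable coefficients. -/
theorem hasSum_norm_sq_of_summable [CompleteSpace H] {y : ℤ → H}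
    (hy : Summable fun k => ‖y k‖) :
    HasSum (fun k => 2 * Real.pi * ‖y k‖ ^ 2)
      (∫ t in (0 : ℝ)..(2 * Real.pi), ‖∑' k, phase k t • y k‖ ^ 2) := by
  have h : Tendsto (fun s : Finset ℤ =>
      ∫ t in (0 : ℝ)..(2 * Real.pi), ‖∑ k ∈ s, phase k t • y k‖ ^ 2) atTop
      (𝓝 (∫ t in (0 : ℝ)..(2 * Real.pi), ‖∑' k, phase k t • y k‖ ^ 2)) := by
    refine intervalIntegral.tendsto_integral_filter_of_dominated_convergence
      (fun _ => (∑' k, ‖y k‖) ^ 2) ?_ ?_ (by simp) ?_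
    · refine Eventually.of_forall fun s => Continuous.aestronglyMeasurable ?_
      exact (continuous_finsetSum _ fun l _ =>
        (continuous_phase _).smul continuous_const).norm.pow 2
    · refine Eventually.of_forall fun s => Eventually.of_forall fun t _ => ?_
      rw [norm_pow, norm_norm]
      refine pow_le_pow_left₀ (norm_nonneg _) ((norm_sum_le _ _).trans ?_) 2
      simp only [norm_phase_smul]
      exact hy.sum_le_tsum _ fun _ _ => norm_nonneg _
    · exact Eventually.of_forall fun t _ => ((summable_phase_smul hy t).hasSum.norm.pow 2)
  simp only [integral_norm_sq_sum_phase] at h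
  simpa only [HasSum, SummationFilter.unconditional_filter, Finset.mul_sum] using h

end Parseval

/-! ### Operators commuting with a group of shifts -/

/-- An additive group of isometries `V` together with an orthogonal projection `P` whose range is
a wandering subspace: the translates of the range are mutually orthogonal and total. -/
structure IsShiftSystem {H : Type*} [NormedAddCommGroup H] [InnerProductSpace ℂ H]
    (V : ℤ → H →ₗᵢ[ℂ] H) (P : H →L[ℂ] H) : Prop where
  zero : ∀ x, V 0 x = x
  add : ∀ i j x, V (i + j) x = V i (V j x)
  idem : ∀ x, P (P x) = P x
  symm : ∀ x y, inner ℂ (P x) y = inner ℂ x (P y)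
  orth : ∀ j ≠ 0, ∀ x, P (V j (P x)) = 0
  sep : ∀ x, (∀ k, P (V k x) = 0) → x = 0

/-- The blocks of `D` in the first block column. -/
def shiftCoeff {H : Type*} [NormedAddCommGroup H] [InnerProductSpace ℂ H]
    (V : ℤ → H →ₗᵢ[ℂ] H) (P D : H →L[ℂ] H) (j : ℤ) : H →L[ℂ] H :=
  P ∘L (V (-j)).toContinuousLinearMap ∘L D ∘L P

/-- The symbol `∑ exp (i j t) A_j` of an operator with blocks `A_j`. -/
def shiftSymbol {H : Type*} [NormedAddCommGroup H] [InnerProductSpace ℂ H]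
    (V : ℤ → H →ₗᵢ[ℂ] H) (P D : H →L[ℂ] H) (t : ℝ) : H →L[ℂ] H :=
  ∑' j, phase j t • shiftCoeff V P D j

/-- Shifting a window of length `n` by `j` changes only terms near its two ends. The bound must not
depend on `n`: it controls the boundary error of truncated Bloch waves. -/
theorem norm_sum_shift_sub_le {F : Type*} [NormedAddCommGroup F] {B : ℝ} (n : ℕ)
    (j : ℤ) (g : ℤ → F) (hg : ∀ m, ‖g m‖ ≤ B) :
    ‖∑ k ∈ Finset.range n, (g (k + j) - g k)‖ ≤ 2 * |(j : ℝ)| * B := by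
  have hnat : ∀ (m : ℕ) (g : ℤ → F), (∀ m, ‖g m‖ ≤ B) →
      ‖∑ k ∈ Finset.range n, (g (k + m) - g k)‖ ≤ 2 * (m : ℝ) * B := by
    intro m g hg
    induction m with
    | zero => simp
    | succ m ih =>
      have h1 : ∑ k ∈ Finset.range n, (g (k + (m + 1 : ℕ)) - g k)
          = ∑ k ∈ Finset.range n, (g (k + m) - g k)
            + ∑ k ∈ Finset.range n, (g ((k + 1 : ℕ) + m) - g (k + m)) := by
        rw [← Finset.sum_add_distrib]
        refine Finset.sum_congr rfl fun k _ => ?_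
        rw [show ((k : ℤ) + ((m + 1 : ℕ) : ℤ)) = ((k + 1 : ℕ) : ℤ) + m by push_cast; ring]
        abel
      rw [h1, Finset.sum_range_sub fun k : ℕ => g (k + m)]
      refine (norm_add_le _ _).trans ?_
      have h2 := norm_sub_le (g ((n : ℕ) + m)) (g ((0 : ℕ) + m))
      have h3 := hg ((n : ℕ) + m)
      have h4 := hg ((0 : ℕ) + m)
      push_cast at h2 h3 h4 ⊢
      linarith
  rcases Int.eq_nat_or_neg j with ⟨m, rfl | rfl⟩
  · simpa using hnat m g hg
  · have h := hnat m (fun k => g (k - m)) fun k => hg _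
    have h1 : ∑ k ∈ Finset.range n, (g (k + -(m : ℤ)) - g k)
        = -∑ k ∈ Finset.range n, (g ((k : ℤ) + m - m) - g (k - m)) := by
      rw [← Finset.sum_neg_distrib]
      refine Finset.sum_congr rfl fun k _ => ?_
      rw [add_sub_cancel_right, neg_sub, sub_eq_add_neg (k : ℤ)]
    rw [h1, norm_neg]
    simpa using h

namespace IsShiftSystem

variable {H : Type*} [NormedAddCommGroup H] [InnerProductSpace ℂ H]
  {V : ℤ → H →ₗᵢ[ℂ] H} {P D : H →L[ℂ] H}

theorem neg_apply (h : IsShiftSystem V P) (j : ℤ) (x : H) : V (-j) (V j x) = x := by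
  rw [← h.add, neg_add_cancel, h.zero]

theorem apply_neg (h : IsShiftSystem V P) (j : ℤ) (x : H) : V j (V (-j) x) = x := by
  rw [← h.add, add_neg_cancel, h.zero]

theorem inner_apply_left (h : IsShiftSystem V P) (j : ℤ) (x y : H) :
    inner ℂ (V j x) y = inner ℂ x (V (-j) y) := by
  rw [← (V (-j)).inner_map_map, h.neg_apply]

theorem inner_apply_apply (h : IsShiftSystem V P) {k l : ℤ} (hkl : k ≠ l) {x y : H}
    (hx : P x = x) (hy : P y = y) : inner ℂ (V k x) (V l y) = 0 := by
  rw [h.inner_apply_left, ← h.add, ← hx, h.symm, ← hy, h.orth _ (by omega), inner_zero_right]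

theorem norm_sq_sum (h : IsShiftSystem V P) (s : Finset ℤ) {y : ℤ → H} (hy : ∀ k, P (y k) = y k) :
    ‖∑ k ∈ s, V k (y k)‖ ^ 2 = ∑ k ∈ s, ‖y k‖ ^ 2 := by
  induction s using Finset.induction_on with
  | empty => simp
  | insert a s ha ih =>
    rw [Finset.sum_insert ha, Finset.sum_insert ha, ← ih, sq, sq, sq]
    have : inner ℂ (V a (y a)) (∑ k ∈ s, V k (y k)) = 0 := by
      rw [inner_sum]
      exact Finset.sum_eq_zero fun k hk =>
        h.inner_apply_apply (ne_of_mem_of_not_mem hk ha).symm (hy a) (hy k)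
    rw [norm_add_sq_eq_norm_sq_add_norm_sq_of_inner_eq_zero _ _ this, (V a).norm_map]

theorem symbol_periodic : Function.Periodic (shiftSymbol V P D) (2 * Real.pi) := fun t => by
  simp only [shiftSymbol, phase_periodic]

variable [CompleteSpace H]

/-- Summability produces a candidate limit with the same cell components as `z`, and `sep` says that
components determine a vector. -/
theorem hasSum_of_summable (h : IsShiftSystem V P) {z : H}
    (hz : Summable fun j => ‖P (V (-j) z)‖) : HasSum (fun j => V j (P (V (-j) z))) z := by
  have hs : Summable fun j => V j (P (V (-j) z)) :=
    Summable.of_norm (by simpa only [LinearIsometry.norm_map] using hz)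
  have hw := hs.hasSum
  set w := ∑' j, V j (P (V (-j) z))
  have : w - z = 0 := by
    refine h.sep _ fun k => ?_
    have h1 := hw.mapL (P ∘L (V k).toContinuousLinearMap)
    have h2 : HasSum (fun j => (P ∘L (V k).toContinuousLinearMap) (V j (P (V (-j) z))))
        (P (V k z)) := by
      have h3 : (fun j => (P ∘L (V k).toContinuousLinearMap) (V j (P (V (-j) z))))
          = fun j => if j = -k then P (V k z) else 0 := by
        funext j
        split_ifs with hj
        · subst hj
          simp [h.apply_neg, h.idem]
        · simp only [ContinuousLinearMap.comp_apply, LinearIsometry.coe_toContinuousLinearMap]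
          rw [← h.add, h.orth _ (by omega)]
      rw [h3]
      exact hasSum_ite_eq _ _
    have := h1.unique h2
    simp only [ContinuousLinearMap.comp_apply, LinearIsometry.coe_toContinuousLinearMap] at this
    rw [map_sub, map_sub, this, sub_self]
  rwa [sub_eq_zero.1 this] at hw

/-- Isometry of the Floquet transform: orthogonality of the cells on one side, Parseval in `t` on
the other. -/
theorem norm_sq_eq_of_hasSum (h : IsShiftSystem V P) {y : ℤ → H} (hy : ∀ k, P (y k) = y k)
    (hs : Summable fun k => ‖y k‖) {z : H} (hz : HasSum (fun k => V k (y k)) z) :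
    2 * Real.pi * ‖z‖ ^ 2 = ∫ t in (0 : ℝ)..(2 * Real.pi), ‖∑' k, phase k t • y k‖ ^ 2 := by
  have h1 : HasSum (fun k => ‖y k‖ ^ 2) (‖z‖ ^ 2) := by
    have := hz.norm.pow 2
    simp only [h.norm_sq_sum _ hy] at this
    exact this
  exact (h1.mul_left (2 * Real.pi)).unique (hasSum_norm_sq_of_summable hs)

theorem hasSum_coeff (h : IsShiftSystem V P) (hs : Summable fun j => ‖shiftCoeff V P D j‖) {x : H}
    (hx : P x = x) : HasSum (fun j => V j (shiftCoeff V P D j x)) (D x) := by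
  have h1 : ∀ j, shiftCoeff V P D j x = P (V (-j) (D x)) := fun j => by simp [shiftCoeff, hx]
  simp only [h1]
  refine h.hasSum_of_summable (Summable.of_nonneg_of_le (fun _ => norm_nonneg _) (fun j => ?_)
    (hs.mul_right ‖x‖))
  rw [← h1]
  exact (shiftCoeff V P D j).le_opNorm x

theorem summable_symbol (hs : Summable fun j => ‖shiftCoeff V P D j‖) (t : ℝ) :
    Summable fun j => phase j t • shiftCoeff V P D j :=
  Summable.of_norm (by simpa only [norm_phase_smul] using hs)

theorem hasSum_symbol_apply (hs : Summable fun j => ‖shiftCoeff V P D j‖) (t : ℝ) (x : H) :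
    HasSum (fun j => phase j t • shiftCoeff V P D j x) (shiftSymbol V P D t x) :=
  (summable_symbol hs t).hasSum.mapL (ContinuousLinearMap.apply ℂ H x)

theorem continuous_symbol (hs : Summable fun j => ‖shiftCoeff V P D j‖) :
    Continuous (shiftSymbol V P D) :=
  continuous_tsum (fun j => (continuous_phase j).smul continuous_const) hs
    fun _ _ => (norm_phase_smul _ _ _).le

/-- A vector orthogonal to every translate of the range of `P` has all components zero. Density
reduces lower bounds to finitely supported vectors. -/
theorem dense_range_sum (h : IsShiftSystem V P) :
    DenseRange (Finsupp.lsum ℂ fun k : ℤ => ((V k).toLinearMap ∘ₗ (P : H →ₗ[ℂ] H))) := by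
  have h1 : (LinearMap.range (Finsupp.lsum ℂ fun k : ℤ =>
      ((V k).toLinearMap ∘ₗ (P : H →ₗ[ℂ] H)))).topologicalClosure = ⊤ := by
    rw [Submodule.topologicalClosure_eq_top_iff, Submodule.eq_bot_iff]
    intro y hy
    refine h.sep y fun k => ?_
    rw [← inner_self_eq_zero (𝕜 := ℂ), h.symm, h.idem, ← h.symm, ← neg_neg k,
      ← h.inner_apply_left]
    refine hy _ ⟨Finsupp.single (-k) (V k y), ?_⟩
    simp
  rw [DenseRange, dense_iff_closure_eq]
  exact congrArg (fun S : Submodule ℂ H => (S : Set H)) h1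

/-- A uniform lower bound for the symbol is a lower bound for the operator. -/
theorem bounded_below_of_symbol (h : IsShiftSystem V P) (hD : ∀ j x, D (V j x) = V j (D x))
    (hs : Summable fun j => ‖shiftCoeff V P D j‖) {l : ℂ} {c : ℝ} (hc : 0 ≤ c)
    (hlow : ∀ t x, c * ‖x‖ ≤ ‖shiftSymbol V P D t x - l • x‖) (z : H) :
    c * ‖z‖ ≤ ‖D z - l • z‖ := by
  refine h.dense_range_sum.induction_on z
    (isClosed_le (by fun_prop) (by fun_prop)) fun a => ?_
  set s := a.support
  let x : ℤ → H := fun k => if k ∈ s then P (a k) else 0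
  have hx : ∀ k, P (x k) = x k := fun k => by
    by_cases hk : k ∈ s <;> simp [x, hk, h.idem]
  have hz : Finsupp.lsum ℂ (fun k : ℤ => ((V k).toLinearMap ∘ₗ (P : H →ₗ[ℂ] H))) a
      = ∑ k ∈ s, V k (x k) := by
    rw [Finsupp.lsum_apply, Finsupp.sum]
    refine Finset.sum_congr rfl fun k hk => ?_
    simp only [x]; rw [if_pos hk]; rfl
  rw [hz]
  have hx0 : ∀ k ∉ s, x k = 0 := fun k hk => if_neg hk
  have hz1 : HasSum (fun k => V k (x k)) (∑ k ∈ s, V k (x k)) :=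
    hasSum_sum_of_ne_finset_zero fun k hk => by rw [hx0 k hk, map_zero]
  have hxs : Summable fun k => ‖x k‖ :=
    summable_of_ne_finset_zero (s := s) fun k hk => by rw [hx0 k hk, norm_zero]
  have hxt : ∀ t, HasSum (fun k => phase k t • x k) (∑ k ∈ s, phase k t • x k) := fun t =>
    hasSum_sum_of_ne_finset_zero fun k hk => by rw [hx0 k hk, smul_zero]
  -- The components of `D z - l • z` form a discrete convolution of the blocks with `x`; the Fourier
  -- series therefore turns it into symbol minus `l` acting on the series of `x`, where `hlow`
  -- applies for each `t`.
  let y : ℤ → H := fun j => ∑ k ∈ s, shiftCoeff V P D (j - k) (x k) - l • x j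
  have hPc : ∀ j w, P (shiftCoeff V P D j w) = shiftCoeff V P D j w := fun j w => by
    simp [shiftCoeff, h.idem]
  have hy : ∀ j, P (y j) = y j := fun j => by
    simp only [y, map_sub, map_sum, map_smul, hPc, hx]
  have hsk : ∀ k, Summable fun j => ‖shiftCoeff V P D (j - k) (x k)‖ := fun k => by
    have h1 : Summable fun j => ‖shiftCoeff V P D (j - k)‖ :=
      hs.comp_injective (Equiv.subRight k).injective
    exact Summable.of_nonneg_of_le (fun _ => norm_nonneg _)
      (fun j => (shiftCoeff V P D (j - k)).le_opNorm (x k)) (h1.mul_right ‖x k‖)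
  have hys : Summable fun j => ‖y j‖ := by
    refine Summable.of_nonneg_of_le (fun _ => norm_nonneg _) (fun j => (norm_sub_le _ _).trans
      (add_le_add (norm_sum_le _ _) (norm_smul _ _).le)) ?_
    exact (summable_sum fun k _ => hsk k).add (hxs.mul_left ‖l‖)
  have hDz : HasSum (fun j => V j (y j)) (D (∑ k ∈ s, V k (x k)) - l • ∑ k ∈ s, V k (x k)) := by
    simp only [y, map_sub, map_sum, map_smul]
    refine HasSum.sub (hasSum_sum fun k _ => ?_) (hz1.const_smul l)
    have h1 := (h.hasSum_coeff hs (hx k)).mapL (V k).toContinuousLinearMap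
    rw [hD]
    have h2 := (Equiv.subRight k).hasSum_iff.2 h1
    simpa [Function.comp_def, ← h.add] using h2
  have hyt : ∀ t, HasSum (fun j => phase j t • y j)
      (shiftSymbol V P D t (∑ k ∈ s, phase k t • x k) - l • ∑ k ∈ s, phase k t • x k) := by
    intro t
    simp only [y, smul_sub, Finset.smul_sum, map_sum, map_smul]
    refine HasSum.sub (hasSum_sum fun k _ => ?_) ?_
    · have h1 := (hasSum_symbol_apply hs t (x k)).const_smul (phase k t)
      have h2 := (Equiv.subRight k).hasSum_iff.2 h1
      simpa [Function.comp_def, smul_smul, ← phase_add] using h2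
    · have := (hxt t).const_smul l
      simp only [Finset.smul_sum] at this
      simpa only [smul_comm l] using this
  have e1 := h.norm_sq_eq_of_hasSum hx hxs hz1
  have e2 := h.norm_sq_eq_of_hasSum hy hys hDz
  simp only [fun t => (hxt t).tsum_eq] at e1
  simp only [fun t => (hyt t).tsum_eq] at e2
  have hcont : Continuous fun t => ∑ k ∈ s, phase k t • x k :=
    continuous_finsetSum _ fun k _ => (continuous_phase k).smul continuous_const
  have hle : c ^ 2 * (2 * Real.pi * ‖∑ k ∈ s, V k (x k)‖ ^ 2)
      ≤ 2 * Real.pi * ‖D (∑ k ∈ s, V k (x k)) - l • ∑ k ∈ s, V k (x k)‖ ^ 2 := by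
    rw [e1, e2, ← intervalIntegral.integral_const_mul]
    refine intervalIntegral.integral_mono_on (by positivity) ?_ ?_ fun t _ => ?_
    · exact (continuous_const.mul (hcont.norm.pow 2)).intervalIntegrable _ _
    · exact ((((continuous_symbol hs).clm_apply hcont).sub (hcont.const_smul l)).norm.pow
        2).intervalIntegrable _ _
    · rw [← mul_pow]
      exact pow_le_pow_left₀ (by positivity) (hlow t _) 2
  have hle' : (c * ‖∑ k ∈ s, V k (x k)‖) ^ 2
      ≤ ‖D (∑ k ∈ s, V k (x k)) - l • ∑ k ∈ s, V k (x k)‖ ^ 2 := by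
    rw [mul_pow]
    refine le_of_mul_le_mul_left ?_ (show 0 < 2 * Real.pi by positivity)
    linarith
  exact (pow_le_pow_iff_left₀ (by positivity) (norm_nonneg _) two_ne_zero).1 hle'

end IsShiftSystem

theorem hasSum_of_eq {F ι : Type*} [AddCommMonoid F] [TopologicalSpace F] {f g : ι → F} {a : F}
    (h : ∀ i, f i = g i) (hf : HasSum f a) : HasSum g a := (funext h : f = g) ▸ hf

/-! ### Adjoint symbol, invertibility, Bloch waves and Fredholm theory for shift-invariant operators
-/

namespace IsShiftSystem

variable {H : Type*} [NormedAddCommGroup H] [InnerProductSpace ℂ H] [CompleteSpace H]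
  {V : ℤ → H →ₗᵢ[ℂ] H} {P D : H →L[ℂ] H}

theorem adjoint_commute (h : IsShiftSystem V P) (hD : ∀ j x, D (V j x) = V j (D x)) (j : ℤ) (x : H) :
    D.adjoint (V j x) = V j (D.adjoint x) := by
  refine ext_inner_right ℂ fun y => ?_
  rw [ContinuousLinearMap.adjoint_inner_left, h.inner_apply_left, ← hD,
    ← ContinuousLinearMap.adjoint_inner_left, h.inner_apply_left]

theorem coeff_adjoint (h : IsShiftSystem V P) (hD : ∀ j x, D (V j x) = V j (D x)) (j : ℤ) :
    shiftCoeff V P D.adjoint j = (shiftCoeff V P D (-j)).adjoint := by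
  refine (ContinuousLinearMap.eq_adjoint_iff _ _).2 fun x y => ?_
  simp only [shiftCoeff, ContinuousLinearMap.comp_apply,
    LinearIsometry.coe_toContinuousLinearMap, neg_neg]
  rw [h.symm, h.inner_apply_left, ContinuousLinearMap.adjoint_inner_left, h.symm, neg_neg, hD]

theorem summable_coeff_adjoint (h : IsShiftSystem V P) (hD : ∀ j x, D (V j x) = V j (D x))
    (hs : Summable fun j => ‖shiftCoeff V P D j‖) :
    Summable fun j => ‖shiftCoeff V P D.adjoint j‖ := by
  simp only [h.coeff_adjoint hD, LinearIsometryEquiv.norm_map]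
  exact hs.comp_injective neg_injective

/-- Taking adjoints reverses the block index, and conjugation reverses the phase, so the two
reversals cancel. -/
theorem symbol_adjoint (h : IsShiftSystem V P) (hD : ∀ j x, D (V j x) = V j (D x))
    (hs : Summable fun j => ‖shiftCoeff V P D j‖) (t : ℝ) :
    shiftSymbol V P D.adjoint t = (shiftSymbol V P D t).adjoint := by
  have h1 := (summable_symbol hs t).hasSum.star
  have h2 := (Equiv.neg ℤ).hasSum_iff.2 h1
  refine (HasSum.tsum_eq ?_)
  simp only [h.coeff_adjoint hD]
  refine hasSum_of_eq (fun j => ?_) h2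
  simp only [Function.comp_apply, Equiv.neg_apply, star_smul]
  congr 1
  exact (conj_phase _ _).trans (by rw [neg_neg])

/-- Inversion is continuous at units and the symbol is continuous and `2π`-periodic, so compactness
of one period makes the bound uniform in `t`. -/
theorem exists_lower_bound (hs : Summable fun j => ‖shiftCoeff V P D j‖) {l : ℂ}
    (hl : ∀ t, IsUnit (shiftSymbol V P D t - l • 1)) :
    ∃ C : ℝ, 0 < C ∧ ∀ t, ‖Ring.inverse (shiftSymbol V P D t - l • 1)‖ ≤ C := by
  have hcont : Continuous fun t => ‖Ring.inverse (shiftSymbol V P D t - l • 1)‖ := by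
    rw [continuous_iff_continuousAt]
    intro t
    obtain ⟨u, hu⟩ := hl t
    have h1 := NormedRing.inverse_continuousAt u
    rw [hu] at h1
    have h2 : ContinuousAt (fun t => shiftSymbol V P D t - l • (1 : H →L[ℂ] H)) t :=
      ((continuous_symbol hs).sub continuous_const).continuousAt
    exact (ContinuousAt.comp (f := fun t => shiftSymbol V P D t - l • (1 : H →L[ℂ] H)) h1 h2).norm
  obtain ⟨C, hC⟩ := (isCompact_Icc (a := (0 : ℝ)) (b := 2 * Real.pi)).exists_bound_of_continuousOn
    hcont.continuousOn
  refine ⟨max C 1, by positivity, fun t => le_max_of_le_left ?_⟩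
  have hper : Function.Periodic (fun t => ‖Ring.inverse (shiftSymbol V P D t - l • 1)‖)
      (2 * Real.pi) := fun t => by
    simp only [symbol_periodic (V := V) (P := P) (D := D) t]
  obtain ⟨t', ht', e⟩ := hper.exists_mem_Ico₀ (by positivity) t
  rw [e]
  simpa using hC t' (Ico_subset_Icc_self ht')

omit [CompleteSpace H] in
theorem bounded_below_of_mul_eq_one {B S : H →L[ℂ] H} (hBS : B * S = 1) {C : ℝ} (hC : 0 < C)
    (hB : ‖B‖ ≤ C) (x : H) : C⁻¹ * ‖x‖ ≤ ‖S x‖ := by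
  have h1 : B (S x) = x := congrArg (fun A : H →L[ℂ] H => A x) hBS
  have h2 := B.le_of_opNorm_le hB (S x)
  rw [h1] at h2
  rwa [inv_mul_le_iff₀ hC]

/-- If all values of the symbol are invertible after subtracting `l`, so is the operator. -/
theorem isUnit_of_symbol (h : IsShiftSystem V P) (hD : ∀ j x, D (V j x) = V j (D x))
    (hs : Summable fun j => ‖shiftCoeff V P D j‖) {l : ℂ}
    (hl : ∀ t, IsUnit (shiftSymbol V P D t - l • 1)) : IsUnit (D - l • 1) := by
  obtain ⟨C, hC, hCt⟩ := exists_lower_bound hs hl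
  have h1 : ∀ z, C⁻¹ * ‖z‖ ≤ ‖(D - l • (1 : H →L[ℂ] H)) z‖ := by
    intro z
    refine h.bounded_below_of_symbol hD hs (by positivity) (fun t x => ?_) z
    exact bounded_below_of_mul_eq_one (Ring.inverse_mul_cancel _ (hl t)) hC (hCt t) x
  -- The bound for `D` gives injectivity and closed range; the bound for the adjoint gives dense
  -- range.
  have h2 : ∀ z, C⁻¹ * ‖z‖ ≤ ‖D.adjoint z - (starRingEnd ℂ l) • z‖ := by
    intro z
    refine h.bounded_below_of_symbol (h.adjoint_commute hD) (h.summable_coeff_adjoint hD hs)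
      (by positivity) (fun t x => ?_) z
    have h3 : (Ring.inverse (shiftSymbol V P D t - l • 1)).adjoint
        * (shiftSymbol V P D.adjoint t - (starRingEnd ℂ l) • 1) = 1 := by
      have h4 := congrArg star (Ring.mul_inverse_cancel _ (hl t))
      rw [star_mul, star_one, star_sub, star_smul, star_one] at h4
      rw [h.symbol_adjoint hD hs]
      exact h4
    exact bounded_below_of_mul_eq_one h3 hC (by rw [LinearIsometryEquiv.norm_map]; exact hCt t) x
  have hinj : Function.Injective (D - l • (1 : H →L[ℂ] H)) := by
    rw [injective_iff_map_eq_zero]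
    intro z hz
    have := h1 z
    rw [hz, norm_zero] at this
    exact norm_le_zero_iff.1 (nonpos_of_mul_nonpos_right this (by positivity))
  have hanti : AntilipschitzWith C.toNNReal (D - l • (1 : H →L[ℂ] H)) := by
    refine AddMonoidHomClass.antilipschitz_of_bound _ fun x => ?_
    rw [Real.coe_toNNReal _ hC.le]
    have := h1 x
    rwa [inv_mul_le_iff₀ hC] at this
  have hcl : IsClosed (Set.range (D - l • (1 : H →L[ℂ] H))) :=
    (hanti.isClosedEmbedding (D - l • (1 : H →L[ℂ] H)).uniformContinuous).isClosed_range
  rw [ContinuousLinearMap.isUnit_iff_bijective]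
  refine ⟨hinj, ?_⟩
  have h3 : ((D - l • (1 : H →L[ℂ] H)).range).topologicalClosure = ⊤ := by
    rw [Submodule.topologicalClosure_eq_top_iff, ContinuousLinearMap.orthogonal_range,
      Submodule.eq_bot_iff]
    intro z hz
    have h4 : D.adjoint z - (starRingEnd ℂ l) • z = 0 := by
      have h5 : (D - l • (1 : H →L[ℂ] H)).adjoint z = 0 := hz
      have h6 : (D - l • (1 : H →L[ℂ] H)).adjoint
          = D.adjoint - (starRingEnd ℂ l) • (1 : H →L[ℂ] H) := by
        change star (D - l • (1 : H →L[ℂ] H)) = _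
        rw [star_sub, star_smul, star_one]; rfl
      rw [h6] at h5
      exact h5
    have := h2 z
    rw [h4, norm_zero] at this
    exact norm_le_zero_iff.1 (nonpos_of_mul_nonpos_right this (by positivity))
  rw [IsClosed.submodule_topologicalClosure_eq hcl] at h3
  exact LinearMap.range_eq_top.1 h3

theorem norm_apply_le_tsum (h : IsShiftSystem V P) (hs : Summable fun j => ‖shiftCoeff V P D j‖)
    {x : H} (hx : P x = x) : ‖D x‖ ≤ ∑' j, ‖shiftCoeff V P D j x‖ := by
  have h1 : Summable fun j => ‖V j (shiftCoeff V P D j x)‖ := by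
    simp only [LinearIsometry.norm_map]
    exact Summable.of_nonneg_of_le (fun _ => norm_nonneg _)
      (fun j => (shiftCoeff V P D j).le_opNorm x) (hs.mul_right ‖x‖)
  rw [← (h.hasSum_coeff hs hx).tsum_eq]
  simpa only [LinearIsometry.norm_map] using norm_tsum_le_tsum_norm h1

/-- Eigenvalues of the symbol belong to the spectrum of the operator. -/
theorem mem_spectrum_of_symbol (h : IsShiftSystem V P) (hD : ∀ j x, D (V j x) = V j (D x))
    (hs : Summable fun j => ‖shiftCoeff V P D j‖)
    (hs' : Summable fun j : ℤ => |(j : ℝ)| * ‖shiftCoeff V P D j‖) {l : ℂ} {t : ℝ} {x : H}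
    (hx : P x = x) (hx0 : x ≠ 0) (hl : shiftSymbol V P D t x = l • x) : l ∈ spectrum ℂ D := by
  let g : H → ℤ → H := fun y m => phase (-m) t • V m y
  have hg : ∀ y m, ‖g y m‖ ≤ ‖y‖ := fun y m => by
    simp only [g, norm_phase_smul, LinearIsometry.norm_map, le_refl]
  -- Truncated Bloch waves: the norm grows like `√n`, while `D ψ - l ψ` consists only of boundary
  -- terms and is bounded by `∑ 2 |j| ‖A_j‖ ‖x‖` independently of `n`. The weight `|j|` is why the
  -- first moment of the blocks must be finite.
  let ψ : ℕ → H := fun n => ∑ k ∈ Finset.range n, g x k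
  have hψ : ∀ n, ‖ψ n‖ ^ 2 = n * ‖x‖ ^ 2 := by
    intro n
    have h1 := h.norm_sq_sum ((Finset.range n).map Nat.castEmbedding)
      (y := fun k => phase (-k) t • x) (fun k => by rw [map_smul, hx])
    simp only [Finset.sum_map, Nat.castEmbedding_apply, map_smul, norm_phase_smul,
      Finset.sum_const, Finset.card_map, Finset.card_range, nsmul_eq_mul] at h1
    exact h1
  set A := shiftCoeff V P D with hA
  have hb : ∀ n, ‖D (ψ n) - l • ψ n‖ ≤ ∑' j : ℤ, 2 * |(j : ℝ)| * (‖A j‖ * ‖x‖) := by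
    intro n
    have hsum : HasSum (fun j => phase j t • ∑ k ∈ Finset.range n,
        (g (A j x) (k + j) - g (A j x) k)) (D (ψ n) - l • ψ n) := by
      simp only [Finset.sum_sub_distrib, smul_sub, Finset.smul_sum, ψ, map_sum]
      refine HasSum.sub (hasSum_sum fun k _ => ?_) (hasSum_sum fun k _ => ?_)
      · have h1 := ((h.hasSum_coeff hs hx).mapL (V k).toContinuousLinearMap).const_smul
          (phase (-k) t)
        simp only [g, map_smul, hD]
        refine hasSum_of_eq (fun j => ?_) h1
        simp only [LinearIsometry.coe_toContinuousLinearMap, smul_smul, ← phase_add, ← h.add, hA]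
        congr 2; ring
      · have h1 := ((hasSum_symbol_apply hs t x).mapL (V k).toContinuousLinearMap).const_smul
          (phase (-k) t)
        rw [hl] at h1
        simp only [g]
        convert h1 using 1
        · funext j
          simp only [LinearIsometry.coe_toContinuousLinearMap, map_smul, smul_comm (phase j t), hA]
        · simp only [LinearIsometry.coe_toContinuousLinearMap, map_smul, smul_comm l]
    have hj : ∀ j, ‖phase j t • ∑ k ∈ Finset.range n, (g (A j x) (k + j) - g (A j x) k)‖
        ≤ 2 * |(j : ℝ)| * (‖A j‖ * ‖x‖) := fun j => by
      rw [norm_phase_smul]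
      exact norm_sum_shift_sub_le n j _ fun m => (hg _ m).trans ((A j).le_opNorm x)
    have hsm : Summable fun j : ℤ => 2 * |(j : ℝ)| * (‖A j‖ * ‖x‖) := by
      have := (hs'.mul_left 2).mul_right ‖x‖
      refine this.congr fun j => by ring
    exact hsum.tsum_eq ▸ tsum_of_norm_bounded hsm.hasSum hj
  rw [spectrum.mem_iff]
  intro hu
  rw [← IsUnit.neg_iff, neg_sub, Algebra.algebraMap_eq_smul_one] at hu
  set B := Ring.inverse (D - l • (1 : H →L[ℂ] H)) with hB
  have hBD : ∀ z, B (D z - l • z) = z := fun z =>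
    congrArg (fun S : H →L[ℂ] H => S z) (Ring.inverse_mul_cancel _ hu)
  set C := ∑' j : ℤ, 2 * |(j : ℝ)| * (‖A j‖ * ‖x‖)
  have hbd : ∀ n : ℕ, n * ‖x‖ ^ 2 ≤ (‖B‖ * C) ^ 2 := fun n => by
    rw [← hψ]
    refine pow_le_pow_left₀ (norm_nonneg _) ?_ 2
    calc ‖ψ n‖ = ‖B (D (ψ n) - l • ψ n)‖ := by rw [hBD]
      _ ≤ ‖B‖ * ‖D (ψ n) - l • ψ n‖ := B.le_opNorm _
      _ ≤ ‖B‖ * C := mul_le_mul_of_nonneg_left (hb n) (norm_nonneg _)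
  have hxp : 0 < ‖x‖ ^ 2 := by have := norm_pos_iff.2 hx0; positivity
  obtain ⟨n, hn⟩ := exists_nat_gt ((‖B‖ * C) ^ 2 / ‖x‖ ^ 2)
  rw [div_lt_iff₀ hxp] at hn
  exact absurd (hbd n) (not_le.2 hn)

omit [CompleteSpace H] in
-- The eigenvalue is unimodular, so every cell component of `x` has norm `‖P x‖`; Bessel's
-- inequality over `n` cells forces it to vanish.
theorem eq_zero_of_eigenvector (h : IsShiftSystem V P) {μ : ℂ} {x : H} (hx : V 1 x = μ • x) :
    x = 0 := by
  by_contra hx0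
  have hμ1 : ‖μ‖ = 1 := by
    have h1 := (V 1).norm_map x
    rw [hx, norm_smul] at h1
    exact mul_right_cancel₀ (norm_ne_zero_iff.2 hx0) (by rw [h1, one_mul])
  have hμ0 : μ ≠ 0 := fun e => by rw [e, norm_zero] at hμ1; exact zero_ne_one hμ1
  have hpos : ∀ n : ℕ, V n x = μ ^ n • x := by
    intro n
    induction n with
    | zero => simp [h.zero]
    | succ n ih => rw [Nat.cast_succ, h.add, hx, map_smul, ih, smul_smul, pow_succ']
  have hneg : ∀ n : ℕ, V (-n) x = (μ ^ n)⁻¹ • x := by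
    intro n
    have h1 := congrArg (V (-n)) (hpos n)
    rw [h.neg_apply, map_smul] at h1
    rw [eq_inv_smul_iff₀ (pow_ne_zero _ hμ0), ← h1]
  have hPx : P x = 0 := by
    have hle : ∀ n : ℕ, n * ‖P x‖ ^ 2 ≤ ‖x‖ ^ 2 := by
      intro n
      set y : ℤ → H := fun k => P (V (-k) x)
      have hyn : ∀ k : ℕ, ‖y k‖ = ‖P x‖ := fun k => by
        simp only [y, hneg, map_smul, norm_smul, norm_inv, norm_pow, hμ1, one_pow, inv_one, one_mul]
      set w := ∑ k ∈ (Finset.range n).map Nat.castEmbedding, V k (y k)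
      have h1 : ‖w‖ ^ 2 = n * ‖P x‖ ^ 2 := by
        have := h.norm_sq_sum ((Finset.range n).map Nat.castEmbedding) (y := y)
          (fun k => h.idem _)
        rw [this]
        simp [Finset.sum_map, hyn]
      have h2 : inner ℂ w x = ((‖w‖ ^ 2 : ℝ) : ℂ) := by
        rw [h1, sum_inner]
        simp only [Finset.sum_map, Nat.castEmbedding_apply]
        rw [Finset.sum_congr rfl (g := fun _ => ((‖P x‖ ^ 2 : ℝ) : ℂ))]
        · simp
        · intro k _
          rw [h.inner_apply_left]
          simp only [y]
          rw [← h.idem, h.symm, ← hyn k]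
          have := inner_self_eq_norm_sq_to_K (𝕜 := ℂ) (y k)
          push_cast; exact this
      have h3 : ‖w‖ ^ 2 ≤ ‖w‖ * ‖x‖ := by
        have := norm_inner_le_norm (𝕜 := ℂ) w x
        rw [h2, Complex.norm_real, norm_pow, norm_norm] at this
        exact this
      rw [← h1]
      nlinarith [norm_nonneg w, norm_nonneg x]
    by_contra hne
    have hp : 0 < ‖P x‖ ^ 2 := by have := norm_pos_iff.2 hne; positivity
    obtain ⟨n, hn⟩ := exists_nat_gt (‖x‖ ^ 2 / ‖P x‖ ^ 2)
    rw [div_lt_iff₀ hp] at hn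
    exact absurd (hle n) (not_le.2 hn)
  refine hx0 (h.sep x fun k => ?_)
  rcases Int.eq_nat_or_neg k with ⟨n, rfl | rfl⟩
  · rw [hpos, map_smul, hPx, smul_zero]
  · rw [hneg, map_smul, hPx, smul_zero]

omit [CompleteSpace H] in
-- The kernel is invariant under `V 1`; if finite-dimensional and nonzero it would contain an
-- eigenvector of the shift.
theorem ker_eq_bot_of_finiteDimensional (h : IsShiftSystem V P) {S : H →L[ℂ] H}
    (hS : ∀ j x, S (V j x) = V j (S x)) [FiniteDimensional ℂ S.ker] : S.ker = ⊥ := by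
  by_contra hne
  have : Nontrivial S.ker := Submodule.nontrivial_iff_ne_bot.2 hne
  have hmaps : ∀ x ∈ S.ker, (V 1).toLinearMap x ∈ S.ker := fun x hx => by
    have hx' : S x = 0 := hx
    change S (V 1 x) = 0
    rw [hS, hx', map_zero]
  obtain ⟨μ, hμ⟩ := Module.End.exists_eigenvalue ((V 1).toLinearMap.restrict hmaps)
  obtain ⟨v, hv⟩ := hμ.exists_hasEigenvector
  refine hv.2 (Subtype.ext (h.eq_zero_of_eigenvector (μ := μ) ?_))
  exact congrArg Subtype.val hv.apply_eq_smul

/-- A Fredholm operator that commutes with the shifts is invertible. -/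
theorem isUnit_of_isFredholm (h : IsShiftSystem V P) {S : H →L[ℂ] H}
    (hS : ∀ j x, S (V j x) = V j (S x)) (hF : S.IsFredholm) : IsUnit S := by
  have := hF.finite_ker
  have hker := h.ker_eq_bot_of_finiteDimensional hS
  have hq : FiniteDimensional ℂ (H ⧸ S.range) := by
    have := hF.finite_coker
    infer_instance
  -- The orthogonal complement of the range injects into the cokernel and is the kernel of the
  -- adjoint, which also commutes with the shifts; so it vanishes too.
  have hfin : FiniteDimensional ℂ (S.range)ᗮ := by
    refine Module.Finite.of_injective ((S.range).mkQ ∘ₗ ((S.range)ᗮ).subtype) ?_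
    rw [← LinearMap.ker_eq_bot, LinearMap.ker_comp, Submodule.ker_mkQ, Submodule.eq_bot_iff]
    intro x hx
    have : (x : H) ∈ S.range ⊓ (S.range)ᗮ := ⟨hx, x.2⟩
    rw [Submodule.inf_orthogonal_eq_bot] at this
    exact Subtype.ext this
  rw [ContinuousLinearMap.orthogonal_range] at hfin
  have hker' := h.ker_eq_bot_of_finiteDimensional (h.adjoint_commute hS)
  rw [ContinuousLinearMap.isUnit_iff_bijective]
  refine ⟨LinearMap.ker_eq_bot.1 hker, LinearMap.range_eq_top.1 ?_⟩
  have h3 : (S.range).topologicalClosure = ⊤ := by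
    rw [Submodule.topologicalClosure_eq_top_iff, ContinuousLinearMap.orthogonal_range, hker']
  rwa [IsClosed.submodule_topologicalClosure_eq hF.isClosed_range] at h3

theorem spectrum_eq_essentialSpectrum (h : IsShiftSystem V P)
    (hD : ∀ j x, D (V j x) = V j (D x)) : spectrum ℂ D = essentialSpectrum D := by
  ext z
  have hu : z ∈ spectrum ℂ D ↔ ¬ IsUnit (D - z • ContinuousLinearMap.id ℂ H) := by
    rw [spectrum.mem_iff, ← IsUnit.neg_iff, neg_sub, Algebra.algebraMap_eq_smul_one]
    rfl
  rw [hu, essentialSpectrum, mem_ofPred_eq, not_iff_not]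
  constructor
  · rintro ⟨u, hu⟩
    set S := D - z • ContinuousLinearMap.id ℂ H
    obtain ⟨e, he⟩ : ∃ e : H ≃L[ℂ] H, (e : H →L[ℂ] H) = S := ⟨ContinuousLinearEquiv.ofUnit u, hu⟩
    have hr : S.range = ⊤ := LinearMap.range_eq_top.2 (he ▸ e.surjective)
    have hk : S.ker = ⊥ := LinearMap.ker_eq_bot.2 (he ▸ e.injective)
    -- The clauses of Fredholmness: strictness, closed range, finite-dimensional kernel and
    -- cokernel, complemented kernel.
    refine ⟨?_, ?_, ?_, ?_, ?_⟩
    · rw [← he]; exact e.toHomeomorph.isEmbedding.isStrictMap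
    · rw [hr]; exact isClosed_univ
    · rw [hk]; infer_instance
    · rw [hr]; infer_instance
    · rw [hk]; exact Submodule.closedComplemented_bot
  · refine h.isUnit_of_isFredholm fun j x => ?_
    simp [hD]

end IsShiftSystem

/-! ### The double-layer kernel of a dilation-invariant graph -/

/-- Second-order Taylor estimate on the segment from `y` to `x`. -/
theorem abs_taylor_two_sub_le {f : ℝ → ℝ} {x y c ε : ℝ} (hε : 0 ≤ ε)
    (hf : ∀ z ∈ uIcc y x, DifferentiableAt ℝ f z)
    (hf' : ∀ z ∈ uIcc y x, DifferentiableAt ℝ (deriv f) z)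
    (hb : ∀ z ∈ uIcc y x, |deriv (deriv f) z - c| ≤ ε) :
    |f x - f y - deriv f y * (x - y) - c / 2 * (x - y) ^ 2| ≤ ε * (x - y) ^ 2 := by
  have hconv : Convex ℝ (uIcc y x) := convex_uIcc y x
  have h1 : ∀ z ∈ uIcc y x, |deriv f z - deriv f y - c * (z - y)| ≤ ε * |x - y| := by
    intro z hz
    have := hconv.norm_image_sub_le_of_norm_hasDerivWithin_le (f := fun z => deriv f z - c * (z - y))
      (f' := fun z => deriv (deriv f) z - c) (C := ε)
      (fun z hz => by
        have h2 : HasDerivAt (fun z => deriv f z - c * (z - y)) (deriv (deriv f) z - c * 1) z :=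
          (hf' z hz).hasDerivAt.sub (((hasDerivAt_id z).sub_const y).const_mul c)
        rw [mul_one] at h2
        exact h2.hasDerivWithinAt) hb left_mem_uIcc hz
    simp only [sub_self, mul_zero, sub_zero, Real.norm_eq_abs] at this
    rw [show deriv f z - deriv f y - c * (z - y) = deriv f z - c * (z - y) - deriv f y by ring]
    exact this.trans (mul_le_mul_of_nonneg_left (abs_sub_left_of_mem_uIcc hz) hε)
  have h3 := hconv.norm_image_sub_le_of_norm_hasDerivWithin_le
    (f := fun z => f z - deriv f y * (z - y) - c / 2 * (z - y) ^ 2)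
    (f' := fun z => deriv f z - deriv f y - c * (z - y)) (C := ε * |x - y|)
    (fun z hz => by
      have h2 := ((hf z hz).hasDerivAt.sub (((hasDerivAt_id z).sub_const y).const_mul
        (deriv f y))).sub ((((hasDerivAt_id z).sub_const y).pow 2).const_mul (c / 2))
      refine HasDerivAt.hasDerivWithinAt (h2.congr_deriv ?_)
      simp only [id]; push_cast; ring) h1 left_mem_uIcc right_mem_uIcc
  simp only [sub_self, mul_zero, sub_zero, Real.norm_eq_abs, ne_eq, OfNat.ofNat_ne_zero,
    not_false_eq_true, zero_pow] at h3
  rw [mul_assoc, ← sq, sq_abs] at h3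
  rw [show f x - f y - deriv f y * (x - y) - c / 2 * (x - y) ^ 2
    = f x - deriv f y * (x - y) - c / 2 * (x - y) ^ 2 - f y by ring]
  exact h3

namespace AnalyticDilationGraph

variable (Γ : AnalyticDilationGraph)

theorem dilation_zpow (n : ℤ) (x : ℝ) : Γ.f (Γ.α ^ n * x) = Γ.α ^ n * Γ.f x := by
  have hα := Γ.α_pos.ne'
  induction n using Int.induction_on generalizing x with
  | zero => simp
  | succ n ih => rw [zpow_add_one₀ hα, mul_assoc, ih, Γ.dilation, mul_assoc]
  | pred n ih =>
    have h1 : Γ.f (Γ.α⁻¹ * x) = Γ.α⁻¹ * Γ.f x := by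
      have := Γ.dilation (Γ.α⁻¹ * x)
      rw [mul_inv_cancel_left₀ hα] at this
      rw [this, inv_mul_cancel_left₀ hα]
    rw [zpow_sub_one₀ hα, mul_assoc, ih, h1, mul_assoc]

theorem zpow_α_pos (n : ℤ) : 0 < Γ.α ^ n := zpow_pos Γ.α_pos n

theorem deriv_zpow (n : ℤ) (x : ℝ) : deriv Γ.f (Γ.α ^ n * x) = deriv Γ.f x := by
  have h1 := deriv_comp_mul_left (Γ.α ^ n) Γ.f x
  simp only [Γ.dilation_zpow, deriv_const_mul_field, smul_eq_mul] at h1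
  exact (mul_left_cancel₀ (Γ.zpow_α_pos n).ne' h1).symm

theorem deriv_deriv_zpow (n : ℤ) (x : ℝ) :
    Γ.α ^ n * deriv (deriv Γ.f) (Γ.α ^ n * x) = deriv (deriv Γ.f) x := by
  have h1 := deriv_comp_mul_left (Γ.α ^ n) (deriv Γ.f) x
  simp only [Γ.deriv_zpow, smul_eq_mul] at h1
  exact h1.symm

/-- A power of `α` moves any nonzero point into the compact annulus `1 ≤ |x| ≤ α⁻¹`, where
continuity gives a bound. -/
theorem exists_bound_of_invariant {g : ℝ → ℝ} (hg : ContinuousOn g {0}ᶜ)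
    (hinv : ∀ (n : ℤ) (x : ℝ), g (Γ.α ^ n * x) = g x) : ∃ C : ℝ, 0 ≤ C ∧ ∀ x ≠ 0, |g x| ≤ C := by
  have hK : IsCompact {x : ℝ | 1 ≤ |x| ∧ |x| ≤ Γ.α⁻¹} := by
    refine IsCompact.of_isClosed_subset (isCompact_Icc (a := -Γ.α⁻¹) (b := Γ.α⁻¹))
      ((isClosed_le continuous_const continuous_abs).inter
        (isClosed_le continuous_abs continuous_const)) fun x hx => abs_le.1 hx.2
  obtain ⟨C, hC⟩ := hK.exists_bound_of_continuousOn (f := g) (hg.mono fun x hx => by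
    rintro rfl
    have := hx.1
    simp at this
    linarith)
  refine ⟨max C 0, le_max_right _ _, fun x hx => le_max_of_le_left ?_⟩
  obtain ⟨n, hn1, hn2⟩ := exists_mem_Ico_zpow (abs_pos.2 hx) (one_lt_inv_iff₀.2
    ⟨Γ.α_pos, Γ.α_lt_one⟩)
  rw [← hinv n x]
  have hp := Γ.zpow_α_pos n
  refine hC _ ⟨?_, ?_⟩
  · rw [abs_mul, abs_of_pos hp]
    rw [inv_zpow, inv_le_iff_one_le_mul₀ hp] at hn1
    linarith
  · rw [abs_mul, abs_of_pos hp]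
    rw [zpow_add_one₀ (inv_ne_zero Γ.α_pos.ne'), inv_zpow] at hn2
    have := mul_lt_mul_of_pos_left hn2 hp
    rw [mul_inv_cancel_left₀ hp.ne'] at this
    exact this.le

theorem analyticAt_f {x : ℝ} (hx : x ≠ 0) : AnalyticAt ℝ Γ.f x := Γ.analytic x hx

/-- The quotient `f x / x`, the derivative `f'` and the product `x f''` are all dilation invariant.
-/
theorem exists_bounds : ∃ L : ℝ, 0 ≤ L ∧ (∀ x, |Γ.f x| ≤ L * |x|) ∧
    (∀ x ≠ 0, |deriv Γ.f x| ≤ L) ∧ ∀ x ≠ 0, |deriv (deriv Γ.f) x| ≤ L / |x| := by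
  obtain ⟨L0, h0, hL0⟩ := Γ.exists_bound_of_invariant (g := fun x => Γ.f x / x)
    (fun x hx => ((Γ.analyticAt_f hx).continuousAt.div continuousAt_id hx).continuousWithinAt)
    (fun n x => by
      simp only [Γ.dilation_zpow]
      exact mul_div_mul_left _ _ (Γ.zpow_α_pos n).ne')
  obtain ⟨L1, h1, hL1⟩ := Γ.exists_bound_of_invariant (g := deriv Γ.f)
    (fun x hx => (Γ.analyticAt_f hx).deriv.continuousAt.continuousWithinAt) Γ.deriv_zpow
  obtain ⟨L2, h2, hL2⟩ := Γ.exists_bound_of_invariant (g := fun x => x * deriv (deriv Γ.f) x)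
    (fun x hx => (continuousAt_id.mul
      (Γ.analyticAt_f hx).deriv.deriv.continuousAt).continuousWithinAt)
    (fun n x => by
      rw [← Γ.deriv_deriv_zpow n x]; ring)
  refine ⟨L0 + L1 + L2, by positivity, fun x => ?_, fun x hx => ?_, fun x hx => ?_⟩
  · by_cases hx : x = 0
    · simp [hx, Γ.map_zero]
    · have := hL0 x hx
      rw [abs_div, div_le_iff₀ (abs_pos.2 hx)] at this
      exact this.trans (mul_le_mul_of_nonneg_right (by linarith) (abs_nonneg _))
  · exact (hL1 x hx).trans (by linarith)
  · have := hL2 x hx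
    rw [abs_mul] at this
    rw [le_div_iff₀ (abs_pos.2 hx)]
    linarith

/-- Second divided difference of `f`, with its continuous value on the diagonal. -/
def secondSlope (x y : ℝ) : ℝ :=
  if x = y then deriv (deriv Γ.f) y / 2
  else (Γ.f x - Γ.f y - deriv Γ.f y * (x - y)) / (x - y) ^ 2

/-- First divided difference of `f`. -/
def firstSlope (x y : ℝ) : ℝ := deriv Γ.f y + (x - y) * Γ.secondSlope x y

theorem firstSlope_of_ne {x y : ℝ} (h : x ≠ y) :
    Γ.firstSlope x y = (Γ.f x - Γ.f y) / (x - y) := by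
  have := sub_ne_zero.2 h
  rw [firstSlope, secondSlope, if_neg h]
  field_simp
  ring

theorem abs_secondSlope_sub_le {x y c ε : ℝ} (hε : 0 ≤ ε) (h0 : (0 : ℝ) ∉ uIcc y x)
    (hb : ∀ z ∈ uIcc y x, |deriv (deriv Γ.f) z - c| ≤ ε) :
    |Γ.secondSlope x y - c / 2| ≤ ε := by
  have hne : ∀ z ∈ uIcc y x, z ≠ 0 := fun z hz e => h0 (e ▸ hz)
  unfold secondSlope
  split_ifs with h
  · have := hb y left_mem_uIcc
    rw [← sub_div, abs_div, abs_two]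
    linarith [abs_nonneg (deriv (deriv Γ.f) y - c)]
  · have hxy : 0 < (x - y) ^ 2 := by have := sub_ne_zero.2 h; positivity
    have h1 := abs_taylor_two_sub_le hε
      (fun z hz => (Γ.analyticAt_f (hne z hz)).differentiableAt)
      (fun z hz => (Γ.analyticAt_f (hne z hz)).deriv.differentiableAt) hb
    rw [show (Γ.f x - Γ.f y - deriv Γ.f y * (x - y)) / (x - y) ^ 2 - c / 2
      = (Γ.f x - Γ.f y - deriv Γ.f y * (x - y) - c / 2 * (x - y) ^ 2) / (x - y) ^ 2 by
        field_simp, abs_div, abs_of_pos hxy, div_le_iff₀ hxy]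
    exact h1

/-- On the diagonal, Taylor's estimate with `c = f''(a)` bounds the deviation by the oscillation of
`f''`; a radius of at most `|a|` keeps the segment off the origin. -/
theorem continuousAt_secondSlope {a b : ℝ} (ha : a ≠ 0) (hb : b ≠ 0) :
    ContinuousAt (fun p : ℝ × ℝ => Γ.secondSlope p.1 p.2) (a, b) := by
  by_cases hab : a = b
  · subst hab
    rw [Metric.continuousAt_iff]
    intro ε hε
    obtain ⟨δ, hδ, hδ'⟩ := Metric.continuousAt_iff.1
      (Γ.analyticAt_f ha).deriv.deriv.continuousAt (ε / 2) (by positivity)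
    refine ⟨min δ |a|, lt_min hδ (abs_pos.2 ha), fun {p} hp => ?_⟩
    rw [Prod.dist_eq, max_lt_iff] at hp
    have hball : ∀ z ∈ uIcc p.2 p.1, dist z a < min δ |a| := fun z hz =>
      ((convex_ball a (min δ |a|)).ordConnected).uIcc_subset hp.2 hp.1 hz
    have h1 := Γ.abs_secondSlope_sub_le (x := p.1) (y := p.2) (c := deriv (deriv Γ.f) a)
      (ε := ε / 2) (by positivity)
      (fun h0 => by
        have := (hball 0 h0).trans_le (min_le_right _ _)
        rw [dist_zero_left, Real.norm_eq_abs] at this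
        exact lt_irrefl _ this)
      (fun z hz => (hδ' ((hball z hz).trans_le (min_le_left _ _))).le)
    rw [Real.dist_eq]
    rw [show Γ.secondSlope a a = deriv (deriv Γ.f) a / 2 by simp [secondSlope]]
    linarith
  · have hev : ∀ᶠ p : ℝ × ℝ in 𝓝 (a, b), p.1 ≠ p.2 :=
      (isOpen_ne_fun continuous_fst continuous_snd).mem_nhds hab
    have hc : ContinuousAt (fun p : ℝ × ℝ =>
        (Γ.f p.1 - Γ.f p.2 - deriv Γ.f p.2 * (p.1 - p.2)) / (p.1 - p.2) ^ 2) (a, b) := by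
      have h1 : ContinuousAt (fun p : ℝ × ℝ => Γ.f p.1) (a, b) :=
        ContinuousAt.comp (f := Prod.fst) (g := Γ.f) (Γ.analyticAt_f ha).continuousAt
          continuousAt_fst
      have h2 : ContinuousAt (fun p : ℝ × ℝ => Γ.f p.2) (a, b) :=
        ContinuousAt.comp (f := Prod.snd) (g := Γ.f) (Γ.analyticAt_f hb).continuousAt
          continuousAt_snd
      have h3 : ContinuousAt (fun p : ℝ × ℝ => deriv Γ.f p.2) (a, b) :=
        ContinuousAt.comp (f := Prod.snd) (g := deriv Γ.f) (Γ.analyticAt_f hb).deriv.continuousAt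
          continuousAt_snd
      refine ContinuousAt.div ((h1.sub h2).sub (h3.mul (by fun_prop))) (by fun_prop) ?_
      exact pow_ne_zero 2 (sub_ne_zero.2 hab)
    refine hc.congr ?_
    filter_upwards [hev] with p hp
    rw [secondSlope, if_neg hp]

theorem exists_secondSlope_bound : ∃ C : ℝ, 0 ≤ C ∧ ∀ x y : ℝ, x ≠ 0 → y ≠ 0 →
    |Γ.secondSlope x y| ≤ C / (|x| + |y|) := by
  obtain ⟨L, hL, hf, hf', hf''⟩ := Γ.exists_bounds
  -- The far case fixes the constant: `|y| ≤ 2 |x - y|` bounds the numerator by `6 L |x - y|` and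
  -- `|x| + |y|` by `5 |x - y|`. Near the diagonal, `|z| ≥ |y| / 2` on the segment and `f''` is at
  -- most `2 L / |y|`.
  refine ⟨30 * L, by positivity, fun x y hx hy => ?_⟩
  have hx' := abs_pos.2 hx
  have hy' := abs_pos.2 hy
  have htri : |x| ≤ |x - y| + |y| := by
    have := abs_add_le (x - y) y
    rwa [sub_add_cancel] at this
  by_cases h : |x - y| < |y| / 2
  · have hz : ∀ z ∈ uIcc y x, |y| / 2 ≤ |z| := fun z hz => by
      have h1 := abs_sub_left_of_mem_uIcc hz
      have h2 := abs_sub_abs_le_abs_sub y z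
      rw [abs_sub_comm y z] at h2
      linarith
    have h1 := Γ.abs_secondSlope_sub_le (x := x) (y := y) (c := 0) (ε := L / (|y| / 2))
      (by positivity) (fun h0 => by have := hz 0 h0; rw [abs_zero] at this; linarith)
      (fun z hz' => by
        rw [sub_zero]
        have hzp : 0 < |z| := lt_of_lt_of_le (by positivity) (hz z hz')
        exact (hf'' z (abs_pos.1 hzp)).trans (div_le_div_of_nonneg_left hL (by positivity)
          (hz z hz')))
    rw [zero_div, sub_zero] at h1
    refine h1.trans ?_
    rw [div_le_div_iff₀ (by positivity) (by positivity)]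
    nlinarith
  · push Not at h
    have hp : 0 < |x - y| := lt_of_lt_of_le (by positivity) h
    have hne : x ≠ y := sub_ne_zero.1 (abs_pos.1 hp)
    rw [secondSlope, if_neg hne, abs_div, abs_pow]
    have h1 : |Γ.f x - Γ.f y - deriv Γ.f y * (x - y)| ≤ 6 * L * |x - y| := by
      have h2 := abs_sub (Γ.f x - Γ.f y) (deriv Γ.f y * (x - y))
      have h3 := abs_sub (Γ.f x) (Γ.f y)
      rw [abs_mul] at h2
      have h4 := mul_le_mul_of_nonneg_right (hf' y hy) hp.le
      have h5 := hf x
      have h6 := hf y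
      nlinarith
    rw [div_le_div_iff₀ (by positivity) (by positivity)]
    calc |Γ.f x - Γ.f y - deriv Γ.f y * (x - y)| * (|x| + |y|)
        ≤ (6 * L * |x - y|) * (5 * |x - y|) :=
          mul_le_mul h1 (by linarith) (by positivity) (by positivity)
      _ = 30 * L * |x - y| ^ 2 := by ring

theorem secondSlope_zpow (n : ℤ) (x y : ℝ) :
    Γ.α ^ n * Γ.secondSlope (Γ.α ^ n * x) (Γ.α ^ n * y) = Γ.secondSlope x y := by
  have hp := (Γ.zpow_α_pos n).ne'
  unfold secondSlope
  by_cases h : x = y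
  · rw [if_pos h, if_pos (by rw [h]), ← Γ.deriv_deriv_zpow n y]; ring
  · have hs := sub_ne_zero.2 h
    rw [if_neg h, if_neg (fun e => h (mul_left_cancel₀ hp e)), Γ.dilation_zpow, Γ.dilation_zpow,
      Γ.deriv_zpow, ← mul_sub, ← mul_sub]
    field_simp

theorem firstSlope_zpow (n : ℤ) (x y : ℝ) :
    Γ.firstSlope (Γ.α ^ n * x) (Γ.α ^ n * y) = Γ.firstSlope x y := by
  rw [firstSlope, firstSlope, Γ.deriv_zpow, ← Γ.secondSlope_zpow n x y]; ring

/-! ### Logarithmic coordinates -/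

/-- The sign of a branch. -/
def branchSign (b : Bool) : ℝ := if b then 1 else -1

theorem branchSign_ne_zero (b : Bool) : branchSign b ≠ 0 := by cases b <;> simp [branchSign]

theorem abs_branchSign (b : Bool) : |branchSign b| = 1 := by cases b <;> simp [branchSign]

/-- The point `± α ^ s` of the real line with logarithmic coordinate `s`. -/
def point (y : ℝ × Bool) : ℝ := branchSign y.2 * Γ.α ^ y.1

theorem rpow_pos (s : ℝ) : 0 < Γ.α ^ s := Real.rpow_pos_of_pos Γ.α_pos s

theorem point_ne_zero (y : ℝ × Bool) : Γ.point y ≠ 0 :=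
  mul_ne_zero (branchSign_ne_zero _) (Γ.rpow_pos _).ne'

theorem abs_point (y : ℝ × Bool) : |Γ.point y| = Γ.α ^ y.1 := by
  rw [point, abs_mul, abs_branchSign, one_mul, abs_of_pos (Γ.rpow_pos _)]

theorem continuous_point : Continuous Γ.point := by
  have h1 : Continuous fun b : Bool => branchSign b := continuous_of_discreteTopology
  exact (h1.comp continuous_snd).mul ((Real.continuous_const_rpow Γ.α_pos.ne').comp continuous_fst)

/-- Translation of the logarithmic coordinate. -/
def translate (j : ℝ) (y : ℝ × Bool) : ℝ × Bool := (y.1 + j, y.2)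

theorem point_translate (n : ℤ) (y : ℝ × Bool) :
    Γ.point (translate n y) = Γ.α ^ n * Γ.point y := by
  rw [point, point, translate, Real.rpow_add Γ.α_pos, Real.rpow_intCast]; ring

/-- The double-layer kernel in logarithmic coordinates. -/
def kern (y z : ℝ × Bool) : ℝ :=
  1 / (2 * Real.pi) * (Γ.secondSlope (Γ.point y) (Γ.point z)
      / (1 + Γ.firstSlope (Γ.point y) (Γ.point z) ^ 2)
    * ((1 + deriv Γ.f (Γ.point y) ^ 2) / (1 + deriv Γ.f (Γ.point z) ^ 2)) ^ (1 / 4 : ℝ)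
    * Γ.α ^ ((y.1 + z.1) / 2) * |Real.log Γ.α|)

theorem kern_eq (y z : ℝ × Bool) : Γ.kern y z =
    1 / (2 * Real.pi) * (Γ.secondSlope (Γ.point y) (Γ.point z)
      / (1 + Γ.firstSlope (Γ.point y) (Γ.point z) ^ 2)
    * ((1 + deriv Γ.f (Γ.point y) ^ 2) / (1 + deriv Γ.f (Γ.point z) ^ 2)) ^ (1 / 4 : ℝ)
    * Γ.α ^ ((y.1 + z.1) / 2) * |Real.log Γ.α|) := rfl

/-- Translation by `n` is dilation by `α ^ n`: the second slope is homogeneous of degree `-1`, which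
the factor `α ^ ((s + r) / 2)` compensates, and the other factors are invariant. -/
theorem kern_translate (n : ℤ) (y z : ℝ × Bool) :
    Γ.kern (translate n y) (translate n z) = Γ.kern y z := by
  have h1 : Γ.α ^ (((translate n y).1 + (translate n z).1) / 2)
      = Γ.α ^ n * Γ.α ^ ((y.1 + z.1) / 2) := by
    rw [show ((translate n y).1 + (translate n z).1) / 2 = n + (y.1 + z.1) / 2 by
      simp only [translate]; ring, Real.rpow_add Γ.α_pos, Real.rpow_intCast]
  rw [kern, kern, h1]
  simp only [Γ.point_translate, Γ.firstSlope_zpow, Γ.deriv_zpow]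
  rw [← Γ.secondSlope_zpow n (Γ.point y) (Γ.point z)]
  ring

theorem continuous_deriv_point : Continuous fun y => deriv Γ.f (Γ.point y) := by
  rw [continuous_iff_continuousAt]
  intro y
  exact ContinuousAt.comp (f := Γ.point) (g := deriv Γ.f)
    (Γ.analyticAt_f (Γ.point_ne_zero y)).deriv.continuousAt Γ.continuous_point.continuousAt

theorem continuous_kern : Continuous fun p : (ℝ × Bool) × (ℝ × Bool) => Γ.kern p.1 p.2 := by
  have hP : Continuous fun p : (ℝ × Bool) × (ℝ × Bool) =>
      Γ.secondSlope (Γ.point p.1) (Γ.point p.2) := by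
    rw [continuous_iff_continuousAt]
    intro p
    exact ContinuousAt.comp
      (f := fun p : (ℝ × Bool) × (ℝ × Bool) => (Γ.point p.1, Γ.point p.2))
      (g := fun q : ℝ × ℝ => Γ.secondSlope q.1 q.2)
      (Γ.continuousAt_secondSlope (Γ.point_ne_zero _) (Γ.point_ne_zero _))
      ((Γ.continuous_point.comp continuous_fst).prodMk
        (Γ.continuous_point.comp continuous_snd)).continuousAt
  have h1 : Continuous fun p : (ℝ × Bool) × (ℝ × Bool) => deriv Γ.f (Γ.point p.1) :=
    Γ.continuous_deriv_point.comp continuous_fst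
  have h2 : Continuous fun p : (ℝ × Bool) × (ℝ × Bool) => deriv Γ.f (Γ.point p.2) :=
    Γ.continuous_deriv_point.comp continuous_snd
  have hQ : Continuous fun p : (ℝ × Bool) × (ℝ × Bool) =>
      Γ.firstSlope (Γ.point p.1) (Γ.point p.2) := by
    unfold firstSlope
    exact h2.add (((Γ.continuous_point.comp continuous_fst).sub
      (Γ.continuous_point.comp continuous_snd)).mul hP)
  unfold kern
  refine continuous_const.mul ((((hP.div (by fun_prop) fun p => by positivity).mul ?_).mul
    ((Real.continuous_const_rpow Γ.α_pos.ne').comp (by fun_prop))).mul continuous_const)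
  refine Continuous.rpow_const ?_ fun x => Or.inr (by norm_num)
  exact (continuous_const.add (h1.pow 2)).div (by fun_prop) fun p => by positivity

/-- The numerator is `α ^ (|s - r| / 2)` times the larger of the two terms in the denominator. -/
theorem rpow_half_sum_div_le (s r : ℝ) :
    Γ.α ^ ((s + r) / 2) / (Γ.α ^ s + Γ.α ^ r) ≤ Γ.α ^ (|s - r| / 2) := by
  have hs := Γ.rpow_pos s
  have hr := Γ.rpow_pos r
  rw [div_le_iff₀ (by positivity)]
  have hp := Γ.rpow_pos (|s - r| / 2)
  rcases le_total s r with h | h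
  · have : Γ.α ^ ((s + r) / 2) = Γ.α ^ (|s - r| / 2) * Γ.α ^ s := by
      rw [← Real.rpow_add Γ.α_pos, abs_of_nonpos (by linarith)]; ring_nf
    rw [this]
    exact mul_le_mul_of_nonneg_left (by linarith) hp.le
  · have : Γ.α ^ ((s + r) / 2) = Γ.α ^ (|s - r| / 2) * Γ.α ^ r := by
      rw [← Real.rpow_add Γ.α_pos, abs_of_nonneg (by linarith)]; ring_nf
    rw [this]
    exact mul_le_mul_of_nonneg_left (by linarith) hp.le

/-- The weight turns the `1 / (|x| + |y|)` decay of the second slope into exponential decay in the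
logarithmic distance. Schur's test and the summability of the blocks both rest on this. -/
theorem exists_kern_bound : ∃ C : ℝ, 0 ≤ C ∧ ∀ y z : ℝ × Bool,
    |Γ.kern y z| ≤ C * Γ.α ^ (|y.1 - z.1| / 2) := by
  obtain ⟨L, hL, -, hf', -⟩ := Γ.exists_bounds
  obtain ⟨C, hC, hS⟩ := Γ.exists_secondSlope_bound
  refine ⟨1 / (2 * Real.pi) * (C * (1 + L ^ 2) ^ (1 / 4 : ℝ) * |Real.log Γ.α|), by positivity,
    fun y z => ?_⟩
  have hq : ((1 + deriv Γ.f (Γ.point y) ^ 2) / (1 + deriv Γ.f (Γ.point z) ^ 2)) ^ (1 / 4 : ℝ)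
      ≤ (1 + L ^ 2) ^ (1 / 4 : ℝ) := by
    refine Real.rpow_le_rpow (by positivity) ?_ (by norm_num)
    rw [div_le_iff₀ (by positivity)]
    have h1 := hf' _ (Γ.point_ne_zero y)
    have h2 : deriv Γ.f (Γ.point y) ^ 2 ≤ L ^ 2 := sq_le_sq' (abs_le.1 h1).1 (abs_le.1 h1).2
    nlinarith [sq_nonneg (deriv Γ.f (Γ.point z)), sq_nonneg L]
  have hs := hS _ _ (Γ.point_ne_zero y) (Γ.point_ne_zero z)
  rw [Γ.abs_point, Γ.abs_point] at hs
  have hPQ : |Γ.secondSlope (Γ.point y) (Γ.point z)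
      / (1 + Γ.firstSlope (Γ.point y) (Γ.point z) ^ 2)| ≤ C / (Γ.α ^ y.1 + Γ.α ^ z.1) := by
    rw [abs_div]
    refine (div_le_self (abs_nonneg _) ?_).trans hs
    rw [abs_of_nonneg (by positivity)]
    nlinarith [sq_nonneg (Γ.firstSlope (Γ.point y) (Γ.point z))]
  have hsum : 0 < Γ.α ^ y.1 + Γ.α ^ z.1 := add_pos (Γ.rpow_pos _) (Γ.rpow_pos _)
  have hh := Γ.rpow_pos ((y.1 + z.1) / 2)
  rw [kern, abs_mul, abs_mul, abs_mul, abs_mul, abs_abs, abs_of_nonneg (Real.rpow_nonneg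
    (show 0 ≤ (1 + deriv Γ.f (Γ.point y) ^ 2) / (1 + deriv Γ.f (Γ.point z) ^ 2) by positivity) _),
    abs_of_pos hh, abs_of_nonneg (show 0 ≤ 1 / (2 * Real.pi) by positivity), mul_assoc (1 / (2 * Real.pi))]
  refine mul_le_mul_of_nonneg_left ?_ (by positivity)
  calc _ ≤ C / (Γ.α ^ y.1 + Γ.α ^ z.1) * (1 + L ^ 2) ^ (1 / 4 : ℝ)
        * Γ.α ^ ((y.1 + z.1) / 2) * |Real.log Γ.α| := by gcongr
    _ = C * (1 + L ^ 2) ^ (1 / 4 : ℝ) * |Real.log Γ.α|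
        * (Γ.α ^ ((y.1 + z.1) / 2) / (Γ.α ^ y.1 + Γ.α ^ z.1)) := by ring
    _ ≤ _ := mul_le_mul_of_nonneg_left (Γ.rpow_half_sum_div_le _ _) (by positivity)

attribute [irreducible] kern

end AnalyticDilationGraph

namespace AnalyticDilationGraph

variable (Γ : AnalyticDilationGraph)

/-! ### The truncated kernels in logarithmic coordinates -/

/-- The branch of the graph over the half line with sign `b`. -/
def branch (b : Bool) (x : ℝ) : ℝ := Γ.f (branchSign b * x)

theorem branch_true : Γ.branch true = Γ.fPos := by funext x; simp [branch, branchSign, fPos]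

theorem branch_false : Γ.branch false = Γ.fNeg := by funext x; simp [branch, branchSign, fNeg]

theorem deriv_branch (b : Bool) (x : ℝ) :
    deriv (Γ.branch b) x = branchSign b * deriv Γ.f (branchSign b * x) := by
  exact deriv_comp_mul_left (branchSign b) Γ.f x

theorem deriv_deriv_branch (b : Bool) (x : ℝ) :
    deriv (deriv (Γ.branch b)) x = deriv (deriv Γ.f) (branchSign b * x) := by
  have h : deriv (Γ.branch b) = fun x => branchSign b * deriv Γ.f (branchSign b * x) :=
    funext (Γ.deriv_branch b)
  have h1 := deriv_comp_mul_left (branchSign b) (deriv Γ.f) x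
  rw [h, deriv_const_mul_field, h1, smul_eq_mul, ← mul_assoc]
  cases b <;> simp [branchSign]

theorem point_eq_iff (b : Bool) (s r : ℝ) : Γ.point (s, b) = Γ.point (r, b) ↔ s = r := by
  simp only [point]
  rw [mul_right_inj' (branchSign_ne_zero b)]
  exact (Real.strictAnti_rpow_of_base_lt_one Γ.α_pos Γ.α_lt_one).injective.eq_iff

theorem point_ne_of_ne {b b' : Bool} (h : b ≠ b') (s r : ℝ) :
    Γ.point (s, b) ≠ Γ.point (r, b') := by
  have hs := Γ.rpow_pos s
  have hr := Γ.rpow_pos r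
  cases b <;> cases b' <;> simp [point, branchSign] at h ⊢ <;> linarith

theorem pDiag_eq_secondSlope (b : Bool) (j : ℤ) (x y : ℝ) :
    pDiag Γ.α (Γ.branch b) j x y = Γ.secondSlope (Γ.point (x + j, b)) (Γ.point (y, b)) := by
  unfold pDiag secondSlope
  simp only [Γ.point_eq_iff]
  split_ifs with h
  · rw [Γ.deriv_deriv_branch]; rfl
  · rw [Γ.deriv_branch]
    simp only [branch, point]
    cases b
    · simp only [branchSign, Bool.false_eq_true, if_false]
      congr 1 <;> ring_nf
    · simp only [branchSign, if_true]
      congr 1 <;> ring_nf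

/-- Reflecting the left branch reverses the sign of slopes, so only the squares agree; the kernel
contains only the square. -/
theorem qDiag_sq_eq (b : Bool) (j : ℤ) (x y : ℝ) :
    qDiag Γ.α (Γ.branch b) j x y ^ 2
      = Γ.firstSlope (Γ.point (x + j, b)) (Γ.point (y, b)) ^ 2 := by
  unfold qDiag
  split_ifs with h
  · rw [h, firstSlope, sub_self, zero_mul, add_zero, Γ.deriv_branch, mul_pow]
    cases b <;> simp [branchSign, point]
  · rw [Γ.firstSlope_of_ne (fun e => h ((Γ.point_eq_iff b _ _).1 e)), div_pow, div_pow]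
    simp only [branch, point]
    congr 1
    rw [← mul_sub, mul_pow]
    cases b <;> simp [branchSign]

theorem pOff_eq_secondSlope {b b' : Bool} (hb : b ≠ b') (j : ℤ) (x y : ℝ) :
    pOff Γ.α (Γ.branch b) (Γ.branch b') j x y
      = Γ.secondSlope (Γ.point (x + j, b)) (Γ.point (y, b')) := by
  rw [secondSlope, if_neg (Γ.point_ne_of_ne hb _ _), pOff, Γ.deriv_branch]
  simp only [branch, point]
  cases b <;> cases b' <;> simp only [ne_eq, not_true_eq_false] at hb <;>
    simp only [branchSign, Bool.false_eq_true, if_false, if_true] <;> congr 1 <;> ring_nf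

theorem qOff_sq_eq {b b' : Bool} (hb : b ≠ b') (j : ℤ) (x y : ℝ) :
    qOff Γ.α (Γ.branch b) (Γ.branch b') j x y ^ 2
      = Γ.firstSlope (Γ.point (x + j, b)) (Γ.point (y, b')) ^ 2 := by
  rw [Γ.firstSlope_of_ne (Γ.point_ne_of_ne hb _ _), qOff, div_pow, div_pow]
  simp only [branch, point]
  cases b <;> cases b' <;> simp only [ne_eq, not_true_eq_false] at hb <;>
    simp only [branchSign, Bool.false_eq_true, if_false, if_true] <;> congr 1 <;> ring_nf

/-- The truncated sum over translates of the kernel. -/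
def blochKernel (t : ℝ) (M : ℕ) (y z : ℝ × Bool) : ℂ :=
  ∑ j ∈ Finset.Icc (-(M : ℤ)) (M : ℤ), phase j t * (Γ.kern (translate j y) z : ℂ)

/-- Diagonal and off-diagonal kernels are treated at once. The truncated kernel has `f'` at `α ^ x`
where `kern` has it at `α ^ (x + j)`; these agree by dilation invariance of `f'`. -/
theorem truncatedKernel_eq_blochKernel {b b' : Bool} {p q : ℤ → ℝ → ℝ → ℝ} {x y : ℝ}
    (hp : ∀ j : ℤ, p j x y = Γ.secondSlope (Γ.point (x + j, b)) (Γ.point (y, b')))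
    (hq : ∀ j : ℤ, q j x y ^ 2 = Γ.firstSlope (Γ.point (x + j, b)) (Γ.point (y, b')) ^ 2)
    (t : ℝ) (M : ℕ) :
    truncatedKernel Γ.α (Γ.branch b) (Γ.branch b') p q t M x y
      = Γ.blochKernel t M (x, b) (y, b') := by
  rw [truncatedKernel, blochKernel, Finset.mul_sum]
  refine Finset.sum_congr rfl fun j _ => ?_
  have h1 : ∀ (b : Bool) (s : ℝ), deriv (Γ.branch b) (Γ.α ^ s) ^ 2
      = deriv Γ.f (Γ.point (s, b)) ^ 2 := fun b s => by
    rw [Γ.deriv_branch, mul_pow]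
    cases b <;> simp [branchSign, point]
  have h2 : deriv Γ.f (Γ.point (translate j (x, b))) = deriv Γ.f (Γ.point (x, b)) := by
    rw [Γ.point_translate, Γ.deriv_zpow]
  rw [kern, h2, hp, hq, h1, h1, phase,
    show ((translate j (x, b)).1 + (y, b').1) / 2 = (x + y + j) / 2 by simp only [translate]; ring]
  simp only [translate]
  push_cast
  ring

theorem diagKernel_eq (b : Bool) (t : ℝ) (M : ℕ) (x y : ℝ) :
    diagKernel Γ.α (Γ.branch b) t M x y = Γ.blochKernel t M (x, b) (y, b) :=
  Γ.truncatedKernel_eq_blochKernel (fun j => Γ.pDiag_eq_secondSlope b j x y)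
    (fun j => Γ.qDiag_sq_eq b j x y) t M

theorem offKernel_eq {b b' : Bool} (hb : b ≠ b') (t : ℝ) (M : ℕ) (x y : ℝ) :
    offKernel Γ.α (Γ.branch b) (Γ.branch b') t M x y = Γ.blochKernel t M (x, b) (y, b') :=
  Γ.truncatedKernel_eq_blochKernel (fun j => Γ.pOff_eq_secondSlope hb j x y)
    (fun j => Γ.qOff_sq_eq hb j x y) t M

end AnalyticDilationGraph

/-! ### Integral operators on `L²` -/

section IntegralOperator

variable {Y : Type*} [MeasurableSpace Y] {ν : Measure Y}

/-- Cauchy–Schwarz for the splitting `a b = a ^ (1/2) · (a ^ (1/2) b)`. -/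
theorem ENNReal.sq_lintegral_mul_le {a b : Y → ENNReal} (ha : AEMeasurable a ν)
    (hb : AEMeasurable b ν) :
    (∫⁻ y, a y * b y ∂ν) ^ 2 ≤ (∫⁻ y, a y ∂ν) * ∫⁻ y, a y * b y ^ 2 ∂ν := by
  have hp : Real.HolderConjugate 2 2 := Real.HolderConjugate.two_two
  have hsq : ∀ x : ENNReal, (x ^ (1 / 2 : ℝ)) ^ (2 : ℝ) = x := fun x => by
    rw [← ENNReal.rpow_mul]; norm_num
  have hsq' : ∀ x : ENNReal, x ^ (1 / 2 : ℝ) * x ^ (1 / 2 : ℝ) = x := fun x => by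
    rw [← ENNReal.rpow_add_of_nonneg _ _ (by norm_num) (by norm_num)]; norm_num
  have h := ENNReal.lintegral_mul_le_Lp_mul_Lq ν hp
    (f := fun y => a y ^ (1 / 2 : ℝ)) (g := fun y => a y ^ (1 / 2 : ℝ) * b y)
    (ha.pow_const _) ((ha.pow_const _).mul hb)
  simp only [Pi.mul_apply, ← mul_assoc, hsq', hsq,
    ENNReal.mul_rpow_of_nonneg _ _ (show (0 : ℝ) ≤ 2 by norm_num)] at h
  calc (∫⁻ y, a y * b y ∂ν) ^ 2
      ≤ ((∫⁻ y, a y ∂ν) ^ (1 / 2 : ℝ) * (∫⁻ y, a y * b y ^ (2 : ℝ) ∂ν) ^ (1 / 2 : ℝ)) ^ 2 :=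
        pow_le_pow_left' h 2
    _ = _ := by
        rw [mul_pow, sq, hsq', sq, hsq']
        simp

theorem lintegral_enorm_sq_integral_le [SFinite ν] {k : Y → Y → ℂ}
    (hk : Measurable (Function.uncurry k)) {C : ENNReal} (h1 : ∀ x, ∫⁻ y, ‖k x y‖ₑ ∂ν ≤ C)
    (h2 : ∀ y, ∫⁻ x, ‖k x y‖ₑ ∂ν ≤ C) {φ : Y → ℂ} (hφ : AEStronglyMeasurable φ ν) :
    ∫⁻ x, ‖∫ y, k x y * φ y ∂ν‖ₑ ^ 2 ∂ν ≤ C ^ 2 * ∫⁻ y, ‖φ y‖ₑ ^ 2 ∂ν := by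
  have hkx : ∀ x, Measurable fun y => ‖k x y‖ₑ := fun x =>
    (hk.comp measurable_prodMk_left).enorm
  have hky : ∀ y, Measurable fun x => ‖k x y‖ₑ := fun y =>
    (hk.comp measurable_prodMk_right).enorm
  have hprod : AEMeasurable (Function.uncurry fun x y => ‖k x y‖ₑ * ‖φ y‖ₑ ^ 2) (ν.prod ν) :=
    hk.enorm.aemeasurable.mul
      ((hφ.comp_quasiMeasurePreserving Measure.quasiMeasurePreserving_snd).enorm.pow_const 2)
  calc ∫⁻ x, ‖∫ y, k x y * φ y ∂ν‖ₑ ^ 2 ∂ν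
      ≤ ∫⁻ x, C * ∫⁻ y, ‖k x y‖ₑ * ‖φ y‖ₑ ^ 2 ∂ν ∂ν := by
        refine lintegral_mono fun x => ?_
        refine (pow_le_pow_left' (enorm_integral_le_lintegral_enorm _) 2).trans ?_
        simp only [enorm_mul]
        exact (ENNReal.sq_lintegral_mul_le (hkx x).aemeasurable hφ.enorm).trans
          (mul_le_mul_left (h1 x) _)
    _ = C * ∫⁻ y, ∫⁻ x, ‖k x y‖ₑ * ‖φ y‖ₑ ^ 2 ∂ν ∂ν := by
        have hin : AEMeasurable (fun x => ∫⁻ y, ‖k x y‖ₑ * ‖φ y‖ₑ ^ 2 ∂ν) ν :=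
          hprod.lintegral_prod_right'
        rw [lintegral_const_mul'' _ hin, lintegral_lintegral_swap hprod]
    _ = C * ∫⁻ y, (∫⁻ x, ‖k x y‖ₑ ∂ν) * ‖φ y‖ₑ ^ 2 ∂ν := by
        congr 1
        exact lintegral_congr fun y => lintegral_mul_const _ (hky y)
    _ ≤ C * ∫⁻ y, C * ‖φ y‖ₑ ^ 2 ∂ν :=
        mul_le_mul_right (lintegral_mono fun y => mul_le_mul_left (h2 y) _) _
    _ = C ^ 2 * ∫⁻ y, ‖φ y‖ₑ ^ 2 ∂ν := by
        rw [lintegral_const_mul'' _ (hφ.enorm.pow_const 2), ← mul_assoc, sq]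

theorem eLpNorm_two_eq (f : Y → ℂ) :
    eLpNorm f 2 ν = (∫⁻ x, ‖f x‖ₑ ^ 2 ∂ν) ^ (1 / 2 : ℝ) := by
  rw [eLpNorm_eq_lintegral_rpow_enorm_toReal (by norm_num) (by norm_num)]
  simp

/-- Schur's test: kernels with bounded rows and columns define bounded operators. -/
theorem exists_integralOperator [SFinite ν] {k : Y → Y → ℂ}
    (hk : Measurable (Function.uncurry k)) {C : NNReal} (h1 : ∀ x, ∫⁻ y, ‖k x y‖ₑ ∂ν ≤ C)
    (h2 : ∀ y, ∫⁻ x, ‖k x y‖ₑ ∂ν ≤ C)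
    (hint : ∀ (φ : Lp ℂ 2 ν) x, Integrable (fun y => k x y * φ y) ν) :
    ∃ T : Lp ℂ 2 ν →L[ℂ] Lp ℂ 2 ν, ∀ φ, T φ =ᵐ[ν] fun x => ∫ y, k x y * φ y ∂ν := by
  have hle : ∀ φ : Lp ℂ 2 ν, eLpNorm (fun x => ∫ y, k x y * φ y ∂ν) 2 ν ≤ C * eLpNorm φ 2 ν := by
    intro φ
    rw [eLpNorm_two_eq, eLpNorm_two_eq]
    refine (ENNReal.rpow_le_rpow (lintegral_enorm_sq_integral_le hk h1 h2
      (Lp.aestronglyMeasurable φ)) (by norm_num)).trans_eq ?_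
    rw [ENNReal.mul_rpow_of_nonneg _ _ (by norm_num), ← ENNReal.rpow_natCast, ← ENNReal.rpow_mul]
    norm_num
  have hmem : ∀ φ : Lp ℂ 2 ν, MemLp (fun x => ∫ y, k x y * φ y ∂ν) 2 ν := by
    intro φ
    refine ⟨?_, (hle φ).trans_lt (ENNReal.mul_lt_top ENNReal.coe_lt_top (Lp.eLpNorm_lt_top φ))⟩
    exact AEStronglyMeasurable.integral_prod_right' (f := fun p : Y × Y => k p.1 p.2 * φ p.2)
      (hk.aestronglyMeasurable.mul ((Lp.aestronglyMeasurable φ).comp_quasiMeasurePreserving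
        Measure.quasiMeasurePreserving_snd))
  let T₀ : Lp ℂ 2 ν →ₗ[ℂ] Lp ℂ 2 ν :=
    { toFun := fun φ => (hmem φ).toLp
      map_add' := fun φ ψ => by
        rw [← MemLp.toLp_add]
        refine MemLp.toLp_congr _ _ (Eventually.of_forall fun x => ?_)
        simp only [Pi.add_apply]
        rw [← integral_add (hint φ x) (hint ψ x)]
        refine integral_congr_ae ?_
        filter_upwards [Lp.coeFn_add φ ψ] with y hy
        rw [hy, Pi.add_apply, mul_add]
      map_smul' := fun a φ => by
        rw [RingHom.id_apply, ← MemLp.toLp_const_smul]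
        refine MemLp.toLp_congr _ _ (Eventually.of_forall fun x => ?_)
        simp only [Pi.smul_apply, smul_eq_mul]
        rw [← integral_const_mul]
        refine integral_congr_ae ?_
        filter_upwards [Lp.coeFn_smul a φ] with y hy
        rw [hy, Pi.smul_apply, smul_eq_mul]; ring }
  refine ⟨T₀.mkContinuous C fun φ => ?_, fun φ => (hmem φ).coeFn_toLp⟩
  change ‖(hmem φ).toLp‖ ≤ C * ‖φ‖
  rw [Lp.norm_toLp, Lp.norm_def]
  have := ENNReal.toReal_mono (ENNReal.mul_ne_top ENNReal.coe_ne_top (Lp.eLpNorm_ne_top φ)) (hle φ)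
  rwa [ENNReal.toReal_mul, ENNReal.coe_toReal] at this

end IntegralOperator

theorem integrable_rpow_abs {α : ℝ} (h0 : 0 < α) (h1 : α < 1) {c : ℝ} (hc : 0 < c) :
    Integrable fun u : ℝ => α ^ (c * |u|) := by
  have hb : 0 < -(Real.log α * c) := by
    have := mul_pos (neg_pos.2 (Real.log_neg h0 h1)) hc
    linarith
  have hI : IntegrableOn (fun u : ℝ => α ^ (c * |u|)) (Ioi 0) := by
    refine (exp_neg_integrableOn_Ioi 0 hb).congr_fun (fun u hu => ?_) measurableSet_Ioi
    change Real.exp _ = α ^ (c * |u|)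
    rw [abs_of_pos hu, Real.rpow_def_of_pos h0]; ring_nf
  rw [← integrableOn_univ, ← Iic_union_Ioi (a := (0 : ℝ))]
  refine IntegrableOn.union ?_ hI
  rw [integrableOn_Iic_iff_integrableOn_Iio]
  have := hI.comp_neg
  simpa using this

/-! ### The translation group in logarithmic coordinates -/

namespace AnalyticDilationGraph

/-- Lebesgue measure on two copies of the line. -/
def logMeasure : Measure (ℝ × Bool) := (volume : Measure ℝ).prod Measure.count

instance : SigmaFinite logMeasure := by unfold logMeasure; infer_instance

/-- `L²` in logarithmic coordinates. -/
abbrev LogL2 : Type := Lp ℂ 2 logMeasure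

theorem measurePreserving_translate (j : ℝ) :
    MeasurePreserving (translate j) logMeasure logMeasure :=
  (measurePreserving_add_right volume j).prod (MeasurePreserving.id Measure.count)

theorem translate_translate (i j : ℝ) (y : ℝ × Bool) :
    translate i (translate j y) = translate (i + j) y := by
  simp only [translate]; rw [add_assoc, add_comm j]

theorem translate_zero (y : ℝ × Bool) : translate 0 y = y := by simp [translate]

theorem measurable_translate (j : ℝ) : Measurable (translate j) :=
  (measurePreserving_translate j).measurable

theorem continuous_translate (j : ℝ) : Continuous (translate j) := by
  unfold translate; fun_prop

theorem measurableEmbedding_translate (j : ℝ) : MeasurableEmbedding (translate j) :=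
  MeasurableEquiv.measurableEmbedding
    { toFun := translate j
      invFun := translate (-j)
      left_inv := fun y => by rw [translate_translate, neg_add_cancel, translate_zero]
      right_inv := fun y => by rw [translate_translate, add_neg_cancel, translate_zero]
      measurable_toFun := measurable_translate j
      measurable_invFun := measurable_translate (-j) }

/-- Translation by an integer as an isometry of `L²`. -/
def shift (j : ℤ) : LogL2 →ₗᵢ[ℂ] LogL2 :=
  Lp.compMeasurePreservingₗᵢ ℂ (translate (-j)) (measurePreserving_translate (-j))

theorem coeFn_shift (j : ℤ) (φ : LogL2) :
    shift j φ =ᵐ[logMeasure] fun y => φ (translate (-j) y) :=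
  Lp.coeFn_compMeasurePreserving φ (measurePreserving_translate (-j))

/-- The fundamental domain. -/
def cell : Set (ℝ × Bool) := Ico 0 1 ×ˢ univ

theorem measurableSet_cell : MeasurableSet cell := measurableSet_Ico.prod MeasurableSet.univ

theorem logMeasure_cell : logMeasure cell = 2 := by
  rw [cell, logMeasure, Measure.prod_prod]
  simp [Measure.count_apply_finite _ (Set.toFinite _)]

theorem mem_cell_iff (y : ℝ × Bool) : y ∈ cell ↔ ⌊y.1⌋ = 0 := by
  rw [cell, Set.mem_prod, Int.floor_eq_zero_iff]; simp

theorem floor_translate (j : ℤ) (y : ℝ × Bool) : ⌊(translate j y).1⌋ = ⌊y.1⌋ + j :=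
  Int.floor_add_intCast _ _

/-- Restriction to the fundamental domain. -/
def cellProj : LogL2 →L[ℂ] LogL2 :=
  LinearMap.mkContinuous
    { toFun := fun φ => ((Lp.memLp φ).indicator measurableSet_cell).toLp
      map_add' := fun φ ψ => by
        rw [← MemLp.toLp_add]
        refine MemLp.toLp_congr _ _ ?_
        filter_upwards [Lp.coeFn_add φ ψ] with y hy
        by_cases h : y ∈ cell
        · simpa [h] using hy
        · simp [h]
      map_smul' := fun a φ => by
        rw [RingHom.id_apply, ← MemLp.toLp_const_smul]
        refine MemLp.toLp_congr _ _ ?_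
        filter_upwards [Lp.coeFn_smul a φ] with y hy
        by_cases h : y ∈ cell
        · simpa [h] using hy
        · simp [h] } 1 fun φ => by
    rw [one_mul]
    refine Lp.norm_le_norm_of_ae_le ?_
    filter_upwards [((Lp.memLp φ).indicator measurableSet_cell).coeFn_toLp] with y hy
    exact (congrArg norm hy).trans_le (norm_indicator_le_norm_self _ _)

theorem coeFn_cellProj (φ : LogL2) : cellProj φ =ᵐ[logMeasure] cell.indicator φ :=
  ((Lp.memLp φ).indicator measurableSet_cell).coeFn_toLp

theorem ae_translate {p : ℝ × Bool → Prop} (j : ℝ) (h : ∀ᵐ y ∂logMeasure, p y) :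
    ∀ᵐ y ∂logMeasure, p (translate j y) :=
  (measurePreserving_translate j).quasiMeasurePreserving.ae h

theorem coeFn_cellProj_shift (j : ℤ) (φ : LogL2) :
    cellProj (shift j φ) =ᵐ[logMeasure] cell.indicator fun y => φ (translate (-j) y) := by
  filter_upwards [coeFn_cellProj (shift j φ), coeFn_shift j φ] with y h1 h2
  rw [h1]
  by_cases h : y ∈ cell <;> simp [h, h2]

/-- The cells are half-open, so integer translates partition the two lines: distinct translates of
the range of `cellProj` have disjoint supports, and the shift by `-⌊y.1⌋` brings any `y` into the
cell. -/
theorem isShiftSystem : IsShiftSystem shift cellProj where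
  zero φ := by
    refine Lp.ext ?_
    filter_upwards [coeFn_shift 0 φ] with y hy
    rw [hy, Int.cast_zero, neg_zero, translate_zero]
  add i j φ := by
    refine Lp.ext ?_
    filter_upwards [coeFn_shift (i + j) φ, coeFn_shift i (shift j φ),
      ae_translate (-i) (coeFn_shift j φ)] with y h1 h2 h3
    rw [h1, h2, h3, translate_translate]
    congr 2; push_cast; ring
  idem φ := by
    refine Lp.ext ?_
    filter_upwards [coeFn_cellProj φ, coeFn_cellProj (cellProj φ)] with y h1 h2
    rw [h2]
    by_cases h : y ∈ cell <;> simp [h, h1]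
  symm φ ψ := by
    rw [L2.inner_def, L2.inner_def]
    refine integral_congr_ae ?_
    filter_upwards [coeFn_cellProj φ, coeFn_cellProj ψ] with y h1 h2
    rw [h1, h2]
    by_cases h : y ∈ cell <;> simp [h]
  orth j hj φ := by
    refine Lp.ext ?_
    filter_upwards [coeFn_cellProj_shift j (cellProj φ),
      ae_translate (-j) (coeFn_cellProj φ), Lp.coeFn_zero ℂ 2 logMeasure] with y h1 h2 h3
    rw [h1, h3, Pi.zero_apply]
    by_cases h : y ∈ cell
    · rw [indicator_of_mem h, h2, indicator_of_notMem]
      rw [mem_cell_iff] at h ⊢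
      have := floor_translate (-j) y
      push_cast at this
      rw [this, h]
      omega
    · rw [indicator_of_notMem h]
  sep φ h := by
    refine Lp.ext ?_
    have h1 : ∀ k : ℤ, ∀ᵐ y ∂logMeasure, y ∈ cell → φ (translate (-k) y) = 0 := fun k => by
      have h2 := coeFn_cellProj_shift k φ
      rw [h k] at h2
      filter_upwards [h2, Lp.coeFn_zero ℂ 2 logMeasure] with y h3 h4 hy
      rwa [h4, Pi.zero_apply, indicator_of_mem hy, eq_comm] at h3
    have h2 : ∀ᵐ y ∂logMeasure, ∀ k : ℤ, translate k y ∈ cell → φ y = 0 := by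
      rw [ae_all_iff]
      intro k
      filter_upwards [ae_translate k (h1 k)] with y hy hc
      have := hy hc
      rwa [translate_translate, neg_add_cancel, translate_zero] at this
    filter_upwards [h2, Lp.coeFn_zero ℂ 2 logMeasure] with y h3 h4
    rw [h4, Pi.zero_apply]
    refine h3 (-⌊y.1⌋) ?_
    rw [mem_cell_iff, floor_translate]
    omega

/-! ### The double-layer operator in logarithmic coordinates -/

variable (Γ : AnalyticDilationGraph)

theorem lintegral_logMeasure_fst {g : ℝ → ENNReal} (hg : Measurable g) :
    ∫⁻ z : ℝ × Bool, g z.1 ∂logMeasure = 2 * ∫⁻ u, g u := by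
  rw [logMeasure, lintegral_prod (fun z : ℝ × Bool => g z.1) (hg.comp measurable_fst).aemeasurable]
  simp only [lintegral_const]
  rw [lintegral_mul_const _ hg, mul_comm]
  simp [Measure.count_apply_finite _ (Set.toFinite _)]

theorem measurable_rpow_abs (c s : ℝ) : Measurable fun u : ℝ => Γ.α ^ (c * |s - u|) :=
  ((Real.continuous_const_rpow Γ.α_pos.ne').comp (by fun_prop)).measurable

theorem integrable_rpow_fst {c : ℝ} (hc : 0 < c) (s : ℝ) :
    Integrable (fun z : ℝ × Bool => Γ.α ^ (c * |s - z.1|)) logMeasure := by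
  have h := (integrable_rpow_abs Γ.α_pos Γ.α_lt_one hc).comp_sub_left s
  exact h.comp_fst (Measure.count : Measure Bool)

theorem measurable_kern : Measurable (Function.uncurry fun y z => (Γ.kern y z : ℂ)) :=
  (Complex.continuous_ofReal.comp Γ.continuous_kern).measurable

theorem exists_sq_kern_bound : ∃ C : ℝ, ∀ y z : ℝ × Bool,
    ‖(Γ.kern y z : ℂ)‖ ^ 2 ≤ C * Γ.α ^ (1 * |y.1 - z.1|) := by
  obtain ⟨C, hC, hb⟩ := Γ.exists_kern_bound
  refine ⟨C ^ 2, fun y z => ?_⟩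
  rw [Complex.norm_real, Real.norm_eq_abs]
  refine (pow_le_pow_left₀ (abs_nonneg _) (hb y z) 2).trans_eq ?_
  have h : (Γ.α ^ (|y.1 - z.1| / 2)) ^ 2 = Γ.α ^ (1 * |y.1 - z.1|) := by
    rw [sq, ← Real.rpow_add Γ.α_pos]
    congr 1; ring
  rw [mul_pow, h]

theorem continuous_kern_right (y : ℝ × Bool) : Continuous fun z => Γ.kern y z := by
  have h := Γ.continuous_kern
  have h2 : Continuous fun z : ℝ × Bool => (y, z) := by fun_prop
  exact h.comp h2

theorem measurable_kern_right (y : ℝ × Bool) : Measurable fun z => (Γ.kern y z : ℂ) := by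
  have h := (Γ.continuous_kern_right y).measurable
  exact Complex.measurable_ofReal.comp h

/-- This holds at every `y`, not only almost every one, so the integral against an `L²` function
makes sense pointwise; Schur's test and the principal value use it in that form. -/
theorem memLp_kern (y : ℝ × Bool) : MemLp (fun z => (Γ.kern y z : ℂ)) 2 logMeasure := by
  obtain ⟨C, hb⟩ := Γ.exists_sq_kern_bound
  have hm := Γ.measurable_kern_right y
  have hi := (Γ.integrable_rpow_fst one_pos y.1).const_mul C
  refine (memLp_two_iff_integrable_sq_norm hm.aestronglyMeasurable).2 ?_
  refine hi.mono' (hm.norm.pow_const 2).aestronglyMeasurable (Eventually.of_forall fun z => ?_)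
  rw [norm_pow, norm_norm]
  exact hb y z

theorem integrable_kern_mul (φ : LogL2) (y : ℝ × Bool) :
    Integrable (fun z => (Γ.kern y z : ℂ) * φ z) logMeasure :=
  (Γ.memLp_kern y).integrable_mul (Lp.memLp φ)

theorem exists_lintegral_kern_le : ∃ C : NNReal,
    (∀ y, ∫⁻ z, ‖(Γ.kern y z : ℂ)‖ₑ ∂logMeasure ≤ C) ∧
    ∀ z, ∫⁻ y, ‖(Γ.kern y z : ℂ)‖ₑ ∂logMeasure ≤ C := by
  obtain ⟨C, hC, hb⟩ := Γ.exists_kern_bound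
  have hm : ∀ s, Measurable fun u : ℝ => ENNReal.ofReal (C * Γ.α ^ (1 / 2 * |s - u|)) := fun s =>
    ((Γ.measurable_rpow_abs _ s).const_mul C).ennreal_ofReal
  set I := ∫⁻ u : ℝ, ENNReal.ofReal (C * Γ.α ^ (1 / 2 * |u|)) with hI
  have hIfin : I ≠ ⊤ := by
    have := (integrable_rpow_abs Γ.α_pos Γ.α_lt_one (c := 1 / 2) (by norm_num)).const_mul C
    exact this.lintegral_lt_top.ne
  have hconst : ∀ s, ∫⁻ z : ℝ × Bool, ENNReal.ofReal (C * Γ.α ^ (1 / 2 * |s - z.1|)) ∂logMeasure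
      = 2 * I := fun s => by
    rw [lintegral_logMeasure_fst (hm s), hI]
    congr 1
    exact lintegral_sub_left_eq_self (fun u => ENNReal.ofReal (C * Γ.α ^ (1 / 2 * |u|))) s
  have hle : ∀ y z, ‖(Γ.kern y z : ℂ)‖ₑ ≤ ENNReal.ofReal (C * Γ.α ^ (1 / 2 * |y.1 - z.1|)) := by
    intro y z
    rw [← ofReal_norm, Complex.norm_real, Real.norm_eq_abs]
    refine ENNReal.ofReal_le_ofReal ((hb y z).trans_eq ?_)
    congr 2; ring
  refine ⟨(2 * I).toNNReal, fun y => ?_, fun z => ?_⟩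
  · rw [ENNReal.coe_toNNReal (ENNReal.mul_ne_top (by norm_num) hIfin), ← hconst y.1]
    exact lintegral_mono (hle y)
  · rw [ENNReal.coe_toNNReal (ENNReal.mul_ne_top (by norm_num) hIfin), ← hconst z.1]
    refine lintegral_mono fun y => (hle y z).trans_eq ?_
    rw [abs_sub_comm]

/-- The double-layer operator in logarithmic coordinates. -/
def logOperator : LogL2 →L[ℂ] LogL2 :=
  (exists_integralOperator Γ.measurable_kern Γ.exists_lintegral_kern_le.choose_spec.1
    Γ.exists_lintegral_kern_le.choose_spec.2 Γ.integrable_kern_mul).choose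

theorem coeFn_logOperator (φ : LogL2) : Γ.logOperator φ =ᵐ[logMeasure]
    fun y => ∫ z, (Γ.kern y z : ℂ) * φ z ∂logMeasure :=
  (exists_integralOperator Γ.measurable_kern Γ.exists_lintegral_kern_le.choose_spec.1
    Γ.exists_lintegral_kern_le.choose_spec.2 Γ.integrable_kern_mul).choose_spec φ

theorem logOperator_shift (j : ℤ) (φ : LogL2) :
    Γ.logOperator (shift j φ) = shift j (Γ.logOperator φ) := by
  refine Lp.ext ?_
  filter_upwards [Γ.coeFn_logOperator (shift j φ), coeFn_shift j (Γ.logOperator φ),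
    ae_translate (-j) (Γ.coeFn_logOperator φ)] with y h1 h2 h3
  rw [h1, h2, h3, ← (measurePreserving_translate (-j)).integral_comp
    (measurableEmbedding_translate (-j)) (fun z => (Γ.kern (translate (-j) y) z : ℂ) * φ z)]
  refine integral_congr_ae ?_
  filter_upwards [coeFn_shift j φ] with z hz
  have := Γ.kern_translate (-j) y z
  push_cast at this
  rw [hz, this]

end AnalyticDilationGraph

/-! ### The midpoint rule -/

/-- Uniform continuity on `[0,1]` suffices. The vector-valued form matters: with values in
continuous functions it gives uniform convergence of the Nyström approximations. -/
theorem tendsto_midpoint_sum {F : Type*} [NormedAddCommGroup F] [NormedSpace ℝ F] [CompleteSpace F]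
    {G : ℝ → F} (hG : Continuous G) :
    Tendsto (fun N : ℕ => (1 / (N : ℝ)) • ∑ q : Fin N, G (midpointNode N q)) atTop
      (𝓝 (∫ r in (0 : ℝ)..1, G r)) := by
  rw [Metric.tendsto_atTop]
  intro ε hε
  have huc : UniformContinuousOn G (Icc 0 1) :=
    isCompact_Icc.uniformContinuousOn_of_continuous hG.continuousOn
  obtain ⟨δ, hδ, hδG⟩ := Metric.uniformContinuousOn_iff.1 huc (ε / 2) (by positivity)
  obtain ⟨N₀, hN₀⟩ := exists_nat_gt (1 / δ)
  refine ⟨max N₀ 1, fun N hN => ?_⟩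
  have hN1 : 0 < (N : ℝ) := by exact_mod_cast (le_max_right _ _).trans hN
  have hNδ : 1 / (N : ℝ) < δ := by
    rw [div_lt_comm₀ hN1 hδ]
    exact hN₀.trans_le (by exact_mod_cast (le_max_left _ _).trans hN)
  have hsplit : ∫ r in (0 : ℝ)..1, G r
      = ∑ q : Fin N, ∫ r in ((q : ℕ) / (N : ℝ))..(((q : ℕ) + 1 : ℕ) / (N : ℝ)), G r := by
    have := intervalIntegral.sum_integral_adjacent_intervals (μ := volume) (f := G) (n := N)
      (a := fun k => (k : ℝ) / N) fun k _ => hG.intervalIntegrable _ _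
    rw [Fin.sum_univ_eq_sum_range (fun q => ∫ r in ((q : ℕ) / (N : ℝ))..((q + 1 : ℕ) / (N : ℝ)), G r),
      this]
    simp [div_self hN1.ne']
  rw [hsplit, Finset.smul_sum, dist_eq_norm, ← Finset.sum_sub_distrib]
  have hterm : ∀ q : Fin N, ‖(1 / (N : ℝ)) • G (midpointNode N q)
      - ∫ r in ((q : ℕ) / (N : ℝ))..(((q : ℕ) + 1 : ℕ) / (N : ℝ)), G r‖ ≤ ε / 2 * (1 / N) := by
    intro q
    have hlen : ((q : ℕ) + 1 : ℕ) / (N : ℝ) - (q : ℕ) / (N : ℝ) = 1 / N := by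
      push_cast; ring
    have hle : (q : ℕ) / (N : ℝ) ≤ ((q : ℕ) + 1 : ℕ) / (N : ℝ) := by
      have : 0 < 1 / (N : ℝ) := by positivity
      linarith
    have hc : (1 / (N : ℝ)) • G (midpointNode N q)
        = ∫ _ in ((q : ℕ) / (N : ℝ))..(((q : ℕ) + 1 : ℕ) / (N : ℝ)), G (midpointNode N q) := by
      rw [intervalIntegral.integral_const, hlen]
    rw [hc, ← intervalIntegral.integral_sub (by simp) (hG.intervalIntegrable _ _)]
    refine (intervalIntegral.norm_integral_le_of_norm_le_const (C := ε / 2) fun r hr => ?_).trans_eq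
      ?_
    · rw [uIoc_of_le hle] at hr
      have hm := midpointNode_mem N q
      have hq1 : ((q : ℕ) + 1 : ℕ) / (N : ℝ) ≤ 1 := by
        rw [div_le_one hN1]; exact_mod_cast q.2
      have hq0 : 0 ≤ (q : ℕ) / (N : ℝ) := by positivity
      have hr01 : r ∈ Icc (0 : ℝ) 1 := ⟨hq0.trans hr.1.le, hr.2.trans hq1⟩
      have hmid : midpointNode N q = (q : ℕ) / (N : ℝ) + 1 / N / 2 := by
        rw [midpointNode]; field_simp
      have hd : dist (midpointNode N q) r < δ := by
        rw [Real.dist_eq, abs_lt]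
        constructor <;> linarith [hr.1, hr.2]
      have := hδG _ hm _ hr01 hd
      rw [dist_eq_norm] at this
      exact this.le
    · rw [hlen, abs_of_pos (by positivity)]
  refine (norm_sum_le _ _).trans_lt ((Finset.sum_le_sum fun q _ => hterm q).trans_lt ?_)
  rw [Finset.sum_const, Finset.card_univ, Fintype.card_fin, nsmul_eq_mul]
  have : (N : ℝ) * (ε / 2 * (1 / N)) = ε / 2 := by field_simp
  rw [this]
  linarith

namespace AnalyticDilationGraph

/-! ### Functions on the closed fundamental domain -/

/-- The closed fundamental domain. -/
abbrev CellSpace : Type := unitInterval × Bool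

/-- Inclusion of the closed fundamental domain. -/
def cellIncl (z : CellSpace) : ℝ × Bool := (z.1, z.2)

/-- A retraction onto the closed fundamental domain. -/
def cellRetract (y : ℝ × Bool) : CellSpace := (projIcc 0 1 zero_le_one y.1, y.2)

theorem continuous_cellIncl : Continuous cellIncl := by unfold cellIncl; fun_prop

theorem continuous_cellRetract : Continuous cellRetract :=
  (continuous_projIcc.comp continuous_fst).prodMk continuous_snd

theorem cellIncl_cellRetract {y : ℝ × Bool} (hy : y ∈ cell) : cellIncl (cellRetract y) = y := by
  have h : y.1 ∈ Icc (0 : ℝ) 1 := Ico_subset_Icc_self hy.1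
  simp [cellIncl, cellRetract, projIcc_of_mem zero_le_one h]

theorem cellRetract_cellIncl (z : CellSpace) : cellRetract (cellIncl z) = z := by
  simp [cellIncl, cellRetract]

instance : IsFiniteMeasure (logMeasure.restrict cell) :=
  ⟨by rw [Measure.restrict_apply_univ, logMeasure_cell]; norm_num⟩

theorem memLp_extend (φ : C(CellSpace, ℂ)) :
    MemLp (cell.indicator fun y => φ (cellRetract y)) 2 logMeasure := by
  rw [memLp_indicator_iff_restrict measurableSet_cell]
  exact MemLp.of_bound (φ.continuous.comp continuous_cellRetract).aestronglyMeasurable ‖φ‖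
    (Eventually.of_forall fun y => φ.norm_coe_le_norm _)

/-- Extension by zero of a function on the closed fundamental domain. -/
def cellExtend : C(CellSpace, ℂ) →L[ℂ] LogL2 :=
  LinearMap.mkContinuous
    { toFun := fun φ => (memLp_extend φ).toLp
      map_add' := fun φ ψ => by
        rw [← MemLp.toLp_add]
        refine MemLp.toLp_congr _ _ (Eventually.of_forall fun y => ?_)
        by_cases h : y ∈ cell <;> simp [h]
      map_smul' := fun a φ => by
        rw [RingHom.id_apply, ← MemLp.toLp_const_smul]
        refine MemLp.toLp_congr _ _ (Eventually.of_forall fun y => ?_)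
        by_cases h : y ∈ cell <;> simp [h] }
    ((2 : ENNReal) ^ (2 : ENNReal).toReal⁻¹).toReal fun φ => by
    change ‖(memLp_extend φ).toLp‖ ≤ _
    rw [Lp.norm_toLp, eLpNorm_indicator_eq_eLpNorm_restrict measurableSet_cell]
    have h := eLpNorm_le_of_ae_bound (p := 2) (μ := logMeasure.restrict cell)
      (f := fun y => φ (cellRetract y)) (C := ‖φ‖) (Eventually.of_forall fun y =>
        φ.norm_coe_le_norm _)
    rw [Measure.restrict_apply_univ, logMeasure_cell] at h
    have h2 := ENNReal.toReal_mono (ENNReal.mul_ne_top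
      (ENNReal.rpow_ne_top_of_nonneg (by simp) (by norm_num)) ENNReal.ofReal_ne_top) h
    rwa [ENNReal.toReal_mul, ENNReal.toReal_ofReal (norm_nonneg _)] at h2

theorem coeFn_cellExtend (φ : C(CellSpace, ℂ)) :
    cellExtend φ =ᵐ[logMeasure] cell.indicator fun y => φ (cellRetract y) :=
  (memLp_extend φ).coeFn_toLp

theorem cellProj_cellExtend (φ : C(CellSpace, ℂ)) : cellProj (cellExtend φ) = cellExtend φ := by
  refine Lp.ext ?_
  filter_upwards [coeFn_cellProj (cellExtend φ), coeFn_cellExtend φ] with y h1 h2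
  rw [h1]
  by_cases h : y ∈ cell
  · rw [indicator_of_mem h]
  · rw [indicator_of_notMem h, h2, indicator_of_notMem h]

/-- A continuous function vanishing almost everywhere on `(0,1)` vanishes on `[0,1]`, the endpoint
missing from the half-open cell included. Hence continuous eigenfunctions stay nonzero in `L²`. -/
theorem cellExtend_injective : Function.Injective cellExtend := by
  rw [injective_iff_map_eq_zero]
  intro φ hφ
  have h1 : ∀ᵐ y ∂logMeasure, y ∈ cell → φ (cellRetract y) = 0 := by
    have h2 := coeFn_cellExtend φ
    rw [hφ] at h2
    filter_upwards [h2, Lp.coeFn_zero ℂ 2 logMeasure] with y h3 h4 hy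
    rwa [h4, Pi.zero_apply, indicator_of_mem hy, eq_comm] at h3
  have hoo : ∀ b : Bool, EqOn (fun r : ℝ => φ (cellRetract (r, b))) 0 (Ioo 0 1) := by
    intro b
    have hb : ∀ᵐ r : ℝ, r ∈ Ico (0 : ℝ) 1 → φ (cellRetract (r, b)) = 0 := by
      have h5 := Measure.ae_ae_of_ae_prod h1
      filter_upwards [h5] with r hr hr1
      have h6 : ∀ b : Bool, (r, b) ∈ cell → φ (cellRetract (r, b)) = 0 := by
        rw [ae_iff, Measure.count_eq_zero_iff] at hr
        intro b hb
        by_contra hne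
        have : b ∈ ({b : Bool | ¬ ((r, b) ∈ cell → φ (cellRetract (r, b)) = 0)} : Set Bool) :=
          fun h => hne (h hb)
        rw [hr] at this
        exact this
      exact h6 b ⟨hr1, trivial⟩
    have hb' : (fun r : ℝ => φ (cellRetract (r, b))) =ᵐ[volume.restrict (Ioo 0 1)] 0 := by
      rw [Filter.EventuallyEq, ae_restrict_iff' measurableSet_Ioo]
      filter_upwards [hb] with r hr hr1
      exact hr (Ioo_subset_Ico_self hr1)
    exact Measure.eqOn_open_of_ae_eq hb' isOpen_Ioo
      (φ.continuous.comp (continuous_cellRetract.comp (by fun_prop))).continuousOn continuousOn_const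
  have hcc : ∀ b : Bool, EqOn (fun r : ℝ => φ (cellRetract (r, b))) 0 (Icc 0 1) := fun b => by
    have := (hoo b).closure (φ.continuous.comp (continuous_cellRetract.comp (by fun_prop)))
      continuous_const
    rwa [closure_Ioo zero_ne_one] at this
  ext z
  have := hcc z.2 z.1.2
  simpa [show ((z.1 : ℝ), z.2) = cellIncl z from rfl, cellRetract_cellIncl] using this

theorem integrableOn_cell (φ : LogL2) : IntegrableOn φ cell logMeasure :=
  ((Lp.memLp φ).restrict cell).integrable (by norm_num)

theorem exists_integral_cell_le : ∃ C : ℝ, 0 ≤ C ∧ ∀ φ : LogL2,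
    ∫ y in cell, ‖φ y‖ ∂logMeasure ≤ C * ‖φ‖ := by
  refine ⟨((2 : ENNReal) ^ (1 / (1 : ENNReal).toReal - 1 / (2 : ENNReal).toReal)).toReal,
    ENNReal.toReal_nonneg, fun φ => ?_⟩
  have h := eLpNorm_le_eLpNorm_mul_rpow_measure_univ (p := 1) (q := 2) (by norm_num)
    (Lp.aestronglyMeasurable φ).restrict (μ := logMeasure.restrict cell)
  rw [Measure.restrict_apply_univ, logMeasure_cell] at h
  have h1 := h.trans (mul_le_mul_left (eLpNorm_mono_measure φ Measure.restrict_le_self) _)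
  have h2 := ENNReal.toReal_mono (ENNReal.mul_ne_top (Lp.eLpNorm_ne_top φ)
    (ENNReal.rpow_ne_top_of_nonneg (by norm_num) (by norm_num))) h1
  rw [ENNReal.toReal_mul, ← Lp.norm_def, eLpNorm_one_eq_lintegral_enorm,
    ← integral_norm_eq_lintegral_enorm (Lp.aestronglyMeasurable φ).restrict] at h2
  rwa [mul_comm]

end AnalyticDilationGraph

namespace AnalyticDilationGraph

variable (Γ : AnalyticDilationGraph)

/-! ### The blocks of the kernel -/

/-- Geometric decay with ratio `α ^ (1/2)`, hence summability with the weight `|j|` as well. The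
extra factor `ρ⁻¹` arises because points of the cell and of its `j`-th translate are at distance at
least `|j| - 1` only. -/
theorem exists_blockBound : ∃ b : ℤ → ℝ, (∀ j, 0 ≤ b j) ∧ (Summable b) ∧
    (Summable fun j : ℤ => |(j : ℝ)| * b j) ∧
    ∀ (j : ℤ) (y w : ℝ × Bool), y.1 ∈ Icc (0 : ℝ) 1 → w.1 ∈ Icc (0 : ℝ) 1 →
      |Γ.kern (translate j y) w| ≤ b j := by
  obtain ⟨C, hC, hb⟩ := Γ.exists_kern_bound
  set ρ := Γ.α ^ (1 / 2 : ℝ) with hρ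
  have hρ0 : 0 < ρ := Γ.rpow_pos _
  have hρ1 : ρ < 1 := Real.rpow_lt_one Γ.α_pos.le Γ.α_lt_one (by norm_num)
  have hρn : ‖ρ‖ < 1 := by rwa [Real.norm_eq_abs, abs_of_pos hρ0]
  refine ⟨fun j => C * ρ⁻¹ * ρ ^ j.natAbs, fun j => by positivity, ?_, ?_, ?_⟩
  · refine Summable.mul_left _ (Summable.of_nat_of_neg ?_ ?_)
    · simpa using summable_geometric_of_lt_one hρ0.le hρ1
    · simpa using summable_geometric_of_lt_one hρ0.le hρ1
  · have h1 : Summable fun n : ℕ => (n : ℝ) * ρ ^ n := by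
      simpa using summable_pow_mul_geometric_of_norm_lt_one 1 hρn
    have h2 : Summable fun j : ℤ => |(j : ℝ)| * ρ ^ j.natAbs :=
      Summable.of_nat_of_neg (by simpa using h1) (by simpa using h1)
    exact (h2.mul_left (C * ρ⁻¹)).congr fun j => by ring
  · intro j y w hy hw
    refine (hb _ _).trans ?_
    simp only [mul_assoc]
    refine mul_le_mul_of_nonneg_left ?_ hC
    have h1 : ρ⁻¹ * ρ ^ j.natAbs = Γ.α ^ ((|(j : ℝ)| - 1) / 2) := by
      have : (j.natAbs : ℝ) = |(j : ℝ)| := by rw [Nat.cast_natAbs]; simp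
      rw [hρ, ← Real.rpow_neg Γ.α_pos.le, ← Real.rpow_natCast, ← Real.rpow_mul Γ.α_pos.le,
        ← Real.rpow_add Γ.α_pos, this]
      congr 1; ring
    rw [h1]
    refine Real.rpow_le_rpow_of_exponent_ge Γ.α_pos Γ.α_lt_one.le ?_
    have h2 : |(j : ℝ)| ≤ |(translate j y).1 - w.1| + |w.1 - y.1| := by
      have := abs_add_le ((translate j y).1 - w.1) (w.1 - y.1)
      rwa [show (translate (j : ℝ) y).1 - w.1 + (w.1 - y.1) = j by simp [translate]] at this
    have h3 : |w.1 - y.1| ≤ 1 := abs_le.2 ⟨by linarith [hy.2, hw.1], by linarith [hy.1, hw.2]⟩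
    linarith

/-- A summable bound for the blocks of the kernel. -/
def blockBound : ℤ → ℝ := Γ.exists_blockBound.choose

theorem blockBound_nonneg (j : ℤ) : 0 ≤ Γ.blockBound j := Γ.exists_blockBound.choose_spec.1 j

theorem summable_blockBound : Summable Γ.blockBound := Γ.exists_blockBound.choose_spec.2.1

theorem summable_abs_mul_blockBound : Summable fun j : ℤ => |(j : ℝ)| * Γ.blockBound j :=
  Γ.exists_blockBound.choose_spec.2.2.1

theorem norm_kern_translate_le (j : ℤ) {y w : ℝ × Bool} (hy : y.1 ∈ Icc (0 : ℝ) 1)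
    (hw : w.1 ∈ Icc (0 : ℝ) 1) : ‖(Γ.kern (translate j y) w : ℂ)‖ ≤ Γ.blockBound j := by
  rw [Complex.norm_real]
  exact Γ.exists_blockBound.choose_spec.2.2.2 j y w hy hw

theorem continuous_kern_translate (j : ℤ) :
    Continuous fun p : (ℝ × Bool) × (ℝ × Bool) => (Γ.kern (translate j p.1) p.2 : ℂ) := by
  have h1 : Continuous fun p : (ℝ × Bool) × (ℝ × Bool) => (translate (j : ℝ) p.1, p.2) :=
    ((continuous_translate j).comp continuous_fst).prodMk continuous_snd
  have h2 := Γ.continuous_kern.comp h1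
  exact Complex.continuous_ofReal.comp h2

/-- A column of a block, as a function on the closed fundamental domain. -/
def blockColumn (j : ℤ) (w : ℝ × Bool) : C(CellSpace, ℂ) :=
  ⟨fun z => (Γ.kern (translate j (cellIncl z)) w : ℂ), by
    have h1 : Continuous fun z : CellSpace => (cellIncl z, w) :=
      continuous_cellIncl.prodMk continuous_const
    exact (Γ.continuous_kern_translate j).comp h1⟩

theorem blockColumn_apply (j : ℤ) (w : ℝ × Bool) (z : CellSpace) :
    Γ.blockColumn j w z = (Γ.kern (translate j (cellIncl z)) w : ℂ) := rfl

theorem cellIncl_mem (z : CellSpace) : (cellIncl z).1 ∈ Icc (0 : ℝ) 1 := z.1.2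

theorem norm_blockColumn_le (j : ℤ) {w : ℝ × Bool} (hw : w.1 ∈ Icc (0 : ℝ) 1) :
    ‖Γ.blockColumn j w‖ ≤ Γ.blockBound j :=
  (ContinuousMap.norm_le _ (Γ.blockBound_nonneg j)).2 fun z =>
    Γ.norm_kern_translate_le j (cellIncl_mem z) hw

theorem continuous_blockColumn (j : ℤ) : Continuous (Γ.blockColumn j) := by
  have h1 : Continuous fun p : (ℝ × Bool) × CellSpace => (cellIncl p.2, p.1) :=
    (continuous_cellIncl.comp continuous_snd).prodMk continuous_fst
  have h2 := (Γ.continuous_kern_translate j).comp h1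
  exact ContinuousMap.continuous_of_continuous_uncurry _ h2

/-- The integral over the fundamental domain against a block of the kernel. -/
theorem continuous_block_integral (j : ℤ) (φ : LogL2) : Continuous fun z : CellSpace =>
    ∫ w in cell, (Γ.kern (translate j (cellIncl z)) w : ℂ) * φ w ∂logMeasure := by
  refine continuous_of_dominated (bound := fun w => Γ.blockBound j * ‖φ w‖) (fun z => ?_)
    (fun z => ?_) ((integrableOn_cell φ).norm.const_mul _) (Eventually.of_forall fun w => ?_)
  · exact (Γ.measurable_kern_right _).aestronglyMeasurable.mul
      (Lp.aestronglyMeasurable φ).restrict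
  · filter_upwards [ae_restrict_mem measurableSet_cell] with w hw
    rw [norm_mul]
    exact mul_le_mul_of_nonneg_right (Γ.norm_kern_translate_le j (cellIncl_mem z)
      (Ico_subset_Icc_self hw.1)) (norm_nonneg _)
  · exact (Γ.blockColumn j w).continuous.mul continuous_const

theorem integrableOn_block_mul (j : ℤ) (φ : LogL2) (z : CellSpace) :
    IntegrableOn (fun w => (Γ.kern (translate j (cellIncl z)) w : ℂ) * φ w) cell logMeasure :=
  (Γ.integrable_kern_mul φ _).integrableOn

theorem norm_block_integral_le (j : ℤ) (φ : LogL2) (z : CellSpace) :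
    ‖∫ w in cell, (Γ.kern (translate j (cellIncl z)) w : ℂ) * φ w ∂logMeasure‖
      ≤ Γ.blockBound j * ∫ w in cell, ‖φ w‖ ∂logMeasure := by
  rw [← integral_const_mul]
  refine norm_integral_le_of_norm_le ((integrableOn_cell φ).norm.const_mul _) ?_
  filter_upwards [ae_restrict_mem measurableSet_cell] with w hw
  rw [norm_mul]
  exact mul_le_mul_of_nonneg_right (Γ.norm_kern_translate_le j (cellIncl_mem z)
    (Ico_subset_Icc_self hw.1)) (norm_nonneg _)

/-- A block of the double-layer operator, with values in continuous functions. -/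
def block (j : ℤ) : LogL2 →L[ℂ] C(CellSpace, ℂ) :=
  LinearMap.mkContinuous
    { toFun := fun φ => ⟨_, Γ.continuous_block_integral j φ⟩
      map_add' := fun φ ψ => by
        ext z
        simp only [ContinuousMap.coe_mk, ContinuousMap.add_apply]
        rw [← integral_add (Γ.integrableOn_block_mul j φ z) (Γ.integrableOn_block_mul j ψ z)]
        refine integral_congr_ae (ae_restrict_of_ae ?_)
        filter_upwards [Lp.coeFn_add φ ψ] with w hw
        rw [hw, Pi.add_apply, mul_add]
      map_smul' := fun a φ => by
        ext z
        simp only [ContinuousMap.coe_mk, ContinuousMap.smul_apply, RingHom.id_apply, smul_eq_mul]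
        rw [← integral_const_mul]
        refine integral_congr_ae (ae_restrict_of_ae ?_)
        filter_upwards [Lp.coeFn_smul a φ] with w hw
        rw [hw, Pi.smul_apply, smul_eq_mul]; ring }
    (Γ.blockBound j * exists_integral_cell_le.choose) fun φ => by
    obtain ⟨h0, hC⟩ := exists_integral_cell_le.choose_spec
    refine (ContinuousMap.norm_le _ (by have := Γ.blockBound_nonneg j; positivity)).2 fun z => ?_
    refine (Γ.norm_block_integral_le j φ z).trans ?_
    rw [mul_assoc]
    exact mul_le_mul_of_nonneg_left (hC φ) (Γ.blockBound_nonneg j)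

theorem block_apply (j : ℤ) (φ : LogL2) (z : CellSpace) :
    Γ.block j φ z = ∫ w in cell, (Γ.kern (translate j (cellIncl z)) w : ℂ) * φ w ∂logMeasure := rfl

theorem norm_block_le (j : ℤ) : ‖Γ.block j‖ ≤ Γ.blockBound j * exists_integral_cell_le.choose :=
  LinearMap.mkContinuous_norm_le _ (mul_nonneg (Γ.blockBound_nonneg j)
    exists_integral_cell_le.choose_spec.1) _

theorem norm_block_apply_le (j : ℤ) (φ : LogL2) :
    ‖Γ.block j φ‖ ≤ Γ.blockBound j * ∫ w in cell, ‖φ w‖ ∂logMeasure :=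
  (ContinuousMap.norm_le _ (mul_nonneg (Γ.blockBound_nonneg j)
    (integral_nonneg fun _ => norm_nonneg _))).2 (Γ.norm_block_integral_le j φ)

attribute [irreducible] block blockBound

/-- Factoring each block through continuous functions allows the `L²` symbol to be compared with an
operator on continuous functions, where Nyström's method lives. -/
theorem shiftCoeff_eq (j : ℤ) :
    shiftCoeff shift cellProj Γ.logOperator j = cellExtend ∘L Γ.block j := by
  ext1 φ
  refine Lp.ext ?_
  have h0 : shiftCoeff shift cellProj Γ.logOperator j φ
      = cellProj (shift (-j) (Γ.logOperator (cellProj φ))) := rfl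
  rw [h0]
  filter_upwards [coeFn_cellProj_shift (-j) (Γ.logOperator (cellProj φ)),
    ae_translate j (Γ.coeFn_logOperator (cellProj φ)), coeFn_cellExtend (Γ.block j φ)]
    with y h1 h2 h3
  rw [h1, ContinuousLinearMap.comp_apply, h3]
  by_cases h : y ∈ cell
  · rw [indicator_of_mem h, indicator_of_mem h]
    push_cast
    rw [neg_neg, h2, block_apply, cellIncl_cellRetract h, ← integral_indicator measurableSet_cell]
    refine integral_congr_ae ?_
    filter_upwards [coeFn_cellProj φ] with w hw
    rw [hw]
    by_cases h' : w ∈ cell <;> simp [h']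
  · rw [indicator_of_notMem h, indicator_of_notMem h]

theorem summable_norm_block : Summable fun j => ‖Γ.block j‖ :=
  Summable.of_nonneg_of_le (fun j => norm_nonneg (Γ.block j)) Γ.norm_block_le
    (Γ.summable_blockBound.mul_right _)

theorem norm_shiftCoeff_le (j : ℤ) : ‖shiftCoeff shift cellProj Γ.logOperator j‖
    ≤ ‖cellExtend‖ * (Γ.blockBound j * exists_integral_cell_le.choose) := by
  rw [Γ.shiftCoeff_eq]
  exact (ContinuousLinearMap.opNorm_comp_le _ _).trans
    (mul_le_mul_of_nonneg_left (Γ.norm_block_le j) (norm_nonneg _))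

theorem summable_shiftCoeff :
    Summable fun j => ‖shiftCoeff shift cellProj Γ.logOperator j‖ :=
  Summable.of_nonneg_of_le (fun _ => norm_nonneg _) Γ.norm_shiftCoeff_le
    ((Γ.summable_blockBound.mul_right _).mul_left _)

theorem summable_abs_mul_shiftCoeff :
    Summable fun j : ℤ => |(j : ℝ)| * ‖shiftCoeff shift cellProj Γ.logOperator j‖ := by
  refine Summable.of_nonneg_of_le (fun j => by positivity)
    (fun j => mul_le_mul_of_nonneg_left (Γ.norm_shiftCoeff_le j) (abs_nonneg _)) ?_
  exact ((Γ.summable_abs_mul_blockBound.mul_right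
    (exists_integral_cell_le.choose)).mul_left ‖cellExtend‖).congr fun j => by ring

/-- The Fourier series of a sequence of operators. -/
def phaseSum {E F : Type*} [NormedAddCommGroup E] [NormedSpace ℂ E] [NormedAddCommGroup F]
    [NormedSpace ℂ F] (A : ℤ → E →L[ℂ] F) (t : ℝ) : E →L[ℂ] F := ∑' j, phase j t • A j

theorem hasSum_phaseSum {E F : Type*} [NormedAddCommGroup E] [NormedSpace ℂ E]
    [NormedAddCommGroup F] [NormedSpace ℂ F] [CompleteSpace F] {A : ℤ → E →L[ℂ] F}
    (hA : Summable fun j => ‖A j‖) (t : ℝ) :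
    HasSum (fun j => phase j t • A j) (phaseSum A t) :=
  (Summable.of_norm (hA.congr fun j => by rw [norm_smul, norm_phase, one_mul])).hasSum

theorem hasSum_phaseSum_apply {E F : Type*} [NormedAddCommGroup E] [NormedSpace ℂ E]
    [NormedAddCommGroup F] [NormedSpace ℂ F] [CompleteSpace F] {A : ℤ → E →L[ℂ] F}
    (hA : Summable fun j => ‖A j‖) (t : ℝ) (x : E) :
    HasSum (fun j => phase j t • A j x) (phaseSum A t x) :=
  (hasSum_phaseSum hA t).mapL (ContinuousLinearMap.apply ℂ F x)

theorem hasSum_comp_phaseSum {E F G : Type*} [NormedAddCommGroup E] [NormedSpace ℂ E]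
    [NormedAddCommGroup F] [NormedSpace ℂ F] [CompleteSpace F] [NormedAddCommGroup G]
    [NormedSpace ℂ G] {A : ℤ → E →L[ℂ] F} (hA : Summable fun j => ‖A j‖) (t : ℝ)
    (J : F →L[ℂ] G) : HasSum (fun j => phase j t • (J ∘L A j)) (J ∘L phaseSum A t) := by
  refine hasSum_of_eq (fun j => ?_)
    ((hasSum_phaseSum hA t).mapL (ContinuousLinearMap.compL ℂ E F G J))
  rw [map_smul]; rfl

/-- The Bloch operator with values in continuous functions. -/
def blochMap (t : ℝ) : LogL2 →L[ℂ] C(CellSpace, ℂ) := phaseSum Γ.block t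

/-- The Bloch operator on continuous functions. -/
def blochOp (t : ℝ) : C(CellSpace, ℂ) →L[ℂ] C(CellSpace, ℂ) := Γ.blochMap t ∘L cellExtend

theorem shiftSymbol_eq (t : ℝ) :
    shiftSymbol shift cellProj Γ.logOperator t = cellExtend ∘L Γ.blochMap t := by
  refine HasSum.tsum_eq ?_
  refine hasSum_of_eq (fun j => ?_) (hasSum_comp_phaseSum Γ.summable_norm_block t cellExtend)
  rw [Γ.shiftCoeff_eq]

theorem hasSum_blochOp_apply (t : ℝ) (φ : C(CellSpace, ℂ)) :
    HasSum (fun j => phase j t • Γ.block j (cellExtend φ)) (Γ.blochOp t φ) :=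
  hasSum_phaseSum_apply Γ.summable_norm_block t (cellExtend φ)

/-! ### Nyström operators on the closed fundamental domain -/

/-- The Nyström operator of a block. -/
def nystromBlock (j : ℤ) (N : ℕ) : C(CellSpace, ℂ) →L[ℂ] C(CellSpace, ℂ) :=
  (1 / (N : ℂ)) • ∑ q : Fin N, ∑ b : Bool,
    (ContinuousMap.evalCLM ℂ ((⟨midpointNode N q, midpointNode_mem N q⟩, b) : CellSpace)).smulRight
      (Γ.blockColumn j (midpointNode N q, b))

theorem nystromBlock_apply (j : ℤ) (N : ℕ) (φ : C(CellSpace, ℂ)) :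
    Γ.nystromBlock j N φ = (1 / (N : ℂ)) • ∑ q : Fin N, ∑ b : Bool,
      φ (⟨midpointNode N q, midpointNode_mem N q⟩, b) • Γ.blockColumn j (midpointNode N q, b) := by
  simp [nystromBlock]

/-- The truncated Nyström operator. -/
def nystromSum (t : ℝ) (M N : ℕ) : C(CellSpace, ℂ) →L[ℂ] C(CellSpace, ℂ) :=
  ∑ j ∈ Finset.Icc (-(M : ℤ)) (M : ℤ), phase j t • Γ.nystromBlock j N

/-- Expressed as a vector-valued integral of kernel columns, the block becomes accessible to the
vector-valued midpoint rule. -/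
theorem block_cellExtend (j : ℤ) (φ : C(CellSpace, ℂ)) :
    Γ.block j (cellExtend φ) = ∑ b : Bool, ∫ r in (0 : ℝ)..1,
      φ (cellRetract (r, b)) • Γ.blockColumn j (r, b) := by
  have hG : ∀ b : Bool, Continuous fun r : ℝ =>
      φ (cellRetract (r, b)) • Γ.blockColumn j (r, b) := fun b =>
    (φ.continuous.comp (continuous_cellRetract.comp (by fun_prop))).smul
      ((Γ.continuous_blockColumn j).comp (by fun_prop))
  ext z
  have h1 : ∀ b : Bool, (∫ r in (0 : ℝ)..1, φ (cellRetract (r, b)) • Γ.blockColumn j (r, b)) z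
      = ∫ r in (0 : ℝ)..1, φ (cellRetract (r, b)) * Γ.blockColumn j (r, b) z := fun b =>
    ((ContinuousMap.evalCLM ℂ z).intervalIntegral_comp_comm
      ((hG b).intervalIntegrable 0 1)).symm
  rw [ContinuousMap.sum_apply]
  simp only [h1]
  rw [block_apply]
  have h2 : ∫ w in cell, (Γ.kern (translate j (cellIncl z)) w : ℂ) * cellExtend φ w ∂logMeasure
      = ∫ w in cell, φ (cellRetract w) * Γ.blockColumn j w z ∂logMeasure := by
    refine setIntegral_congr_ae measurableSet_cell ?_
    filter_upwards [coeFn_cellExtend φ] with w hw hwc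
    rw [hw, indicator_of_mem hwc, mul_comm]; rfl
  have hcont : Continuous fun w : ℝ × Bool => φ (cellRetract w) * Γ.blockColumn j w z := by
    refine (φ.continuous.comp continuous_cellRetract).mul ?_
    have := Γ.continuous_blockColumn j
    exact (ContinuousMap.evalCLM ℂ z).continuous.comp this
  have hint : IntegrableOn (fun w : ℝ × Bool => φ (cellRetract w) * Γ.blockColumn j w z) cell
      logMeasure := by
    refine (integrable_const (‖φ‖ * Γ.blockBound j)).mono' hcont.aestronglyMeasurable ?_
    filter_upwards [ae_restrict_mem measurableSet_cell] with w hw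
    rw [norm_mul]
    exact mul_le_mul (φ.norm_coe_le_norm _) (Γ.norm_kern_translate_le j (cellIncl_mem z)
      (Ico_subset_Icc_self hw.1)) (norm_nonneg _) (norm_nonneg _)
  rw [h2]
  rw [IntegrableOn] at hint
  have hrest : logMeasure.restrict cell
      = (volume.restrict (Ico (0 : ℝ) 1)).prod (Measure.count : Measure Bool) := by
    rw [logMeasure, cell, ← Measure.prod_restrict, Measure.restrict_univ]
  rw [hrest] at hint ⊢
  rw [integral_prod _ hint]
  simp only [integral_count]
  rw [integral_finsetSum]
  · refine Finset.sum_congr rfl fun b _ => ?_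
    rw [intervalIntegral.integral_of_le zero_le_one, integral_Ico_eq_integral_Ioc]
  · intro b _
    have hc : Continuous fun r : ℝ => φ (cellRetract (r, b)) * Γ.blockColumn j (r, b) z :=
      hcont.comp (by fun_prop)
    exact (hc.integrableOn_Icc (a := 0) (b := 1)).mono_set Ico_subset_Icc_self

theorem tendsto_nystromBlock (j : ℤ) (φ : C(CellSpace, ℂ)) :
    Tendsto (fun N => Γ.nystromBlock j N φ) atTop (𝓝 (Γ.block j (cellExtend φ))) := by
  rw [Γ.block_cellExtend]
  have hG : ∀ b : Bool, Continuous fun r : ℝ =>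
      φ (cellRetract (r, b)) • Γ.blockColumn j (r, b) := fun b =>
    (φ.continuous.comp (continuous_cellRetract.comp (by fun_prop))).smul
      ((Γ.continuous_blockColumn j).comp (by fun_prop))
  refine (tendsto_finsetSum Finset.univ fun b _ => tendsto_midpoint_sum (hG b)).congr fun N => ?_
  rw [nystromBlock_apply, ← Finset.smul_sum, Finset.sum_comm]
  have : ((1 / (N : ℝ) : ℝ) : ℂ) = 1 / (N : ℂ) := by push_cast; rfl
  rw [← this]
  ext z
  simp only [ContinuousMap.smul_apply, Complex.real_smul, smul_eq_mul]
  congr 2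
  refine Finset.sum_congr rfl fun q _ => Finset.sum_congr rfl fun b _ => ?_
  congr 2
  simp [cellRetract, projIcc_of_mem zero_le_one (midpointNode_mem N q)]

theorem norm_nystromBlock_apply_le (j : ℤ) (N : ℕ) (φ : C(CellSpace, ℂ)) :
    ‖Γ.nystromBlock j N φ‖ ≤ 2 * Γ.blockBound j * ‖φ‖ := by
  have hb := Γ.blockBound_nonneg j
  rw [nystromBlock_apply, norm_smul, norm_div, norm_one, Complex.norm_natCast]
  have h : ‖∑ q : Fin N, ∑ b : Bool, φ (⟨midpointNode N q, midpointNode_mem N q⟩, b) •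
      Γ.blockColumn j (midpointNode N q, b)‖ ≤ N * (2 * (‖φ‖ * Γ.blockBound j)) := by
    have h1 : ∀ (q : Fin N) (b : Bool), ‖φ (⟨midpointNode N q, midpointNode_mem N q⟩, b) •
        Γ.blockColumn j (midpointNode N q, b)‖ ≤ ‖φ‖ * Γ.blockBound j := fun q b => by
      rw [norm_smul]
      exact mul_le_mul (φ.norm_coe_le_norm _)
        (Γ.norm_blockColumn_le j (midpointNode_mem N q)) (norm_nonneg _) (norm_nonneg _)
    have h2 := norm_sum_le_of_le Finset.univ fun (q : Fin N) _ =>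
      norm_sum_le_of_le Finset.univ fun (b : Bool) _ => h1 q b
    refine h2.trans_eq ?_
    rw [Finset.sum_const, Finset.sum_const, Finset.card_univ, Finset.card_univ, Fintype.card_fin,
      Fintype.card_bool, nsmul_eq_mul, nsmul_eq_mul]
    norm_num
  rcases Nat.eq_zero_or_pos N with rfl | hN
  · simp; positivity
  · have hN' : (0 : ℝ) < N := by exact_mod_cast hN
    rw [one_div, inv_mul_le_iff₀ hN']
    linarith

end AnalyticDilationGraph

/-! ### Hulls of continuous families -/

section ComplexHull

variable {E X : Type*} [NormedAddCommGroup E] [NormedSpace ℂ E]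

/-- The closed convex hull of the multiples `c • g x` with `‖c‖ ≤ r`. -/
def complexHull (r : ℝ) (g : X → E) : Set E :=
  closedAbsConvexHull ℝ ((fun p : ℂ × X => p.1 • g p.2) '' (Metric.closedBall 0 r ×ˢ univ))

/-- Mazur's theorem. The hull is over the reals; complex multipliers are already in the compact
generating set. -/
theorem isCompact_complexHull [CompleteSpace E] [TopologicalSpace X] [CompactSpace X] (r : ℝ) {g : X → E}
    (hg : Continuous g) : IsCompact (complexHull r g) := by
  refine isCompact_closedAbsConvexHull_of_totallyBounded ?_
  refine (((isCompact_closedBall (0 : ℂ) r).prod isCompact_univ).image ?_).totallyBounded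
  exact continuous_fst.smul (hg.comp continuous_snd)

theorem norm_le_of_mem_complexHull {r b : ℝ} (hr : 0 ≤ r) {g : X → E} (hb : ∀ x, ‖g x‖ ≤ b)
    {y : E} (hy : y ∈ complexHull r g) : ‖y‖ ≤ r * b := by
  have h : complexHull r g ⊆ Metric.closedBall 0 (r * b) := by
    refine closedAbsConvexHull_min ?_ ⟨balanced_closedBall_zero, convex_closedBall _ _⟩
      Metric.isClosed_closedBall
    rintro _ ⟨⟨c, z⟩, ⟨hc, -⟩, rfl⟩
    rw [mem_closedBall_zero_iff] at hc ⊢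
    rw [norm_smul]
    exact mul_le_mul hc (hb z) (norm_nonneg _) hr
  exact mem_closedBall_zero_iff.1 (h hy)

theorem smul_mem_complexHull {r : ℝ} (g : X → E) {c : ℂ} (hc : ‖c‖ ≤ r) (x : X) :
    c • g x ∈ complexHull r g :=
  subset_closedAbsConvexHull ⟨(c, x), ⟨mem_closedBall_zero_iff.2 hc, mem_univ x⟩, rfl⟩

/-- With `n` terms, the sum is the average of the vectors `(n c_i) • g (x i)`, each a generator
since `n ‖c_i‖ ≤ r`. The hull does not depend on `n`. -/
theorem sum_mem_complexHull {r : ℝ} (g : X → E) {ι : Type*} [Fintype ι] [Nonempty ι] {c : ι → ℂ}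
    (hc : ∀ i, ‖c i‖ ≤ r / Fintype.card ι) (x : ι → X) :
    ∑ i, c i • g (x i) ∈ complexHull r g := by
  have hn : (0 : ℝ) < Fintype.card ι := by exact_mod_cast Fintype.card_pos
  have h := (absConvex_convexClosedHull (𝕜 := ℝ)
    (s := ((fun p : ℂ × X => p.1 • g p.2) '' (Metric.closedBall 0 r ×ˢ univ)))).2.sum_mem
    (t := Finset.univ) (w := fun _ : ι => 1 / (Fintype.card ι : ℝ))
    (z := fun i => ((Fintype.card ι : ℂ) * c i) • g (x i)) (fun _ _ => by positivity)
    (by rw [Finset.sum_const, Finset.card_univ, nsmul_eq_mul]; field_simp)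
    (fun i _ => smul_mem_complexHull g (by
      rw [norm_mul, Complex.norm_natCast, ← le_div_iff₀' hn]; exact hc i) (x i))
  refine mem_of_eq_of_mem (Finset.sum_congr rfl fun i _ => ?_) h
  have hn' : (Fintype.card ι : ℂ) ≠ 0 := by exact_mod_cast hn.ne'
  rw [← Complex.coe_smul, smul_smul]
  congr 1
  push_cast
  field_simp

theorem zero_mem_complexHull [Nonempty X] {r : ℝ} (hr : 0 ≤ r) (g : X → E) :
    0 ∈ complexHull r g := by
  obtain ⟨x⟩ := ‹Nonempty X›
  have h := smul_mem_complexHull g (c := 0) (by simpa using hr) x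
  rwa [zero_smul] at h

end ComplexHull

namespace AnalyticDilationGraph

variable (Γ : AnalyticDilationGraph)

/-! ### Collectively compact convergence of the Nyström operators -/

/-- A compact convex set containing the values of the Nyström operators of a block. -/
def blockHull (j : ℤ) : Set C(CellSpace, ℂ) :=
  complexHull 2 fun z : CellSpace => Γ.blockColumn j (cellIncl z)

theorem isCompact_blockHull (j : ℤ) : IsCompact (Γ.blockHull j) :=
  isCompact_complexHull 2 ((Γ.continuous_blockColumn j).comp continuous_cellIncl)

theorem zero_mem_blockHull (j : ℤ) : 0 ∈ Γ.blockHull j := zero_mem_complexHull zero_le_two _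

theorem norm_le_of_mem_blockHull (j : ℤ) {ψ : C(CellSpace, ℂ)} (hψ : ψ ∈ Γ.blockHull j) :
    ‖ψ‖ ≤ 2 * Γ.blockBound j :=
  norm_le_of_mem_complexHull zero_le_two
    (fun z => Γ.norm_blockColumn_le j (cellIncl_mem z)) hψ

theorem phase_smul_nystromBlock_mem (j : ℤ) (t : ℝ) (N : ℕ) {φ : C(CellSpace, ℂ)}
    (hφ : ‖φ‖ ≤ 1) : phase j t • Γ.nystromBlock j N φ ∈ Γ.blockHull j := by
  rw [nystromBlock_apply]
  rcases Nat.eq_zero_or_pos N with rfl | hN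
  · simpa using Γ.zero_mem_blockHull j
  have : NeZero N := ⟨hN.ne'⟩
  have hN' : (0 : ℝ) < N := by positivity
  -- There are `2N` terms, `N` nodes on each of two branches, with coefficients at most `1 / N = 2 /
  -- (2N)`.
  have h := sum_mem_complexHull (r := 2) (ι := Fin N × Bool)
    (fun z : CellSpace => Γ.blockColumn j (cellIncl z))
    (c := fun p => phase j t * (1 / (N : ℂ)) *
      φ (⟨midpointNode N p.1, midpointNode_mem N p.1⟩, p.2)) (fun p => by
      have h := (φ.norm_coe_le_norm (⟨midpointNode N p.1, midpointNode_mem N p.1⟩, p.2)).trans hφ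
      rw [norm_mul, norm_mul, norm_phase, norm_div, norm_one, Complex.norm_natCast,
        Fintype.card_prod, Fintype.card_fin, Fintype.card_bool, one_mul]
      push_cast
      rw [mul_comm (N : ℝ), div_mul_eq_div_div, div_self two_ne_zero]
      exact mul_le_of_le_one_right (by positivity) h)
    (fun p => (⟨midpointNode N p.1, midpointNode_mem N p.1⟩, p.2))
  refine mem_of_eq_of_mem ?_ h
  rw [Fintype.sum_prod_type, Finset.smul_sum, Finset.smul_sum]
  refine Finset.sum_congr rfl fun q _ => ?_
  rw [Finset.smul_sum, Finset.smul_sum]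
  refine Finset.sum_congr rfl fun b _ => ?_
  rw [smul_smul, smul_smul]
  rfl

theorem nystromSum_apply (t : ℝ) (M N : ℕ) (φ : C(CellSpace, ℂ)) :
    Γ.nystromSum t M N φ
      = ∑ j ∈ Finset.Icc (-(M : ℤ)) (M : ℤ), phase j t • Γ.nystromBlock j N φ := by
  simp [nystromSum]

theorem nystromSum_apply_eq_tsum (t : ℝ) (M N : ℕ) (φ : C(CellSpace, ℂ)) :
    Γ.nystromSum t M N φ
      = ∑' j, if j ∈ Finset.Icc (-(M : ℤ)) (M : ℤ) then phase j t • Γ.nystromBlock j N φ else 0 := by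
  rw [nystromSum_apply, tsum_eq_sum (s := Finset.Icc (-(M : ℤ)) (M : ℤ))]
  · exact Finset.sum_congr rfl fun j hj => (if_pos hj).symm
  · exact fun j hj => if_neg hj

/-- Dominated convergence for series: for fixed `j` the truncation eventually includes `j`, the
phase converges and the midpoint rule converges; the block bound dominates. All parameters may thus
vary together. -/
theorem tendsto_nystromSum {t : ℕ → ℝ} {t₀ : ℝ} {M N : ℕ → ℕ} (ht : Tendsto t atTop (𝓝 t₀))
    (hM : Tendsto M atTop atTop) (hN : Tendsto N atTop atTop) (φ : C(CellSpace, ℂ)) :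
    Tendsto (fun n => Γ.nystromSum (t n) (M n) (N n) φ) atTop (𝓝 (Γ.blochOp t₀ φ)) := by
  rw [← (Γ.hasSum_blochOp_apply t₀ φ).tsum_eq]
  simp only [nystromSum_apply_eq_tsum]
  refine tendsto_tsum_of_dominated_convergence
    (bound := fun j => 2 * Γ.blockBound j * ‖φ‖)
    ((Γ.summable_blockBound.mul_left 2).mul_right ‖φ‖) (fun j => ?_)
    (Eventually.of_forall fun n j => ?_)
  · have h1 : ∀ᶠ n in atTop, j ∈ Finset.Icc (-(M n : ℤ)) (M n : ℤ) := by
      filter_upwards [hM.eventually_ge_atTop j.natAbs] with n hn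
      rw [Finset.mem_Icc]; omega
    have h2 : Tendsto (fun n => phase j (t n) • Γ.nystromBlock j (N n) φ) atTop
        (𝓝 (phase j t₀ • Γ.block j (cellExtend φ))) :=
      (((continuous_phase j).tendsto t₀).comp ht).smul ((Γ.tendsto_nystromBlock j φ).comp hN)
    refine h2.congr' ?_
    filter_upwards [h1] with n hn
    rw [if_pos hn]
  · have hb := Γ.blockBound_nonneg j
    split_ifs
    · rw [norm_smul, norm_phase, one_mul]
      exact Γ.norm_nystromBlock_apply_le j _ φ
    · rw [norm_zero]; positivity

/-- The compact set consists of all sums with `j`-th term in the `j`-th hull, compact by Tychonoff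
and uniform summability. The hulls depend on neither `t`, `M` nor `N`, and they contain `0` for the
truncated terms. -/
theorem collectivelyCompactTendsto_nystromSum {t : ℕ → ℝ} {t₀ : ℝ} {M N : ℕ → ℕ}
    (ht : Tendsto t atTop (𝓝 t₀)) (hM : Tendsto M atTop atTop) (hN : Tendsto N atTop atTop) :
    CollectivelyCompactTendsto (fun n => Γ.nystromSum (t n) (M n) (N n)) (Γ.blochOp t₀) where
  exists_compact := by
    refine ⟨_, isCompact_setOf_tsum Γ.isCompact_blockHull (Γ.summable_blockBound.mul_left 2)
      fun j ψ hψ => Γ.norm_le_of_mem_blockHull j hψ, fun n φ hφ => ?_⟩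
    refine ⟨fun j => if j ∈ Finset.Icc (-(M n : ℤ)) (M n : ℤ) then
      phase j (t n) • Γ.nystromBlock j (N n) φ else 0, fun j _ => ?_,
      (Γ.nystromSum_apply_eq_tsum _ _ _ φ).symm⟩
    dsimp only
    split_ifs
    · exact Γ.phase_smul_nystromBlock_mem j _ _ hφ
    · exact Γ.zero_mem_blockHull j
  tendsto := Γ.tendsto_nystromSum ht hM hN

theorem isCompactOperator_blochOp (t : ℝ) : IsCompactOperator (Γ.blochOp t) :=
  (Γ.collectivelyCompactTendsto_nystromSum (tendsto_const_nhds (x := t)) tendsto_id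
    tendsto_id).isCompactOperator

end AnalyticDilationGraph

/-- Jacobson's identity: `(J S - l)⁻¹ = l⁻¹ (J (S J - l)⁻¹ S - 1)`. -/
theorem isUnit_comp_sub_of_isUnit {E F : Type*} [NormedAddCommGroup E] [NormedSpace ℂ E]
    [NormedAddCommGroup F] [NormedSpace ℂ F] {J : F →L[ℂ] E} {S : E →L[ℂ] F} {l : ℂ} (hl : l ≠ 0)
    (h : IsUnit (S ∘L J - l • (1 : F →L[ℂ] F))) : IsUnit (J ∘L S - l • (1 : E →L[ℂ] E)) := by
  obtain ⟨u, hu⟩ := h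
  have h1 : ∀ x, S (J ((u⁻¹ : (F →L[ℂ] F)ˣ).1 x)) = x + l • (u⁻¹ : (F →L[ℂ] F)ˣ).1 x := fun x => by
    have h2 := congrArg (fun A : F →L[ℂ] F => A x) u.mul_inv
    simp only [hu, ContinuousLinearMap.mul_def, ContinuousLinearMap.comp_apply,
      sub_apply, smul_apply,
      one_apply_eq_self] at h2
    exact sub_eq_iff_eq_add.1 h2
  have h1' : ∀ x, (u⁻¹ : (F →L[ℂ] F)ˣ).1 (S (J x)) = x + l • (u⁻¹ : (F →L[ℂ] F)ˣ).1 x :=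
    fun x => by
    have h2 := congrArg (fun A : F →L[ℂ] F => A x) u.inv_mul
    simp only [hu, ContinuousLinearMap.mul_def, ContinuousLinearMap.comp_apply,
      sub_apply, smul_apply,
      one_apply_eq_self, map_sub, map_smul] at h2
    exact sub_eq_iff_eq_add.1 h2
  refine ⟨⟨J ∘L S - l • 1, l⁻¹ • (J ∘L (u⁻¹ : (F →L[ℂ] F)ˣ).1 ∘L S - 1), ?_, ?_⟩, rfl⟩
  · ext x
    simp only [ContinuousLinearMap.mul_def, ContinuousLinearMap.comp_apply,
      sub_apply, smul_apply,
      one_apply_eq_self, map_sub, map_smul, h1, map_add, smul_sub, smul_add, smul_smul,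
      inv_mul_cancel₀ hl, one_smul]
    abel
  · ext x
    simp only [ContinuousLinearMap.mul_def, ContinuousLinearMap.comp_apply,
      sub_apply, smul_apply,
      one_apply_eq_self, map_sub, map_smul, h1', map_add, smul_sub, smul_add,
      smul_smul, inv_mul_cancel₀ hl, mul_inv_cancel₀ hl, one_smul]
    abel

namespace AnalyticDilationGraph

variable (Γ : AnalyticDilationGraph)

/-! ### The spectrum of the double-layer operator in logarithmic coordinates -/

theorem blochOp_periodic : Function.Periodic Γ.blochOp (2 * Real.pi) := fun t => by
  simp only [blochOp, blochMap, phaseSum, phase_periodic]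

/-- Extension by zero carries an eigenfunction of `B(t) J` to a nonzero eigenvector of the symbol `J
B(t)`. -/
theorem mem_spectrum_logOperator_of_hasEigenvalue {t : ℝ} {l : ℂ}
    (h : Module.End.HasEigenvalue (Γ.blochOp t : Module.End ℂ C(CellSpace, ℂ)) l) :
    l ∈ spectrum ℂ Γ.logOperator := by
  obtain ⟨φ, hφ⟩ := h.exists_hasEigenvector
  have h1 : Γ.blochOp t φ = l • φ := hφ.apply_eq_smul
  refine isShiftSystem.mem_spectrum_of_symbol Γ.logOperator_shift Γ.summable_shiftCoeff
    Γ.summable_abs_mul_shiftCoeff (t := t) (cellProj_cellExtend φ)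
    (fun h0 => hφ.2 (cellExtend_injective (h0.trans (_root_.map_zero cellExtend).symm))) ?_
  rw [Γ.shiftSymbol_eq, ContinuousLinearMap.comp_apply, ← map_smul, ← h1]
  rfl

/-- If `l` were an eigenvalue for no `t`, the Fredholm alternative would invert `B(t) J - l`, hence
`J B(t) - l`, for all `t`. Periodicity confines the search to one period. -/
theorem exists_hasEigenvalue_of_mem_spectrum {l : ℂ} (hl : l ≠ 0)
    (h : l ∈ spectrum ℂ Γ.logOperator) : ∃ t ∈ Icc (-Real.pi) Real.pi,
      Module.End.HasEigenvalue (Γ.blochOp t : Module.End ℂ C(CellSpace, ℂ)) l := by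
  by_contra! hno
  have hno' : ∀ t, ¬ Module.End.HasEigenvalue (Γ.blochOp t : Module.End ℂ C(CellSpace, ℂ)) l := by
    intro t
    obtain ⟨s, hs, hst⟩ := Γ.blochOp_periodic.exists_mem_Ico Real.two_pi_pos t (-Real.pi)
    rw [hst]
    exact hno s ⟨hs.1, by linarith [hs.2]⟩
  rw [spectrum.mem_iff] at h
  refine h ?_
  rw [← IsUnit.neg_iff, neg_sub, Algebra.algebraMap_eq_smul_one]
  refine isShiftSystem.isUnit_of_symbol Γ.logOperator_shift Γ.summable_shiftCoeff fun t => ?_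
  rw [Γ.shiftSymbol_eq]
  refine isUnit_comp_sub_of_isUnit hl ?_
  have h1 := ((Γ.isCompactOperator_blochOp t).hasEigenvalue_or_mem_resolventSet hl).resolve_left
    (hno' t)
  have h2 := h1.neg
  rwa [neg_sub, Algebra.algebraMap_eq_smul_one] at h2

theorem exists_norm_logOperator_le : ∃ C : ℝ, 0 ≤ C ∧ ∀ φ : LogL2, cellProj φ = φ →
    ‖Γ.logOperator φ‖ ≤ C * ∫ y in cell, ‖φ y‖ ∂logMeasure := by
  refine ⟨‖cellExtend‖ * ∑' j, Γ.blockBound j,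
    mul_nonneg (norm_nonneg cellExtend) (tsum_nonneg Γ.blockBound_nonneg), fun φ hφ => ?_⟩
  have h1 : ∀ j, ‖shiftCoeff shift cellProj Γ.logOperator j φ‖
      ≤ Γ.blockBound j * (‖cellExtend‖ * ∫ y in cell, ‖φ y‖ ∂logMeasure) := fun j => by
    rw [Γ.shiftCoeff_eq]
    refine (cellExtend.le_opNorm _).trans ?_
    refine (mul_le_mul_of_nonneg_left (Γ.norm_block_apply_le j φ) (norm_nonneg _)).trans_eq ?_
    ring
  have h2 := Γ.summable_blockBound.mul_right
    (‖cellExtend‖ * ∫ y in cell, ‖φ y‖ ∂logMeasure)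
  refine (isShiftSystem.norm_apply_le_tsum Γ.summable_shiftCoeff hφ).trans ?_
  refine ((Summable.of_nonneg_of_le (fun j => norm_nonneg _) h1 h2).tsum_le_tsum h1 h2).trans_eq ?_
  rw [tsum_mul_right]; ring

/-- An inverse would bound the `L²` norm by the `L¹` norm on one cell. Indicators of `[0, r ^ 2)` on
one branch have `L²` norm `r` and `L¹` norm `r ^ 2`, which is impossible for small `r`. -/
theorem zero_mem_spectrum_logOperator : 0 ∈ spectrum ℂ Γ.logOperator := by
  rw [spectrum.zero_mem_iff]
  rintro ⟨u, hu⟩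
  obtain ⟨C, hC, hCb⟩ := Γ.exists_norm_logOperator_le
  set B := ‖(u⁻¹ : (LogL2 →L[ℂ] LogL2)ˣ).1‖ with hB
  have hbound : ∀ φ : LogL2, cellProj φ = φ →
      ‖φ‖ ≤ B * C * ∫ y in cell, ‖φ y‖ ∂logMeasure := fun φ hφ => by
    have h1 : (u⁻¹ : (LogL2 →L[ℂ] LogL2)ˣ).1 (Γ.logOperator φ) = φ := by
      rw [← hu]
      exact congrArg (fun A : LogL2 →L[ℂ] LogL2 => A φ) u.inv_mul
    have h2 := (u⁻¹ : (LogL2 →L[ℂ] LogL2)ˣ).1.le_opNorm (Γ.logOperator φ)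
    rw [h1] at h2
    refine h2.trans ?_
    rw [mul_assoc]
    exact mul_le_mul_of_nonneg_left (hCb φ hφ) (norm_nonneg _)
  have hkey : ∀ r : ℝ, 0 < r → r ≤ 1 → r ≤ B * C * r ^ 2 := fun r hr hr1 => by
    have hms : MeasurableSet (Ico 0 (r ^ 2) ×ˢ ({true} : Set Bool)) :=
      measurableSet_Ico.prod (measurableSet_singleton _)
    have hμ : logMeasure (Ico 0 (r ^ 2) ×ˢ ({true} : Set Bool)) = ENNReal.ofReal (r ^ 2) := by
      rw [logMeasure, Measure.prod_prod]; simp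
    have hfin : logMeasure (Ico 0 (r ^ 2) ×ˢ ({true} : Set Bool)) ≠ ⊤ := by
      rw [hμ]; exact ENNReal.ofReal_ne_top
    have hsub : Ico 0 (r ^ 2) ×ˢ ({true} : Set Bool) ⊆ cell :=
      prod_mono (Ico_subset_Ico_right (pow_le_one₀ hr.le hr1)) (subset_univ _)
    have hreal : logMeasure.real (Ico 0 (r ^ 2) ×ˢ ({true} : Set Bool)) = r ^ 2 := by
      rw [measureReal_def, hμ, ENNReal.toReal_ofReal (by positivity)]
    have h1 := hbound (indicatorConstLp 2 hms hfin (1 : ℂ)) (by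
      refine Lp.ext ?_
      filter_upwards [coeFn_cellProj (indicatorConstLp 2 hms hfin (1 : ℂ)),
        indicatorConstLp_coeFn (p := 2) (hs := hms) (hμs := hfin) (c := (1 : ℂ))] with y h1 h2
      rw [h1]
      by_cases h : y ∈ cell
      · rw [indicator_of_mem h]
      · rw [indicator_of_notMem h, h2, indicator_of_notMem fun h' => h (hsub h')])
    have h2 : ∫ y in cell, ‖indicatorConstLp 2 hms hfin (1 : ℂ) y‖ ∂logMeasure = r ^ 2 := by
      have h3 : ∫ y in cell, ‖indicatorConstLp 2 hms hfin (1 : ℂ) y‖ ∂logMeasure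
          = ∫ y in cell, (Ico 0 (r ^ 2) ×ˢ ({true} : Set Bool)).indicator (fun _ => (1 : ℝ)) y
            ∂logMeasure := by
        refine integral_congr_ae (ae_restrict_of_ae ?_)
        filter_upwards [indicatorConstLp_coeFn (p := 2) (hs := hms) (hμs := hfin) (c := (1 : ℂ))]
          with y h2
        rw [h2, norm_indicator_eq_indicator_norm, norm_one]
      rw [h3, setIntegral_indicator hms, inter_eq_self_of_subset_right hsub, setIntegral_const,
        hreal]
      simp
    rw [h2, norm_indicatorConstLp (by norm_num) (by norm_num), hreal] at h1
    have h4 : (r ^ 2) ^ (1 / (2 : ENNReal).toReal) = r := by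
      rw [ENNReal.toReal_ofNat, ← Real.sqrt_eq_rpow, Real.sqrt_sq hr.le]
    rwa [h4, norm_one, one_mul] at h1
  have hBC : 0 ≤ B * C := mul_nonneg (norm_nonneg _) hC
  -- For this `r` the bound `r ≤ B C r ^ 2` would read `1 ≤ B C / (B C + 2)`; the `2` keeps the
  -- denominator positive and `r ≤ 1`.
  have hr : (0 : ℝ) < 1 / (B * C + 2) := by positivity
  have h := hkey (1 / (B * C + 2)) hr (by rw [div_le_one (by positivity)]; linarith)
  rw [sq, ← mul_assoc] at h
  have h5 : 1 ≤ B * C * (1 / (B * C + 2)) := by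
    by_contra! h6
    have := mul_lt_mul_of_pos_right h6 hr
    linarith
  rw [mul_one_div, le_div_iff₀ (by positivity)] at h5
  linarith

end AnalyticDilationGraph

/-! ### Change of variables in `L²` -/

section WeightedComp

variable {X Y : Type*} [MeasurableSpace X] [MeasurableSpace Y] {μ : Measure X} {ν : Measure Y}
  {E : X → Y} {w : X → ℝ}

/-- `ν` is the image of `w² μ` under `E`. -/
structure IsWeightedImage (μ : Measure X) (ν : Measure Y) (E : X → Y) (w : X → ℝ) : Prop where
  embedding : MeasurableEmbedding E
  measurable : Measurable w
  pos : ∀ x, 0 < w x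
  eq_map : ν = (μ.withDensity fun x => ENNReal.ofReal (w x ^ 2)).map E

namespace IsWeightedImage

theorem measurable_density (h : IsWeightedImage μ ν E w) :
    Measurable fun x => ENNReal.ofReal (w x ^ 2) := (h.measurable.pow_const 2).ennreal_ofReal

theorem ae_iff (h : IsWeightedImage μ ν E w) {p : Y → Prop} :
    (∀ᵐ y ∂ν, p y) ↔ ∀ᵐ x ∂μ, p (E x) := by
  rw [h.eq_map, h.embedding.ae_map_iff, ae_withDensity_iff h.measurable_density]
  refine eventually_congr (Eventually.of_forall fun x => ?_)
  have : ENNReal.ofReal (w x ^ 2) ≠ 0 := by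
    rw [Ne, ENNReal.ofReal_eq_zero, not_le]; exact pow_pos (h.pos x) 2
  exact ⟨fun hx => hx this, fun hx _ => hx⟩

theorem quasiMeasurePreserving (h : IsWeightedImage μ ν E w) : Measure.QuasiMeasurePreserving E μ ν :=
  ⟨h.embedding.measurable, by
    refine Measure.AbsolutelyContinuous.mk fun s hs hs0 => ?_
    have h1 : ∀ᵐ y ∂ν, y ∉ s := measure_eq_zero_iff_ae_notMem.1 hs0
    rw [Measure.map_apply h.embedding.measurable hs]
    exact measure_eq_zero_iff_ae_notMem.2 (h.ae_iff.1 h1)⟩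

theorem lintegral_eq (h : IsWeightedImage μ ν E w) (F : Y → ENNReal) :
    ∫⁻ y, F y ∂ν = ∫⁻ x, ENNReal.ofReal (w x ^ 2) * F (E x) ∂μ := by
  rw [h.eq_map, h.embedding.lintegral_map,
    lintegral_withDensity_eq_lintegral_mul_non_measurable _ h.measurable_density
      (Eventually.of_forall fun x => ENNReal.ofReal_lt_top)]
  rfl

theorem integral_eq (h : IsWeightedImage μ ν E w) (F : Y → ℂ) :
    ∫ y, F y ∂ν = ∫ x, ((w x ^ 2 : ℝ) : ℂ) * F (E x) ∂μ := by
  rw [h.eq_map, h.embedding.integral_map,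
    integral_withDensity_eq_integral_toReal_smul h.measurable_density
      (Eventually.of_forall fun x => ENNReal.ofReal_lt_top)]
  refine integral_congr_ae (Eventually.of_forall fun x => ?_)
  dsimp only
  rw [ENNReal.toReal_ofReal (sq_nonneg _), Complex.real_smul]

theorem eLpNorm_eq (h : IsWeightedImage μ ν E w) (g : Y → ℂ) :
    eLpNorm (fun x => (w x : ℂ) * g (E x)) 2 μ = eLpNorm g 2 ν := by
  rw [eLpNorm_two_eq, eLpNorm_two_eq, h.lintegral_eq]
  congr 1
  refine lintegral_congr fun x => ?_
  rw [enorm_mul, mul_pow]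
  congr 1
  rw [← ofReal_norm, Complex.norm_real, Real.norm_eq_abs, ← ENNReal.ofReal_pow (abs_nonneg _),
    sq_abs]

theorem memLp_comp (h : IsWeightedImage μ ν E w) {g : Y → ℂ} (hg : MemLp g 2 ν) :
    MemLp (fun x => (w x : ℂ) * g (E x)) 2 μ :=
  ⟨(Complex.measurable_ofReal.comp h.measurable).aestronglyMeasurable.mul
    (hg.1.comp_quasiMeasurePreserving h.quasiMeasurePreserving), by
    rw [h.eLpNorm_eq]; exact hg.2⟩

/-- The isometry `g ↦ w • (g ∘ E)` of `L²` spaces. -/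
def linearIsometry (h : IsWeightedImage μ ν E w) : Lp ℂ 2 ν →ₗᵢ[ℂ] Lp ℂ 2 μ where
  toFun φ := (h.memLp_comp (Lp.memLp φ)).toLp
  map_add' φ ψ := by
    rw [← MemLp.toLp_add]
    refine MemLp.toLp_congr _ _ ?_
    filter_upwards [h.ae_iff.1 (Lp.coeFn_add φ ψ)] with x hx
    simp only [hx, Pi.add_apply, mul_add]
  map_smul' a φ := by
    rw [RingHom.id_apply, ← MemLp.toLp_const_smul]
    refine MemLp.toLp_congr _ _ ?_
    filter_upwards [h.ae_iff.1 (Lp.coeFn_smul a φ)] with x hx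
    simp only [hx, Pi.smul_apply, smul_eq_mul]; ring
  norm_map' φ := by
    change ‖(h.memLp_comp (Lp.memLp φ)).toLp‖ = ‖φ‖
    rw [Lp.norm_toLp, h.eLpNorm_eq, ← Lp.norm_def]

theorem coeFn_linearIsometry (h : IsWeightedImage μ ν E w) (φ : Lp ℂ 2 ν) :
    h.linearIsometry φ =ᵐ[μ] fun x => (w x : ℂ) * φ (E x) :=
  (h.memLp_comp (Lp.memLp φ)).coeFn_toLp

theorem surjective_linearIsometry (h : IsWeightedImage μ ν E w) :
    Function.Surjective h.linearIsometry := by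
  intro ψ
  let g : Y → ℂ := Function.extend E (fun x => ψ x / w x) 0
  have hgE : ∀ x, (w x : ℂ) * g (E x) = ψ x := fun x => by
    have hw : (w x : ℂ) ≠ 0 := by exact_mod_cast (h.pos x).ne'
    simp only [g]
    rw [h.embedding.injective.extend_apply]
    field_simp
  have hgm : Measurable g := h.embedding.measurable_extend
    ((Lp.stronglyMeasurable ψ).measurable.div (Complex.measurable_ofReal.comp h.measurable))
    measurable_const
  have hg : MemLp g 2 ν := ⟨hgm.aestronglyMeasurable, by
    rw [← h.eLpNorm_eq]
    simp only [hgE]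
    exact (Lp.memLp ψ).2⟩
  refine ⟨hg.toLp, Lp.ext ?_⟩
  filter_upwards [h.coeFn_linearIsometry hg.toLp, h.ae_iff.1 hg.coeFn_toLp] with x h1 h2
  rw [h1, h2, hgE]

/-- The unitary map `g ↦ w • (g ∘ E)` of `L²` spaces. -/
def unitary (h : IsWeightedImage μ ν E w) : Lp ℂ 2 ν ≃ₗᵢ[ℂ] Lp ℂ 2 μ :=
  LinearIsometryEquiv.ofSurjective h.linearIsometry h.surjective_linearIsometry

theorem coeFn_unitary (h : IsWeightedImage μ ν E w) (φ : Lp ℂ 2 ν) :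
    h.unitary φ =ᵐ[μ] fun x => (w x : ℂ) * φ (E x) := h.coeFn_linearIsometry φ

end IsWeightedImage

end WeightedComp

/-! ### Shift systems under unitary maps -/

theorem IsShiftSystem.conj {H H' : Type*} [NormedAddCommGroup H] [InnerProductSpace ℂ H]
    [NormedAddCommGroup H'] [InnerProductSpace ℂ H'] {V : ℤ → H →ₗᵢ[ℂ] H} {P : H →L[ℂ] H}
    (h : IsShiftSystem V P) (U : H' ≃ₗᵢ[ℂ] H) :
    IsShiftSystem (fun j => U.symm.toLinearIsometry.comp ((V j).comp U.toLinearIsometry))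
      ((U.symm : H →L[ℂ] H') ∘L P ∘L (U : H' →L[ℂ] H)) where
  zero x := by simp [h.zero]
  add i j x := by simp [h.add]
  idem x := by simp [h.idem]
  symm x y := by
    have h1 := h.symm (U x) (U y)
    rw [← U.symm.inner_map_map, ← U.symm.inner_map_map (U x)] at h1
    simpa using h1
  orth j hj x := by simp [h.orth j hj]
  sep x hx := by
    have h1 := h.sep (U x) fun k => by simpa using hx k
    simpa using h1

namespace AnalyticDilationGraph

variable (Γ : AnalyticDilationGraph)

/-! ### Logarithmic coordinates on the graph -/

/-- The point of the graph with given logarithmic coordinate. -/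
def graphPoint (z : ℝ × Bool) : Plane := !₂[Γ.point z, Γ.f (Γ.point z)]

/-- The square root of the density of arc length in logarithmic coordinates. -/
def weight (z : ℝ × Bool) : ℝ :=
  Real.sqrt (Γ.α ^ z.1 * |Real.log Γ.α| * Real.sqrt (1 + deriv Γ.f (Γ.point z) ^ 2))

theorem abs_log_pos : 0 < |Real.log Γ.α| :=
  abs_pos.2 (Real.log_neg Γ.α_pos Γ.α_lt_one).ne

theorem weight_pos (z : ℝ × Bool) : 0 < Γ.weight z := by
  have := Γ.rpow_pos z.1
  have := Γ.abs_log_pos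
  exact Real.sqrt_pos.2 (by positivity)

theorem weight_sq (z : ℝ × Bool) : Γ.weight z ^ 2
    = Γ.α ^ z.1 * |Real.log Γ.α| * Real.sqrt (1 + deriv Γ.f (Γ.point z) ^ 2) := by
  have := Γ.rpow_pos z.1
  exact Real.sq_sqrt (by positivity)

theorem continuous_weight : Continuous Γ.weight := by
  have h1 := Γ.continuous_deriv_point
  have h2 : Continuous fun z : ℝ × Bool => Γ.α ^ z.1 :=
    (Real.continuous_const_rpow Γ.α_pos.ne').comp continuous_fst
  exact ((h2.mul continuous_const).mul (continuous_const.add (h1.pow 2)).sqrt).sqrt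

theorem injective_point : Function.Injective Γ.point := by
  rintro ⟨s, b⟩ ⟨r, b'⟩ h
  by_cases hb : b = b'
  · subst hb
    rw [(Γ.point_eq_iff b s r).1 h]
  · exact absurd h (Γ.point_ne_of_ne hb s r)

theorem measurable_f : Measurable Γ.f :=
  measurable_of_continuousOn_compl_singleton 0 fun _ hx =>
    (Γ.analyticAt_f hx).continuousAt.continuousWithinAt

theorem continuous_graphPoint : Continuous Γ.graphPoint := by
  have h1 : Continuous fun z => Γ.f (Γ.point z) := by
    rw [continuous_iff_continuousAt]
    exact fun z => ContinuousAt.comp (f := Γ.point) (g := Γ.f)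
      (Γ.analyticAt_f (Γ.point_ne_zero z)).continuousAt Γ.continuous_point.continuousAt
  have h2 := Γ.continuous_point
  unfold graphPoint
  fun_prop

theorem injective_graphPoint : Function.Injective Γ.graphPoint := fun y z h =>
  Γ.injective_point (by simpa [graphPoint] using congrArg (fun p : Plane => p 0) h)

theorem lintegral_eq_lintegral_point (F : ℝ → ENNReal) (hF : Measurable F) :
    ∫⁻ x, F x = ∫⁻ z, ENNReal.ofReal (Γ.α ^ z.1 * |Real.log Γ.α|) * F (Γ.point z) ∂logMeasure := by
  have hlog := (Real.log_neg Γ.α_pos Γ.α_lt_one)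
  have hd : ∀ b : Bool, ∫⁻ x in (fun r : ℝ => branchSign b * Γ.α ^ r) '' univ, F x
      = ∫⁻ r, ENNReal.ofReal (Γ.α ^ r * |Real.log Γ.α|) * F (Γ.point (r, b)) := fun b => by
    rw [lintegral_image_eq_lintegral_abs_deriv_mul (f' := fun r : ℝ =>
      branchSign b * (Γ.α ^ r * Real.log Γ.α)) MeasurableSet.univ
      (fun r _ => ((Real.hasStrictDerivAt_const_rpow Γ.α_pos r).hasDerivAt.const_mul
        _).hasDerivWithinAt)
      (fun s _ r _ h => (Γ.point_eq_iff b s r).1 h), Measure.restrict_univ]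
    refine lintegral_congr fun r => ?_
    rw [abs_mul, abs_branchSign, one_mul, abs_mul, abs_of_pos (Γ.rpow_pos r)]
    rfl
  have hpos : (fun r : ℝ => branchSign true * Γ.α ^ r) '' univ = Ioi 0 := by
    ext x
    simp only [branchSign, if_true, one_mul, image_univ, mem_range, mem_Ioi]
    constructor
    · rintro ⟨r, rfl⟩; exact Γ.rpow_pos r
    · intro hx
      exact ⟨Real.logb Γ.α x, Real.rpow_logb Γ.α_pos Γ.α_lt_one.ne hx⟩
  have hneg : (fun r : ℝ => branchSign false * Γ.α ^ r) '' univ = Iio 0 := by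
    ext x
    simp only [branchSign, image_univ, mem_range, mem_Iio]
    constructor
    · rintro ⟨r, rfl⟩
      have := Γ.rpow_pos r
      simpa using this
    · intro hx
      refine ⟨Real.logb Γ.α (-x), ?_⟩
      rw [Real.rpow_logb Γ.α_pos Γ.α_lt_one.ne (by linarith)]
      simp
  have hm : Measurable fun z : ℝ × Bool =>
      ENNReal.ofReal (Γ.α ^ z.1 * |Real.log Γ.α|) * F (Γ.point z) := by
    have h1 : Continuous fun z : ℝ × Bool => Γ.α ^ z.1 * |Real.log Γ.α| :=
      ((Real.continuous_const_rpow Γ.α_pos.ne').comp continuous_fst).mul continuous_const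
    exact h1.measurable.ennreal_ofReal.mul (hF.comp Γ.continuous_point.measurable)
  -- The two branches parametrize the open half lines; the origin is null.
  rw [logMeasure, lintegral_prod_symm _ hm.aemeasurable, lintegral_count, tsum_bool, ← hd, ← hd,
    hpos, hneg, ← lintegral_add_compl F (measurableSet_Iio (a := (0 : ℝ))), compl_Iio,
    setLIntegral_congr Ioi_ae_eq_Ici]

theorem isWeightedImage : IsWeightedImage logMeasure Γ.arcLength Γ.graphPoint Γ.weight where
  -- Lusin–Souslin: a continuous injection of this Polish space is a measurable embedding. The
  -- origin of the graph is not in its range.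
  embedding := Γ.continuous_graphPoint.measurableEmbedding Γ.injective_graphPoint
  measurable := Γ.continuous_weight.measurable
  pos := Γ.weight_pos
  eq_map := by
    have hG : Measurable fun x : ℝ => (!₂[x, Γ.f x] : Plane) := by
      have := Γ.measurable_f
      fun_prop
    have hd : Measurable fun x => ENNReal.ofReal (Real.sqrt (1 + deriv Γ.f x ^ 2)) :=
      ((measurable_const.add ((measurable_deriv Γ.f).pow_const 2)).sqrt).ennreal_ofReal
    have hw : Measurable fun z => ENNReal.ofReal (Γ.weight z ^ 2) :=
      (Γ.continuous_weight.measurable.pow_const 2).ennreal_ofReal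
    refine Measure.ext_of_lintegral _ fun F hF => ?_
    have hFG : Measurable fun x : ℝ => F !₂[x, Γ.f x] := hF.comp hG
    have hFE : Measurable fun z => F (Γ.graphPoint z) :=
      hF.comp Γ.continuous_graphPoint.measurable
    rw [arcLength, lintegral_map hF hG, lintegral_map hF Γ.continuous_graphPoint.measurable,
      lintegral_withDensity_eq_lintegral_mul _ hd hFG,
      lintegral_withDensity_eq_lintegral_mul _ hw hFE,
      Γ.lintegral_eq_lintegral_point _ (hd.mul hFG)]
    refine lintegral_congr fun z => ?_
    have := Γ.rpow_pos z.1
    simp only [Pi.mul_apply]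
    rw [Γ.weight_sq, ENNReal.ofReal_mul (show 0 ≤ Γ.α ^ z.1 * |Real.log Γ.α| by positivity),
      mul_assoc]
    rfl

end AnalyticDilationGraph

namespace AnalyticDilationGraph

variable (Γ : AnalyticDilationGraph)

/-! ### The double-layer operator -/

theorem inner_graphPoint_sub_normal (y z : ℝ × Bool) :
    inner ℝ (Γ.graphPoint y - Γ.graphPoint z) (Γ.normal (Γ.graphPoint z))
      = (Real.sqrt (1 + deriv Γ.f (Γ.point z) ^ 2))⁻¹ *
        (Γ.f (Γ.point y) - Γ.f (Γ.point z)
          - deriv Γ.f (Γ.point z) * (Γ.point y - Γ.point z)) := by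
  rw [normal, inner_smul_right]
  simp [graphPoint, PiLp.inner_apply, Fin.sum_univ_two]
  ring_nf
  tauto

theorem norm_graphPoint_sub_sq (y z : ℝ × Bool) : ‖Γ.graphPoint y - Γ.graphPoint z‖ ^ 2
    = (Γ.point y - Γ.point z) ^ 2 + (Γ.f (Γ.point y) - Γ.f (Γ.point z)) ^ 2 := by
  rw [EuclideanSpace.norm_sq_eq]
  simp [graphPoint, Fin.sum_univ_two]

/-- Conjugation by the unitary leaves one weight from the target and one from the source: of the
source's two weights in the density, one is absorbed by the transformed `φ`. -/
theorem weight_mul_weight_mul_kernel {y z : ℝ × Bool} (h : y ≠ z) :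
    Γ.weight y * Γ.weight z * (1 / (2 * Real.pi) *
      (inner ℝ (Γ.graphPoint y - Γ.graphPoint z) (Γ.normal (Γ.graphPoint z))
        / ‖Γ.graphPoint y - Γ.graphPoint z‖ ^ 2)) = Γ.kern y z := by
  have hne : Γ.point y ≠ Γ.point z := fun e => h (Γ.injective_point e)
  have hsub := sub_ne_zero.2 hne
  rw [Γ.inner_graphPoint_sub_normal, Γ.norm_graphPoint_sub_sq]
  have hy := Γ.rpow_pos y.1
  have hz := Γ.rpow_pos z.1
  have hl := Γ.abs_log_pos
  have hyz := Γ.rpow_pos ((y.1 + z.1) / 2)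
  set a := 1 + deriv Γ.f (Γ.point y) ^ 2 with ha
  set b := 1 + deriv Γ.f (Γ.point z) ^ 2 with hb
  have ha0 : 0 < a := by positivity
  have hb0 : 0 < b := by positivity
  have hww : Γ.weight y * Γ.weight z = Γ.α ^ ((y.1 + z.1) / 2) * |Real.log Γ.α| *
      (a ^ (1 / 4 : ℝ) * b ^ (1 / 4 : ℝ)) := by
    rw [weight, weight, ← Real.sqrt_mul (by positivity),
      Real.sqrt_eq_iff_mul_self_eq (by positivity) (by positivity)]
    have h4 : ∀ c : ℝ, 0 < c → c ^ (1 / 4 : ℝ) * c ^ (1 / 4 : ℝ) = Real.sqrt c := fun c hc => by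
      rw [← Real.rpow_add hc, Real.sqrt_eq_rpow]; norm_num
    have h2 : Γ.α ^ ((y.1 + z.1) / 2) * Γ.α ^ ((y.1 + z.1) / 2) = Γ.α ^ y.1 * Γ.α ^ z.1 := by
      rw [← Real.rpow_add Γ.α_pos, ← Real.rpow_add Γ.α_pos]; congr 1; ring
    rw [← h4 a ha0, ← h4 b hb0]
    linear_combination -(|Real.log Γ.α| ^ 2 * (a ^ (1 / 4 : ℝ)) ^ 2 * (b ^ (1 / 4 : ℝ)) ^ 2) * h2
  -- The source weight gives `b ^ (1/4)` and the normalization of the normal gives `b ^ (-1/2)`;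
  -- together they are the denominator of the fourth root in the kernel.
  have hbq : b ^ (1 / 4 : ℝ) * (Real.sqrt b)⁻¹ = (b ^ (1 / 4 : ℝ))⁻¹ := by
    have h4 : b ^ (1 / 4 : ℝ) * b ^ (1 / 4 : ℝ) = Real.sqrt b := by
      rw [← Real.rpow_add hb0, Real.sqrt_eq_rpow]; norm_num
    have := Real.rpow_pos_of_pos hb0 (1 / 4)
    rw [← h4]
    field_simp
  have hfrac : Γ.secondSlope (Γ.point y) (Γ.point z)
      / (1 + Γ.firstSlope (Γ.point y) (Γ.point z) ^ 2)
      = (Γ.f (Γ.point y) - Γ.f (Γ.point z) - deriv Γ.f (Γ.point z) * (Γ.point y - Γ.point z)) /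
        ((Γ.point y - Γ.point z) ^ 2 + (Γ.f (Γ.point y) - Γ.f (Γ.point z)) ^ 2) := by
    rw [Γ.firstSlope_of_ne hne, secondSlope, if_neg hne]
    have : (Γ.point y - Γ.point z) ^ 2 + (Γ.f (Γ.point y) - Γ.f (Γ.point z)) ^ 2 ≠ 0 := by
      positivity
    field_simp
  have hk : Γ.kern y z = 1 / (2 * Real.pi) * (Γ.secondSlope (Γ.point y) (Γ.point z)
      / (1 + Γ.firstSlope (Γ.point y) (Γ.point z) ^ 2) * (a / b) ^ (1 / 4 : ℝ)
      * Γ.α ^ ((y.1 + z.1) / 2) * |Real.log Γ.α|) := Γ.kern_eq y z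
  rw [hk, hfrac, Real.div_rpow ha0.le hb0.le, hww, div_eq_mul_inv (a ^ (1 / 4 : ℝ)), ← hbq]
  ring

instance : NullSingletonClass logMeasure := ⟨fun y => by
  rw [← Set.singleton_prod_singleton (a := y.1) (b := y.2), logMeasure, Measure.prod_prod]
  simp⟩

/-- The double-layer operator. -/
def doubleLayer : Γ.L2 →L[ℂ] Γ.L2 :=
  (Γ.isWeightedImage.unitary.symm : LogL2 →L[ℂ] Γ.L2) ∘L Γ.logOperator ∘L
    (Γ.isWeightedImage.unitary : Γ.L2 →L[ℂ] LogL2)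

/-- The transformed integrand is absolutely integrable and a single point is null, so dominated
convergence identifies the principal value with an ordinary integral, at every `y`. -/
theorem tendsto_truncated_integral (φ : Γ.L2) (y : ℝ × Bool) :
    Tendsto (fun ε : ℝ => ∫ x in {x : Plane | ε < dist (Γ.graphPoint y) x},
        ((1 / (2 * Real.pi) * (inner ℝ (Γ.graphPoint y - x) (Γ.normal x)
          / ‖Γ.graphPoint y - x‖ ^ 2) : ℝ) : ℂ) * φ x ∂Γ.arcLength) (𝓝[>] 0)
      (𝓝 ((Γ.weight y : ℂ)⁻¹ *
        ∫ z, (Γ.kern y z : ℂ) * Γ.isWeightedImage.unitary φ z ∂logMeasure)) := by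
  have hw : ∀ z, (Γ.weight z : ℂ) ≠ 0 := fun z => by exact_mod_cast (Γ.weight_pos z).ne'
  let F : ℝ → ℝ × Bool → ℂ := fun ε => {z | ε < dist (Γ.graphPoint y) (Γ.graphPoint z)}.indicator
    fun z => (Γ.weight y : ℂ)⁻¹ * ((Γ.kern y z : ℂ) * Γ.isWeightedImage.unitary φ z)
  have hF : ∀ ε > 0, ∫ x in {x : Plane | ε < dist (Γ.graphPoint y) x},
        ((1 / (2 * Real.pi) * (inner ℝ (Γ.graphPoint y - x) (Γ.normal x)
          / ‖Γ.graphPoint y - x‖ ^ 2) : ℝ) : ℂ) * φ x ∂Γ.arcLength = ∫ z, F ε z ∂logMeasure := by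
    intro ε hε
    have hms : MeasurableSet {x : Plane | ε < dist (Γ.graphPoint y) x} :=
      measurableSet_lt measurable_const (by fun_prop)
    rw [← integral_indicator hms, Γ.isWeightedImage.integral_eq]
    refine integral_congr_ae ?_
    filter_upwards [Γ.isWeightedImage.coeFn_unitary φ] with z hz
    simp only [F, indicator_apply, mem_ofPred_eq]
    split_ifs with h
    · have hyz : y ≠ z := by
        rintro rfl
        rw [dist_self] at h
        exact absurd h hε.le.not_gt
      rw [hz, ← Γ.weight_mul_weight_mul_kernel hyz]
      have := hw y
      push_cast
      field_simp
    · rw [mul_zero]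
  have hint := (Γ.integrable_kern_mul (Γ.isWeightedImage.unitary φ) y).const_mul
    (Γ.weight y : ℂ)⁻¹
  rw [← integral_const_mul]
  refine Tendsto.congr' (f₁ := fun ε => ∫ z, F ε z ∂logMeasure) ?_ ?_
  · filter_upwards [self_mem_nhdsWithin] with ε hε
    exact (hF ε hε).symm
  · refine tendsto_integral_filter_of_dominated_convergence _ (Eventually.of_forall fun ε => ?_)
      (Eventually.of_forall fun ε => Eventually.of_forall fun z => ?_) hint.norm ?_
    · have hms : MeasurableSet {z | ε < dist (Γ.graphPoint y) (Γ.graphPoint z)} :=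
        measurableSet_lt measurable_const
          (measurable_const.dist Γ.continuous_graphPoint.measurable)
      exact hint.1.indicator hms
    · exact norm_indicator_le_norm_self _ z
    · filter_upwards [compl_mem_ae_iff.2 (measure_singleton y)] with z hz
      have hd : 0 < dist (Γ.graphPoint y) (Γ.graphPoint z) :=
        dist_pos.2 fun e => hz (Γ.injective_graphPoint e).symm
      refine tendsto_const_nhds.congr' ?_
      filter_upwards [Ioo_mem_nhdsGT hd] with ε hε
      have hz' : z ∈ {z | ε < dist (Γ.graphPoint y) (Γ.graphPoint z)} := hε.2
      simp only [F]
      rw [indicator_of_mem hz']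

theorem isDoubleLayer_doubleLayer : Γ.IsDoubleLayer Γ.doubleLayer := by
  intro φ
  rw [Γ.isWeightedImage.ae_iff]
  filter_upwards [Γ.isWeightedImage.coeFn_unitary (Γ.doubleLayer φ),
    Γ.coeFn_logOperator (Γ.isWeightedImage.unitary φ)] with y h1 h2
  have h3 : Γ.isWeightedImage.unitary (Γ.doubleLayer φ)
      = Γ.logOperator (Γ.isWeightedImage.unitary φ) := by simp [doubleLayer]
  have hw : (Γ.weight y : ℂ) ≠ 0 := by exact_mod_cast (Γ.weight_pos y).ne'
  have h4 := Γ.tendsto_truncated_integral φ y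
  rw [← h2, ← h3, h1, inv_mul_cancel_left₀ hw] at h4
  exact h4

theorem eq_of_isDoubleLayer {D D' : Γ.L2 →L[ℂ] Γ.L2} (h : Γ.IsDoubleLayer D)
    (h' : Γ.IsDoubleLayer D') : D = D' := by
  ext1 φ
  refine Lp.ext ?_
  filter_upwards [h φ, h' φ] with x h1 h2
  exact tendsto_nhds_unique h1 h2

theorem spectrum_doubleLayer : spectrum ℂ Γ.doubleLayer = spectrum ℂ Γ.logOperator := by
  have h := AlgEquiv.spectrum_eq
    (Γ.isWeightedImage.unitary.symm.toContinuousLinearEquiv.conjContinuousAlgEquiv :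
      (LogL2 →L[ℂ] LogL2) ≃ₐ[ℂ] (Γ.L2 →L[ℂ] Γ.L2)) Γ.logOperator
  rw [← h]
  rfl

/-- Transporting the shift system to `L²(Γ)` avoids having to move Fredholmness across the unitary
map. -/
theorem spectrum_doubleLayer_eq_essentialSpectrum :
    spectrum ℂ Γ.doubleLayer = essentialSpectrum Γ.doubleLayer := by
  refine (isShiftSystem.conj Γ.isWeightedImage.unitary).spectrum_eq_essentialSpectrum
    fun j φ => ?_
  simp [doubleLayer, Γ.logOperator_shift]

end AnalyticDilationGraph

/-! ### Nyström operators and Nyström matrices -/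

theorem mem_spectrum_comp_comm {E F : Type*} [NormedAddCommGroup E] [NormedSpace ℂ E]
    [NormedAddCommGroup F] [NormedSpace ℂ F] {J : F →L[ℂ] E} {S : E →L[ℂ] F} {l : ℂ}
    (hl : l ≠ 0) : l ∈ spectrum ℂ (J ∘L S) ↔ l ∈ spectrum ℂ (S ∘L J) := by
  rw [spectrum.mem_iff, spectrum.mem_iff, not_iff_not, ← IsUnit.neg_iff, neg_sub,
    ← IsUnit.neg_iff (_ - S ∘L J), neg_sub, Algebra.algebraMap_eq_smul_one,
    Algebra.algebraMap_eq_smul_one]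
  exact ⟨isUnit_comp_sub_of_isUnit hl, isUnit_comp_sub_of_isUnit hl⟩

/-- The midpoint nodes as points of the unit interval. -/
def unitNode (N : ℕ) (q : Fin N) : unitInterval := ⟨midpointNode N q, midpointNode_mem N q⟩

/-- The Nyström extension of a vector of nodal values. -/
def nystromExtend (k : ℝ → ℝ → ℂ) (hk : ∀ y : ℝ, Continuous fun x => k x y) (N : ℕ) :
    (Fin N → ℂ) →L[ℂ] C(unitInterval, ℂ) :=
  (1 / (N : ℂ)) • ∑ q : Fin N, (ContinuousLinearMap.proj (R := ℂ) (φ := fun _ : Fin N => ℂ)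
    q).smulRight (⟨fun x : unitInterval => k x (midpointNode N q),
      (hk _).comp continuous_subtype_val⟩ : C(unitInterval, ℂ))

theorem nystromExtend_apply (k : ℝ → ℝ → ℂ) (hk : ∀ y : ℝ, Continuous fun x => k x y) (N : ℕ)
    (v : Fin N → ℂ) (x : unitInterval) :
    nystromExtend k hk N v x = (1 / (N : ℂ)) * ∑ q : Fin N, k x (midpointNode N q) * v q := by
  simp [nystromExtend, mul_comm]

theorem nystromExtend_unitNode (k : ℝ → ℝ → ℂ) (hk : ∀ y : ℝ, Continuous fun x => k x y) (N : ℕ)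
    (v : Fin N → ℂ) (p : Fin N) :
    nystromExtend k hk N v (unitNode N p) = (nystromMatrix k N).mulVec v p := by
  rw [nystromExtend_apply, Matrix.mulVec, dotProduct, Finset.mul_sum]
  refine Finset.sum_congr rfl fun q _ => ?_
  rw [nystromMatrix, Matrix.of_apply, mul_assoc]
  rfl

/-- Nodal values of a pair of functions. -/
def evalNodes (N : ℕ) :
    (C(unitInterval, ℂ) × C(unitInterval, ℂ)) →L[ℂ] (Fin N ⊕ Fin N → ℂ) :=
  ContinuousLinearMap.pi fun i => Sum.elim
    (fun q => (ContinuousMap.evalCLM ℂ (unitNode N q)) ∘L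
      ContinuousLinearMap.fst ℂ C(unitInterval, ℂ) C(unitInterval, ℂ))
    (fun q => (ContinuousMap.evalCLM ℂ (unitNode N q)) ∘L
      ContinuousLinearMap.snd ℂ C(unitInterval, ℂ) C(unitInterval, ℂ)) i

/-- The node polynomial works: all nodes are positive, so it is nonzero at `0`. It provides a kernel
vector of the Nyström operator. -/
theorem exists_ne_zero_vanishing_at_nodes (N : ℕ) :
    ∃ φ : C(unitInterval, ℂ), φ ≠ 0 ∧ ∀ q, φ (unitNode N q) = 0 := by
  refine ⟨⟨fun x => ∏ q : Fin N, ((x : ℝ) - (midpointNode N q : ℝ) : ℂ), by fun_prop⟩,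
    fun h => ?_, fun q => ?_⟩
  · have h0 := congrArg (fun φ : C(unitInterval, ℂ) => φ 0) h
    simp only [ContinuousMap.coe_mk, ContinuousMap.zero_apply, Finset.prod_eq_zero_iff] at h0
    obtain ⟨q, -, hq⟩ := h0
    have hpos : 0 < midpointNode N q := by
      have hN : (0 : ℝ) < N := by exact_mod_cast q.pos
      unfold midpointNode; positivity
    simp only [Set.Icc.coe_zero, Complex.ofReal_zero, zero_sub, neg_eq_zero,
      Complex.ofReal_eq_zero] at hq
    exact hpos.ne' hq
  · exact Finset.prod_eq_zero (Finset.mem_univ q) (sub_self _)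

namespace AnalyticDilationGraph

variable (Γ : AnalyticDilationGraph)

/-- The Nyström extension for the `2 × 2` system. -/
def operatorExtend (t : ℝ) (M N : ℕ) :
    (Fin N ⊕ Fin N → ℂ) →L[ℂ] (C(unitInterval, ℂ) × C(unitInterval, ℂ)) :=
  (((nystromExtend (diagKernel Γ.α Γ.fNeg t M)
        (continuous_diagKernel Γ.α_pos Γ.α_lt_one Γ.analytic_fNeg t M) N).coprod
      (nystromExtend (offKernel Γ.α Γ.fNeg Γ.fPos t M)
        (continuous_offKernel Γ.α_pos Γ.analytic_fNeg t M) N)).prod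
    ((nystromExtend (offKernel Γ.α Γ.fPos Γ.fNeg t M)
        (continuous_offKernel Γ.α_pos Γ.analytic_fPos t M) N).coprod
      (nystromExtend (diagKernel Γ.α Γ.fPos t M)
        (continuous_diagKernel Γ.α_pos Γ.α_lt_one Γ.analytic_fPos t M) N))) ∘L
    ((LinearMap.funLeft ℂ ℂ Sum.inl).toContinuousLinearMap.prod
      (LinearMap.funLeft ℂ ℂ Sum.inr).toContinuousLinearMap)

theorem operator_apply_fst (t : ℝ) (M N : ℕ) (p : C(unitInterval, ℂ) × C(unitInterval, ℂ))
    (x : unitInterval) : (Γ.operator t M N p).1 x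
      = 1 / (N : ℂ) * ∑ q : Fin N, diagKernel Γ.α Γ.fNeg t M x (midpointNode N q)
          * p.1 (unitNode N q)
        + 1 / (N : ℂ) * ∑ q : Fin N, offKernel Γ.α Γ.fNeg Γ.fPos t M x (midpointNode N q)
          * p.2 (unitNode N q) :=
  congrArg₂ (· + ·)
    (nystromOp_apply _ (continuous_diagKernel Γ.α_pos Γ.α_lt_one Γ.analytic_fNeg t M) _ _ _)
    (nystromOp_apply _ (continuous_offKernel Γ.α_pos Γ.analytic_fNeg t M) _ _ _)

theorem operator_apply_snd (t : ℝ) (M N : ℕ) (p : C(unitInterval, ℂ) × C(unitInterval, ℂ))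
    (x : unitInterval) : (Γ.operator t M N p).2 x
      = 1 / (N : ℂ) * ∑ q : Fin N, offKernel Γ.α Γ.fPos Γ.fNeg t M x (midpointNode N q)
          * p.1 (unitNode N q)
        + 1 / (N : ℂ) * ∑ q : Fin N, diagKernel Γ.α Γ.fPos t M x (midpointNode N q)
          * p.2 (unitNode N q) :=
  congrArg₂ (· + ·)
    (nystromOp_apply _ (continuous_offKernel Γ.α_pos Γ.analytic_fPos t M) _ _ _)
    (nystromOp_apply _ (continuous_diagKernel Γ.α_pos Γ.α_lt_one Γ.analytic_fPos t M) _ _ _)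

theorem operatorExtend_comp_evalNodes (t : ℝ) (M N : ℕ) :
    Γ.operatorExtend t M N ∘L evalNodes N = Γ.operator t M N := by
  refine ContinuousLinearMap.ext fun p => Prod.ext ?_ ?_
  · ext x
    rw [operator_apply_fst]
    exact congrArg₂ (· + ·)
      (nystromExtend_apply _ (continuous_diagKernel Γ.α_pos Γ.α_lt_one Γ.analytic_fNeg t M) _ _ _)
      (nystromExtend_apply _ (continuous_offKernel Γ.α_pos Γ.analytic_fNeg t M) _ _ _)
  · ext x
    rw [operator_apply_snd]
    exact congrArg₂ (· + ·)
      (nystromExtend_apply _ (continuous_offKernel Γ.α_pos Γ.analytic_fPos t M) _ _ _)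
      (nystromExtend_apply _ (continuous_diagKernel Γ.α_pos Γ.α_lt_one Γ.analytic_fPos t M) _ _ _)

theorem evalNodes_comp_operatorExtend (t : ℝ) (M N : ℕ) :
    evalNodes N ∘L Γ.operatorExtend t M N
      = Module.End.toContinuousLinearMap _ (Γ.matrix t M N).toLin' := by
  ext1 v
  have hR : Module.End.toContinuousLinearMap _ (Γ.matrix t M N).toLin' v
      = (Γ.matrix t M N).mulVec v := rfl
  rw [hR, matrix, Matrix.fromBlocks_mulVec]
  funext i
  cases i with
  | inl p =>
    simp only [Sum.elim_inl, Pi.add_apply]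
    rw [← nystromExtend_unitNode (diagKernel Γ.α Γ.fNeg t M)
      (continuous_diagKernel Γ.α_pos Γ.α_lt_one Γ.analytic_fNeg t M),
      ← nystromExtend_unitNode (offKernel Γ.α Γ.fNeg Γ.fPos t M)
      (continuous_offKernel Γ.α_pos Γ.analytic_fNeg t M)]
    rfl
  | inr p =>
    simp only [Sum.elim_inr, Pi.add_apply]
    rw [← nystromExtend_unitNode (diagKernel Γ.α Γ.fPos t M)
      (continuous_diagKernel Γ.α_pos Γ.α_lt_one Γ.analytic_fPos t M),
      ← nystromExtend_unitNode (offKernel Γ.α Γ.fPos Γ.fNeg t M)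
      (continuous_offKernel Γ.α_pos Γ.analytic_fPos t M)]
    rfl

theorem zero_mem_spectrum_operator (t : ℝ) (M N : ℕ) : 0 ∈ spectrum ℂ (Γ.operator t M N) := by
  rw [spectrum.zero_mem_iff]
  rintro ⟨u, hu⟩
  obtain ⟨φ, hφ, hq⟩ := exists_ne_zero_vanishing_at_nodes N
  have h1 : evalNodes N (φ, 0) = 0 := by
    funext i
    cases i with
    | inl p => exact hq p
    | inr p => rfl
  have h2 : Γ.operator t M N (φ, 0) = 0 := by
    rw [← operatorExtend_comp_evalNodes, ContinuousLinearMap.comp_apply, h1, _root_.map_zero]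
  have h3 := congrArg (fun A : (C(unitInterval, ℂ) × C(unitInterval, ℂ)) →L[ℂ]
    (C(unitInterval, ℂ) × C(unitInterval, ℂ)) => A (φ, 0)) u.inv_mul
  simp only [ContinuousLinearMap.mul_def, ContinuousLinearMap.comp_apply, hu, h2,
    _root_.map_zero, one_apply_eq_self] at h3
  exact hφ (congrArg Prod.fst h3).symm

/-- Operator and matrix are the two products of `operatorExtend` and `evalNodes`, so they share
nonzero spectrum; `0` belongs to the operator's because functions vanishing at the nodes are
annihilated. -/
theorem spectrum_operator (t : ℝ) (M N : ℕ) :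
    spectrum ℂ (Γ.operator t M N) = {0} ∪ spectrum ℂ (Γ.matrix t M N) := by
  have hmat : spectrum ℂ (evalNodes N ∘L Γ.operatorExtend t M N)
      = spectrum ℂ (Γ.matrix t M N) := by
    rw [evalNodes_comp_operatorExtend, AlgEquiv.spectrum_eq, Matrix.spectrum_toLin']
  ext l
  by_cases hl : l = 0
  · subst hl
    simp [Γ.zero_mem_spectrum_operator]
  · rw [← hmat, ← operatorExtend_comp_evalNodes, mem_spectrum_comp_comm hl]
    simp [hl]

theorem samplePoints_nonempty {m : ℕ} (hm : 1 ≤ m) : (samplePoints m).Nonempty :=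
  ⟨_, 1, le_rfl, hm, Or.inl rfl⟩

theorem approxSpectrum_eq {m : ℕ} (hm : 1 ≤ m) (M N : ℕ) : Γ.approxSpectrum m M N
    = {0} ∪ ⋃ t ∈ samplePoints m, spectrum ℂ (Γ.matrix t M N) := by
  obtain ⟨t₀, ht₀⟩ := samplePoints_nonempty hm
  ext l
  simp only [approxSpectrum, spectrum_operator, mem_iUnion, mem_union, exists_prop]
  constructor
  · rintro ⟨t, ht, h | h⟩
    exacts [Or.inl h, Or.inr ⟨t, ht, h⟩]
  · rintro (h | ⟨t, ht, h⟩)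
    exacts [⟨t₀, ht₀, Or.inl h⟩, ⟨t, ht, Or.inr h⟩]

/-! ### The Nyström operators on the closed fundamental domain -/

/-- Functions on the two branches as pairs of functions. -/
def cellEquiv : C(CellSpace, ℂ) ≃L[ℂ] (C(unitInterval, ℂ) × C(unitInterval, ℂ)) :=
  LinearEquiv.toContinuousLinearEquivOfBounds
    { toFun := fun φ => (⟨fun x => φ (x, false), by fun_prop⟩, ⟨fun x => φ (x, true), by fun_prop⟩)
      invFun := fun p => ⟨fun z => if z.2 then p.2 z.1 else p.1 z.1,
        continuous_prod_of_discrete_right.2 fun b => by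
          cases b
          · simpa using p.1.continuous
          · simpa using p.2.continuous⟩
      map_add' := fun _ _ => rfl
      map_smul' := fun _ _ => rfl
      left_inv := fun φ => by
        ext ⟨x, b⟩
        cases b <;> rfl
      right_inv := fun _ => rfl }
    1 1 (fun φ => by
      rw [one_mul]
      exact norm_prod_le_iff.2 ⟨(ContinuousMap.norm_le _ (norm_nonneg _)).2 fun x =>
        φ.norm_coe_le_norm _, (ContinuousMap.norm_le _ (norm_nonneg _)).2 fun x =>
        φ.norm_coe_le_norm _⟩)
    (fun p => by
      rw [one_mul]
      refine (ContinuousMap.norm_le _ (norm_nonneg _)).2 fun z => ?_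
      obtain ⟨x, b⟩ := z
      cases b
      · exact (p.1.norm_coe_le_norm x).trans (norm_fst_le p)
      · exact (p.2.norm_coe_le_norm x).trans (norm_snd_le p))

theorem nystromSum_apply_apply (t : ℝ) (M N : ℕ) (φ : C(CellSpace, ℂ)) (x : unitInterval)
    (b : Bool) : Γ.nystromSum t M N φ (x, b) = 1 / (N : ℂ) * ∑ q : Fin N, ∑ b' : Bool,
      Γ.blochKernel t M (x, b) (midpointNode N q, b') * φ (unitNode N q, b') := by
  rw [nystromSum_apply, ContinuousMap.sum_apply]
  simp only [nystromBlock_apply, ContinuousMap.smul_apply, ContinuousMap.sum_apply, smul_eq_mul,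
    blockColumn_apply, blochKernel, Finset.sum_mul, Finset.mul_sum]
  rw [Finset.sum_comm]
  refine Finset.sum_congr rfl fun q _ => ?_
  rw [Finset.sum_comm]
  refine Finset.sum_congr rfl fun b' _ => Finset.sum_congr rfl fun j _ => ?_
  simp only [unitNode, cellIncl]
  ring

/-- The pair system is similar to the scalar operator on the two-branch cell, so the collectively
compact theory transfers to its spectrum. -/
theorem operator_cellEquiv (t : ℝ) (M N : ℕ) (φ : C(CellSpace, ℂ)) :
    Γ.operator t M N (cellEquiv φ) = cellEquiv (Γ.nystromSum t M N φ) := by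
  refine Prod.ext ?_ ?_
  · ext x
    change (Γ.operator t M N (cellEquiv φ)).1 x = Γ.nystromSum t M N φ (x, false)
    rw [nystromSum_apply_apply, operator_apply_fst, ← mul_add, ← Finset.sum_add_distrib]
    refine congrArg _ (Finset.sum_congr rfl fun q _ => ?_)
    rw [Fintype.sum_bool, add_comm, ← diagKernel_eq, ← Γ.offKernel_eq Bool.false_ne_true,
      branch_true, branch_false]
    rfl
  · ext x
    change (Γ.operator t M N (cellEquiv φ)).2 x = Γ.nystromSum t M N φ (x, true)
    rw [nystromSum_apply_apply, operator_apply_snd, ← mul_add, ← Finset.sum_add_distrib]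
    refine congrArg _ (Finset.sum_congr rfl fun q _ => ?_)
    rw [Fintype.sum_bool, add_comm, ← diagKernel_eq, ← Γ.offKernel_eq Bool.false_ne_true.symm,
      branch_true, branch_false]
    rfl

theorem spectrum_operator_eq_nystromSum (t : ℝ) (M N : ℕ) :
    spectrum ℂ (Γ.operator t M N) = spectrum ℂ (Γ.nystromSum t M N) := by
  have h := AlgEquiv.spectrum_eq
    cellEquiv.conjContinuousAlgEquiv.toAlgEquiv
    (Γ.nystromSum t M N)
  rw [← h]
  refine congrArg _ (ContinuousLinearMap.ext fun p => ?_)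
  have h1 := Γ.operator_cellEquiv t M N (cellEquiv.symm p)
  rw [cellEquiv.apply_symm_apply] at h1
  exact h1

end AnalyticDilationGraph

/-! ### Spectra along a collectively compact sequence -/

theorem CollectivelyCompactTendsto.isCompactOperator_apply {E : Type*} [NormedAddCommGroup E]
    [NormedSpace ℂ E] {T : ℕ → E →L[ℂ] E} {T₀ : E →L[ℂ] E} (h : CollectivelyCompactTendsto T T₀)
    (n : ℕ) : IsCompactOperator (T n) := by
  obtain ⟨K, hK, hTK⟩ := h.exists_compact
  refine (isCompactOperator_iff_image_closedBall_subset_compact (T n : E →ₗ[ℂ] E) one_pos).2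
    ⟨K, hK, ?_⟩
  rintro _ ⟨φ, hφ, rfl⟩
  exact hTK n φ (by simpa using hφ)

theorem CollectivelyCompactTendsto.exists_norm_le_of_mem_spectrum {E : Type*}
    [NormedAddCommGroup E] [NormedSpace ℂ E] [CompleteSpace E] {T : ℕ → E →L[ℂ] E}
    {T₀ : E →L[ℂ] E} (h : CollectivelyCompactTendsto T T₀) :
    ∃ C : ℝ, ∀ n, ∀ μ ∈ spectrum ℂ (T n), ‖μ‖ ≤ C := by
  obtain ⟨C, hC0, hC⟩ := h.exists_norm_le
  refine ⟨C * ‖(1 : E →L[ℂ] E)‖, fun n μ hμ => ?_⟩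
  exact (spectrum.norm_le_norm_mul_of_mem hμ).trans
    (mul_le_mul_of_nonneg_right (hC n) (norm_nonneg _))

/-- Upper semicontinuity of the spectrum off `0`. -/
theorem CollectivelyCompactTendsto.hasEigenvalue_of_mem_spectrum {E : Type*} [NormedAddCommGroup E]
    [NormedSpace ℂ E] [CompleteSpace E] {T : ℕ → E →L[ℂ] E} {T₀ : E →L[ℂ] E}
    (h : CollectivelyCompactTendsto T T₀) {μ : ℕ → ℂ} {μ₀ : ℂ} (hμ : Tendsto μ atTop (𝓝 μ₀))
    (hμ0 : ∀ n, μ n ≠ 0) (hμ₀ : μ₀ ≠ 0) (hT : ∀ n, μ n ∈ spectrum ℂ (T n)) :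
    Module.End.HasEigenvalue (T₀ : Module.End ℂ E) μ₀ := by
  have h1 : ∀ n, ∃ φ : E, ‖φ‖ = 1 ∧ T n φ - μ n • φ = 0 := fun n => by
    obtain ⟨v, hv⟩ := (((h.isCompactOperator_apply n).hasEigenvalue_iff_mem_spectrum
      (hμ0 n)).2 (hT n)).exists_hasEigenvector
    have hv' : T n v = μ n • v := hv.apply_eq_smul
    have hv0 : ‖v‖ ≠ 0 := norm_ne_zero_iff.2 hv.2
    refine ⟨((‖v‖ : ℂ)⁻¹) • v, ?_, ?_⟩
    · rw [norm_smul, norm_inv, Complex.norm_real, norm_norm, inv_mul_cancel₀ hv0]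
    · rw [map_smul, hv', smul_comm, sub_self]
  choose φ hφ hTφ using h1
  exact h.hasEigenvalue_of_tendsto hμ hμ₀ hφ (by simp only [hTφ]; exact tendsto_const_nhds)

namespace AnalyticDilationGraph

variable (Γ : AnalyticDilationGraph)

/-! ### Sample points -/

theorem samplePoints_subset (m : ℕ) : samplePoints m ⊆ Icc (-Real.pi) Real.pi := by
  rintro t ⟨k, hk1, hkm, ht⟩
  have hk : (1 : ℝ) ≤ k := by exact_mod_cast hk1
  have hkm' : (k : ℝ) ≤ m := by exact_mod_cast hkm
  have hpi := Real.pi_pos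
  have h0 : 0 ≤ ((k : ℝ) - 1 / 2) * Real.pi / m :=
    div_nonneg (mul_nonneg (by linarith) hpi.le) (by linarith)
  have h1 : ((k : ℝ) - 1 / 2) * Real.pi / m ≤ Real.pi := by
    rw [div_le_iff₀ (by linarith), mul_comm Real.pi]
    exact mul_le_mul_of_nonneg_right (by linarith) hpi.le
  rcases ht with rfl | rfl
  · exact ⟨by linarith, h1⟩
  · exact ⟨by linarith, by linarith⟩

theorem exists_samplePoint_near {m : ℕ} (hm : 1 ≤ m) {t : ℝ} (ht : t ∈ Icc (-Real.pi) Real.pi) :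
    ∃ s ∈ samplePoints m, dist s t ≤ Real.pi / m := by
  have hpi := Real.pi_pos
  have hm' : (0 : ℝ) < m := by exact_mod_cast hm
  have key : ∀ r : ℝ, 0 ≤ r → r ≤ Real.pi → ∃ k : ℕ, 1 ≤ k ∧ k ≤ m ∧
      |((k : ℝ) - 1 / 2) * Real.pi / m - r| ≤ Real.pi / m := fun r hr0 hr => by
    have hx0 : 0 ≤ r * m / Real.pi := by positivity
    have hxm : r * m / Real.pi ≤ m := by
      rw [div_le_iff₀ hpi, mul_comm (m : ℝ)]
      exact mul_le_mul_of_nonneg_right hr hm'.le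
    have hk1 : ((max 1 ⌈r * m / Real.pi⌉₊ : ℕ) : ℝ) ≤ r * m / Real.pi + 1 := by
      rw [Nat.cast_max]
      exact max_le (by push_cast; linarith) (Nat.ceil_lt_add_one hx0).le
    have hk2 : r * m / Real.pi ≤ ((max 1 ⌈r * m / Real.pi⌉₊ : ℕ) : ℝ) :=
      (Nat.le_ceil _).trans (by exact_mod_cast le_max_right _ _)
    -- The ceiling selects the interval containing `r`; the maximum handles `r = 0`, where it would
    -- give the inadmissible index `0`.
    refine ⟨max 1 ⌈r * m / Real.pi⌉₊, le_max_left _ _, max_le hm (Nat.ceil_le.2 hxm), ?_⟩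
    generalize ((max 1 ⌈r * m / Real.pi⌉₊ : ℕ) : ℝ) = k at hk1 hk2
    have h1 : (k - 1 / 2) * Real.pi / m - r = (k - 1 / 2 - r * m / Real.pi) * (Real.pi / m) := by
      field_simp
    rw [h1, abs_mul, abs_of_pos (div_pos hpi hm')]
    exact mul_le_of_le_one_left (by positivity) (abs_le.2 ⟨by linarith, by linarith⟩)
  rcases le_total 0 t with h | h
  · obtain ⟨k, hk1, hk2, hk⟩ := key t h ht.2
    exact ⟨_, ⟨k, hk1, hk2, Or.inl rfl⟩, hk⟩
  · obtain ⟨k, hk1, hk2, hk⟩ := key (-t) (by linarith) (by linarith [ht.1])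
    refine ⟨_, ⟨k, hk1, hk2, Or.inr rfl⟩, ?_⟩
    rwa [Real.dist_eq, ← abs_neg, neg_sub, sub_neg_eq_add, add_comm, ← sub_neg_eq_add]

theorem exists_samplePoint_sequence {m : ℕ → ℕ} (hm : Tendsto m atTop atTop) {t : ℝ}
    (ht : t ∈ Icc (-Real.pi) Real.pi) : ∃ s : ℕ → ℝ, (∀ N, 1 ≤ m N → s N ∈ samplePoints (m N)) ∧
      Tendsto s atTop (𝓝 t) := by
  have h : ∀ N, ∃ s, 1 ≤ m N → s ∈ samplePoints (m N) ∧ dist s t ≤ Real.pi / m N := fun N => by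
    by_cases hN : 1 ≤ m N
    · obtain ⟨s, hs⟩ := exists_samplePoint_near hN ht
      exact ⟨s, fun _ => hs⟩
    · exact ⟨0, fun h => absurd h hN⟩
  choose s hs using h
  refine ⟨s, fun N hN => (hs N hN).1, tendsto_iff_dist_tendsto_zero.2 ?_⟩
  have h1 : Tendsto (fun N => Real.pi / (m N : ℝ)) atTop (𝓝 0) :=
    tendsto_const_nhds.div_atTop (tendsto_natCast_atTop_atTop.comp hm)
  refine squeeze_zero' (Eventually.of_forall fun _ => dist_nonneg) ?_ h1
  filter_upwards [hm.eventually_ge_atTop 1] with N hN using (hs N hN).2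

/-! ### Convergence of the spectra -/

theorem mem_approxSpectrum_iff {m M N : ℕ} {l : ℂ} : l ∈ Γ.approxSpectrum m M N ↔
    ∃ t ∈ samplePoints m, l ∈ spectrum ℂ (Γ.nystromSum t M N) := by
  simp only [approxSpectrum, spectrum_operator_eq_nystromSum, mem_iUnion, exists_prop]

theorem eventually_approxSpectrum_near {m M : ℕ → ℕ} (hM : Tendsto M atTop atTop) {δ : ℝ}
    (hδ : 0 < δ) : ∀ᶠ N in atTop, ∀ l ∈ Γ.approxSpectrum (m N) (M N) N,
      ∃ μ ∈ spectrum ℂ Γ.logOperator, dist l μ < δ := by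
  by_contra hcon
  obtain ⟨u, hu, hbad⟩ := extraction_of_frequently_atTop (not_eventually.1 hcon)
  push Not at hbad
  choose l hl hfar using hbad
  simp only [mem_approxSpectrum_iff] at hl
  choose t ht hlt using hl
  -- Since `0` is in the limit spectrum, points far from that spectrum are far from `0`, where
  -- eigenvalue convergence applies.
  have hl0 : ∀ n, δ ≤ ‖l n‖ := fun n => by
    have := hfar n 0 Γ.zero_mem_spectrum_logOperator
    rwa [dist_zero_right] at this
  obtain ⟨t₀, -, v, hv, hvt⟩ := isCompact_Icc.tendsto_subseq fun n => samplePoints_subset _ (ht n)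
  have huv : Tendsto (fun n => u (v n)) atTop atTop := hu.tendsto_atTop.comp hv.tendsto_atTop
  have hcc := Γ.collectivelyCompactTendsto_nystromSum hvt (hM.comp huv) huv
  obtain ⟨C, hC⟩ := hcc.exists_norm_le_of_mem_spectrum
  have hbd : ∀ n, l (v n) ∈ Metric.closedBall (0 : ℂ) C := fun n =>
    mem_closedBall_zero_iff.2 (hC n _ (hlt (v n)))
  obtain ⟨l₀, -, w, hw, hwl⟩ := (isCompact_closedBall (0 : ℂ) C).tendsto_subseq hbd
  have hl₀ : δ ≤ ‖l₀‖ := ge_of_tendsto' hwl.norm fun n => hl0 _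
  have hne : l₀ ≠ 0 := norm_pos_iff.1 (hδ.trans_le hl₀)
  have hev := (hcc.comp hw.tendsto_atTop).hasEigenvalue_of_mem_spectrum hwl
    (fun n => norm_pos_iff.1 (hδ.trans_le (hl0 _))) hne fun n => hlt (v (w n))
  have hmem := Γ.mem_spectrum_logOperator_of_hasEigenvalue hev
  have hlim := tendsto_iff_dist_tendsto_zero.1 hwl
  obtain ⟨n, hn⟩ := (hlim.eventually_lt_const hδ).exists
  exact absurd (hfar _ l₀ hmem) (not_le.2 hn)

theorem eventually_spectrum_near {m M : ℕ → ℕ} (hm : Tendsto m atTop atTop)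
    (hM : Tendsto M atTop atTop) {δ : ℝ} (hδ : 0 < δ) :
    ∀ᶠ N in atTop, ∀ l ∈ spectrum ℂ Γ.logOperator,
      ∃ μ ∈ Γ.approxSpectrum (m N) (M N) N, dist l μ < δ := by
  by_contra hcon
  obtain ⟨u, hu, hbad⟩ := extraction_of_frequently_atTop (not_eventually.1 hcon)
  push Not at hbad
  choose l hl hfar using hbad
  -- Compactness of the spectrum replaces the moving bad points by one limit `l₀`, for which
  -- pointwise approximation suffices. For `l₀ = 0` the approximating set contains `0` itself.
  obtain ⟨l₀, hl₀, v, hv, hvl⟩ := (spectrum.isCompact Γ.logOperator).tendsto_subseq hl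
  have huv : Tendsto (fun n => u (v n)) atTop atTop := hu.tendsto_atTop.comp hv.tendsto_atTop
  have hclose := (tendsto_iff_dist_tendsto_zero.1 hvl).eventually_lt_const (half_pos hδ)
  have hm1 := (hm.comp huv).eventually_ge_atTop 1
  have hex : ∀ᶠ n in atTop, ∃ μ ∈ Γ.approxSpectrum (m (u (v n))) (M (u (v n))) (u (v n)),
      ‖μ - l₀‖ < δ / 2 := by
    by_cases hne : l₀ = 0
    · filter_upwards [hm1] with n hn
      refine ⟨0, ?_, by rw [hne, sub_zero, norm_zero]; exact half_pos hδ⟩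
      rw [Γ.approxSpectrum_eq (m := m (u (v n))) hn]
      exact Or.inl rfl
    · obtain ⟨t₀, ht₀, hev⟩ := Γ.exists_hasEigenvalue_of_mem_spectrum hne hl₀
      obtain ⟨s, hs, hst⟩ := exists_samplePoint_sequence hm ht₀
      have hcc := Γ.collectivelyCompactTendsto_nystromSum (hst.comp huv) (hM.comp huv) huv
      filter_upwards [hm1, hcc.eventually_exists_mem_spectrum hne hev (half_pos hδ)]
        with n hn ⟨μ, hμ, hμl⟩
      exact ⟨μ, Γ.mem_approxSpectrum_iff.2 ⟨_, hs _ hn, hμ⟩, hμl⟩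
  obtain ⟨n, hn, μ, hμ, hμl⟩ := (hclose.and hex).exists
  refine absurd (hfar _ μ hμ) (not_le.2 ?_)
  have htri := dist_triangle (l (v n)) l₀ μ
  have h2 : dist l₀ μ < δ / 2 := by rwa [dist_comm, dist_eq_norm]
  have h3 : dist (l (v n)) l₀ < δ / 2 := hn
  linarith

theorem tendsto_hausdorffEDist {m M : ℕ → ℕ} (hm : Tendsto m atTop atTop)
    (hM : Tendsto M atTop atTop) : Tendsto (fun N : ℕ =>
      Metric.hausdorffEDist (Γ.approxSpectrum (m N) (M N) N) (spectrum ℂ Γ.logOperator))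
      atTop (𝓝 0) := by
  rw [ENNReal.tendsto_nhds_zero]
  intro ε hε
  obtain ⟨δ, hδ, hδε⟩ := ENNReal.lt_iff_exists_nnreal_btwn.1 hε
  have hδ' : 0 < (δ : ℝ) := by exact_mod_cast hδ
  have hed : ∀ x y : ℂ, dist x y < δ → edist x y ≤ ε := fun x y h => by
    refine le_trans ?_ hδε.le
    rw [edist_nndist]
    exact_mod_cast h.le
  filter_upwards [Γ.eventually_approxSpectrum_near (m := m) hM hδ',
    Γ.eventually_spectrum_near hm hM hδ'] with N h1 h2
  refine Metric.hausdorffEDist_le_of_mem_edist (fun l hl => ?_) fun l hl => ?_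
  · obtain ⟨μ, hμ, hd⟩ := h1 l hl
    exact ⟨μ, hμ, hed _ _ hd⟩
  · obtain ⟨μ, hμ, hd⟩ := h2 l hl
    exact ⟨μ, hμ, hed _ _ hd⟩

end AnalyticDilationGraph

end

/-! ### The main theorem -/

theorem mainTheorem2 (Γ : AnalyticDilationGraph) (m M : ℕ → ℕ)
    (hm_pos : ∀ N : ℕ, 1 ≤ N → 1 ≤ m N)
    (hm : Tendsto m atTop atTop) (hM : Tendsto M atTop atTop) :
    (∃! D : Γ.L2 →L[ℂ] Γ.L2, Γ.IsDoubleLayer D) ∧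
    (∀ N : ℕ, 1 ≤ N →
      Γ.approxSpectrum (m N) (M N) N =
        {0} ∪ ⋃ t ∈ AnalyticDilationGraph.samplePoints (m N),
          spectrum ℂ (Γ.matrix t (M N) N)) ∧
    ∀ D : Γ.L2 →L[ℂ] Γ.L2, Γ.IsDoubleLayer D →
      spectrum ℂ D = essentialSpectrum D ∧
      Tendsto (fun N : ℕ => Metric.hausdorffEDist (Γ.approxSpectrum (m N) (M N) N) (spectrum ℂ D))
        atTop (𝓝 0) := by
  refine ⟨⟨Γ.doubleLayer, Γ.isDoubleLayer_doubleLayer, fun D hD =>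
    Γ.eq_of_isDoubleLayer hD Γ.isDoubleLayer_doubleLayer⟩,
    fun N hN => Γ.approxSpectrum_eq (hm_pos N hN) _ _, fun D hD => ?_⟩
  rw [Γ.eq_of_isDoubleLayer hD Γ.isDoubleLayer_doubleLayer]
  refine ⟨Γ.spectrum_doubleLayer_eq_essentialSpectrum, ?_⟩
  rw [Γ.spectrum_doubleLayer]
  exact Γ.tendsto_hausdorffEDist hm hM
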